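/- Let $n\in\{2,3\}$, let $\Omega\subset\mathbb R^n$ be open and bounded (for instance a bounded Lipschitz domain), and let $V_h\subset H^1_0(\Omega)$ be a finite-dimensional subspace (all spaces complexified) with norm $\|v\|_{V_h}^2=\|\nabla v\|_{L^2}^2+\kappa\|v\|_{L^2}^2$, where $\kappa\in\{0,1\}$ is fixed (either of the usual $H^1_0$-norms). Let $V_h\subseteq H\subseteq V_h^\star$, where $H$ is $V_h$ with the $L^2(\Omega)$-norm and $V_h^\star$ carries the dual norm. Let $A_h=-\Delta:V_h\to V_h^\star$, $\langle A_hv,w\rangle=\int_\Omega\nabla v\cdot\overline{\nabla w}$; let $\Pi_h$ and $Q_h$ be the $L^2(\Omega)$- and the $H^1(\Omega)$-orthogonal projections onto $V_h$. Write $\widehat g(s)=\int_0^\infty e^{-st}g(t)\,dt$, $\ \|g\|_{\mathscr H^2_\alpha(X)}^2=\sup_{\sigma>\alpha}\int_{\mathbb R}\|g(\sigma+\imath\tau)\|_X^2\frac{d\tau}{2\pi}$, and $g\in L^2_\alpha(\mathbb R_+;X)$ if $\int_0^\infty e^{-2\alpha t}\|g(t)\|_X^2\,dt<\infty$. For $0<d<\pi/2$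 let $\mathcal D_d=\{z\in\mathbb C:|\arg(z+\sqrt{1+z^2})|<d\}$, and let $\mathcal N_2(\mathcal D_d;X)$ be the space of analytic $F:\mathcal D_d\to X$ with $\|F\|_{\mathcal N_2(\mathcal D_d;X)}^2=\int_{\partial\mathcal D_d}\|F\|_X^2\,|dz|<\infty$, the boundary integral being understood in the Hardy-space sense as $\sup_{0<y<d}\int_{\partial\mathcal D_y}\|F\|_X^2\,|dz|$. For a function $g$ on $\mathbb R_+$, $\widehat g(\alpha+\imath\,\cdot)\in\mathcal N_2(\mathcal D_d;X)$ means that $z\mapsto\widehat g(\alpha+\imath z)$, $\operatorname{Im}z<0$, has an analytic extension to $\mathcal D_d$ which lies in that space; it is denoted by the same symbol. Let $\alpha\ge1$, $0<d<\pi/2$ and $C_0\in\mathbb R$. Let $f:\mathbb R_+\to V_h^\star$ satisfy $f\in L^2_\alpha(\mathbb R_+;V_h^\star)$, $\partial_tf\in L^2(\mathbb R_+;V_h^\star)$, $\widehat f(\alpha+\imath\,\cdot),\ \widehat{\partial_tf}(\alpha+\imath\,\cdot)\in\mathcal N_2(\mathcal D_d;V_h^\star)$, $f(0)\in H^1(\Omega)$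 (that is, the functional $f(0)\in V_h^\star$ is the $L^2$-pairing with a function in $H^1(\Omega)$, also denoted $f(0)$), and $$\|\widehat f(\alpha+\imath\tau)\|_{V_h^\star}+\|\widehat{\partial_tf}(\alpha+\imath\tau)\|_{V_h^\star}\le\frac{C_0}{\sqrt{1+\tau^2}},\qquad\tau\in\mathbb R .$$ Let $u_0\in H^2(\Omega)$, $u_{0,h}=Q_hu_0$, and let $u_h:[0,\infty)\to V_h$ solve $(\partial_t+A_h)u_h=f$ in $V_h^\star$ for a.e. $t>0$, $u_h(0)=u_{0,h}$. For a subspace $V_R\subset V_h$, with $\mathsf P_{V_R}$ the $V_h$-orthogonal projection onto $V_R$, put $$\varepsilon(V_R)=\|\widehat{u_h}-\mathsf P_{V_R}\widehat{u_h}\|_{\mathscr H^2_\alpha(V_h)}^2+\|\widehat{\partial_tu_h}-\widehat{\partial_t\mathsf P_{V_R}u_h}\|_{\mathscr H^2_\alpha(V_h^\star)}^2 .$$ Then there are a constant $C(d,\alpha)>0$ depending only on $d$ and $\alpha$, with $C(d,\alpha)\to\infty$ as $d\to\pi/2$, and a constant $c>0$ depending only on $n$, $\Omega$, $\kappa$ and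 $C_0$ such that for every integer $R\ge1$ $$\inf_{V_R\subset V_h,\ \dim V_R\le R}\varepsilon(V_R)\le c\,C(d,\alpha)\,R^{1/2}\exp\Big(-2\sqrt{\tfrac{\pi dR}{4}}\Big)\,\mathcal B,$$ $$\mathcal B=\|\widehat f(\alpha+\imath\,\cdot)\|_{\mathcal N_2(\mathcal D_d;V_h^\star)}^2+\|\widehat{\partial_tf}(\alpha+\imath\,\cdot)\|_{\mathcal N_2(\mathcal D_d;V_h^\star)}^2+1+\|\Pi_h(f(0))\|_{V_h}^2+\|\Pi_h(\Delta u_0)\|_{V_h}^2+\|u_{0,h}-\Pi_hu_0\|_{V_h}^2+\|u_0\|_{H^2(\Omega)}^2 .$$ Moreover, for $R=2K+2$ with an integer $K\ge1$, the bound holds for a space spanned by sinc-point solutions: with $\vartheta=\sqrt{2\pi d/K}$ and $s_k=\alpha+\imath\sinh(k\vartheta)$, the space $V_R=\operatorname{span}\{u_{0,h},\widehat u_h(s_{-K}),\dots,\widehat u_h(s_K)\}$, where $(s_k+A_h)\widehat u_h(s_k)=\widehat f(s_k)+u_{0,h}$ in $V_h^\star$, satisfies $\varepsilon(V_R)\le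 c\,C(d,\alpha)\,R^{1/2}\exp(-2\sqrt{\pi dR/4})\,\mathcal B$. -/

import Mathlib

open MeasureTheory Filter Topology Set
open scoped ENNReal ContDiff

noncomputable section

namespace LaplaceRB

/-! ### Sobolev spaces of complex-valued functions on an open set `Ω ⊆ ℝⁿ` -/

/-- Euclidean space `ℝⁿ`. -/
abbrev RSpace (n : ℕ) := EuclideanSpace ℝ (Fin n)

/-- `ℂⁿ` with its Hermitian norm (values of gradients). -/
abbrev CSpace (n : ℕ) := EuclideanSpace ℂ (Fin n)

/-- The Lebesgue space `L²(Ω; X)`. -/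
abbrev L2 {n : ℕ} (Ω : Set (RSpace n)) (X : Type) [NormedAddCommGroup X] :=
  Lp X 2 (volume.restrict Ω)

/-- `φ ∈ C_c^∞(Ω)`. -/
structure IsTestFunction {n : ℕ} (Ω : Set (RSpace n)) (φ : RSpace n → ℂ) : Prop where
  smooth : ContDiff ℝ ∞ φ
  compact : HasCompactSupport φ
  support : tsupport φ ⊆ Ω

/-- The classical partial derivative `∂_i φ`. -/
def partialDeriv {n : ℕ} (i : Fin n) (φ : RSpace n → ℂ) (x : RSpace n) : ℂ :=
  fderiv ℝ φ x (EuclideanSpace.single i 1)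

/-- `w` is the weak partial derivative `∂_i u` on `Ω`. -/
def HasWeakPartial {n : ℕ} (Ω : Set (RSpace n)) (i : Fin n) (u w : RSpace n → ℂ) : Prop :=
  ∀ φ : RSpace n → ℂ, IsTestFunction Ω φ →
    ∫ x in Ω, u x * partialDeriv i φ x = - ∫ x in Ω, w x * φ x

/-- An element of `H¹(Ω)`: a function in `L²(Ω)` with its weak gradient in `L²(Ω)ⁿ`. -/
structure H1 {n : ℕ} (Ω : Set (RSpace n)) where
  val : L2 Ω ℂ
  grad : L2 Ω (CSpace n)
  weak_grad : ∀ i, HasWeakPartial Ω i (fun x => val x) (fun x => grad x i)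

/-- An element of `H²(Ω)`: an element of `H¹(Ω)` with its weak Hessian in `L²(Ω)^{n × n}`. -/
structure H2 {n : ℕ} (Ω : Set (RSpace n)) extends H1 Ω where
  hess : L2 Ω (EuclideanSpace ℂ (Fin n × Fin n))
  weak_hess : ∀ i j, HasWeakPartial Ω j (fun x => grad x i) (fun x => hess x (i, j))

/-- The squared `H²(Ω)` norm. -/
def H2.normSq {n : ℕ} {Ω : Set (RSpace n)} (u : H2 Ω) : ℝ :=
  ‖u.val‖ ^ 2 + ‖u.grad‖ ^ 2 + ‖u.hess‖ ^ 2

/-- The Laplacian `Δu = ∑ i, ∂_i ∂_i u ∈ L²(Ω)` of `u ∈ H²(Ω)`. -/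
def H2.laplacian {n : ℕ} {Ω : Set (RSpace n)} (u : H2 Ω) : L2 Ω ℂ :=
  (∑ i : Fin n, (EuclideanSpace.proj (i, i) :
    EuclideanSpace ℂ (Fin n × Fin n) →L[ℂ] ℂ)).compLp u.hess

/-- `H¹₀(Ω)`, as the set of pairs `(v, ∇v)`: the closure of `{(φ, ∇φ) | φ ∈ C_c^∞(Ω)}` in
`L²(Ω) × L²(Ω)ⁿ`. -/
def H10 {n : ℕ} (Ω : Set (RSpace n)) : Set (L2 Ω ℂ × L2 Ω (CSpace n)) :=
  closure {p | ∃ φ : RSpace n → ℂ, IsTestFunction Ω φ ∧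
    (∀ᵐ x ∂(volume.restrict Ω), p.1 x = φ x) ∧
    (∀ᵐ x ∂(volume.restrict Ω), ∀ i, p.2 x i = partialDeriv i φ x)}

/-! ### The discrete space, its dual, and the discrete operators -/

/-- `V` is (a copy of) a subspace of `H¹₀(Ω)`: each `v : V` stands for the pair `emb v = (v, ∇v)`,
and the Hilbert norm of `V` is `‖v‖² = ‖∇v‖²_{L²} + κ ‖v‖²_{L²}`. The two usual meanings of the
`H¹₀(Ω)` norm are `κ = 0` and `κ = 1`. -/
structure DiscreteSpace {n : ℕ} (κ : ℝ) (Ω : Set (RSpace n)) (V : Type)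
    [NormedAddCommGroup V] [InnerProductSpace ℂ V] where
  emb : V →ₗ[ℂ] L2 Ω ℂ × L2 Ω (CSpace n)
  emb_mem : ∀ v, emb v ∈ H10 Ω
  norm_sq : ∀ v, ‖v‖ ^ 2 = ‖(emb v).2‖ ^ 2 + κ * ‖(emb v).1‖ ^ 2

/-- The dual `V⋆` of `V`: antilinear functionals with the dual (operator) norm. -/
abbrev AntiDual (V : Type) [NormedAddCommGroup V] [InnerProductSpace ℂ V] := V →L⋆[ℂ] ℂ

namespace DiscreteSpace

variable {n : ℕ} {κ : ℝ} {Ω : Set (RSpace n)} {V : Type}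
  [NormedAddCommGroup V] [InnerProductSpace ℂ V] [FiniteDimensional ℂ V]

/-- The functional `w ↦ ∫_Ω g w̄` in `V⋆`, for `g ∈ L²(Ω)`. -/
def l2Functional (S : DiscreteSpace κ Ω V) (g : L2 Ω ℂ) : AntiDual V :=
  (innerSLFlip ℂ g).comp
    (LinearMap.toContinuousLinearMap ((LinearMap.fst ℂ _ _).comp S.emb))

/-- The functional `w ↦ ∫_Ω g · ∇w̄` in `V⋆`, for `g ∈ L²(Ω)ⁿ`. -/
def gradFunctional (S : DiscreteSpace κ Ω V) (g : L2 Ω (CSpace n)) : AntiDual V :=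
  (innerSLFlip ℂ g).comp
    (LinearMap.toContinuousLinearMap ((LinearMap.snd ℂ _ _).comp S.emb))

/-- The embedding `V ⊆ H ⊆ V⋆` of the Gelfand triple, where `H` is `V` with the `L²` norm. -/
def toDual (S : DiscreteSpace κ Ω V) (v : V) : AntiDual V :=
  S.l2Functional (S.emb v).1

/-- The discrete operator `A_h = -Δ : V → V⋆`. -/
def A (S : DiscreteSpace κ Ω V) (v : V) : AntiDual V :=
  S.gradFunctional (S.emb v).2

/-- `v = Π_h g`, the `L²(Ω)`-orthogonal projection of `g` onto `V`. -/
def IsL2Proj (S : DiscreteSpace κ Ω V) (g : L2 Ω ℂ) (v : V) : Prop :=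
  ∀ w : V, inner ℂ (S.emb w).1 ((S.emb v).1 - g) = 0

/-- `v = Q_h u`, the `H¹(Ω)`-orthogonal projection of `u` onto `V`. -/
def IsH1Proj (S : DiscreteSpace κ Ω V) (u : H1 Ω) (v : V) : Prop :=
  ∀ w : V, inner ℂ (S.emb w).1 ((S.emb v).1 - u.val) +
    inner ℂ (S.emb w).2 ((S.emb v).2 - u.grad) = 0

/-- `u`, with derivative `u'`, solves `(∂_t + A_h) u = f` in `V⋆` for a.e. `t > 0`, `u(0) = u₀`;
here `u' ∈ L²(0,T)` for all `T`, and `u` is the absolutely continuous primitive of `u'`. -/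
structure IsSolution (S : DiscreteSpace κ Ω V) (f : ℝ → AntiDual V) (u₀ : V) (u u' : ℝ → V) :
    Prop where
  memLp : ∀ T : ℝ, MemLp u' 2 (volume.restrict (Ioc 0 T))
  primitive : ∀ t : ℝ, 0 ≤ t → u t = u₀ + ∫ r in (0 : ℝ)..t, u' r
  equation : ∀ᵐ t ∂(volume.restrict (Ioi (0 : ℝ))), S.toDual (u' t) + S.A (u t) = f t

/-- `w` solves the Laplace-domain problem `(s + A_h) w = b` in `V⋆`. -/
def IsLaplaceSolution (S : DiscreteSpace κ Ω V) (s : ℂ) (b : AntiDual V) (w : V) : Prop :=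
  s • S.toDual w + S.A w = b

end DiscreteSpace

/-! ### Laplace transform, Hardy norm, and the class `N₂(D_d)` -/

section Laplace

variable {X : Type} [NormedAddCommGroup X] [NormedSpace ℂ X]

/-- `f ∈ L²_α(ℝ₊; X)`, that is `∫₀^∞ e^{-2αt} ‖f(t)‖² dt < ∞`. -/
def MemL2Weighted (α : ℝ) (f : ℝ → X) : Prop :=
  MemLp (fun t : ℝ => (Real.exp (-α * t) : ℂ) • f t) 2 (volume.restrict (Ioi 0))

/-- The Laplace transform `∫₀^∞ e^{-st} f(t) dt`. -/
def laplace (f : ℝ → X) (s : ℂ) : X :=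
  ∫ t in Ioi (0 : ℝ), Complex.exp (-s * t) • f t

/-- The squared norm of the Hardy space `ℋ²_α(X)`. -/
def hardySq (α : ℝ) (g : ℂ → X) : ℝ≥0∞ :=
  ⨆ σ ∈ Ioi α, (∫⁻ τ : ℝ, ‖g (σ + Complex.I * τ)‖ₑ ^ 2) / ENNReal.ofReal (2 * Real.pi)

/-- The domain `D_d = {z | |arg(z + √(1 + z²))| < d}` (principal branches). -/
def dom (d : ℝ) : Set ℂ :=
  {z | |Complex.arg (z + (1 + z ^ 2) ^ (1 / 2 : ℂ))| < d}

/-- `∫_{∂D_y} ‖F(z)‖² |dz|` for `0 < y < π/2`; the two branches of the hyperbola `∂D_y` are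
`x ↦ sinh(x ± iy)`. -/
def boundaryIntegral (y : ℝ) (F : ℂ → X) : ℝ≥0∞ :=
  (∫⁻ x : ℝ, ‖F (Complex.sinh (x + Complex.I * y))‖ₑ ^ 2 *
      ‖Complex.cosh (x + Complex.I * y)‖ₑ) +
  ∫⁻ x : ℝ, ‖F (Complex.sinh (x - Complex.I * y))‖ₑ ^ 2 *
      ‖Complex.cosh (x - Complex.I * y)‖ₑ

/-- The squared norm of `N₂(D_d; X)`. The integral over `∂D_d` is understood in the Hardy space
sense, through the curves `∂D_y ⊆ D_d`, `y < d`. -/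
def nTwoSq (d : ℝ) (F : ℂ → X) : ℝ≥0∞ :=
  ⨆ y ∈ Ioo 0 d, boundaryIntegral y F

/-- `F ∈ N₂(D_d; X)`. -/
def MemNTwo (d : ℝ) (F : ℂ → X) : Prop :=
  DifferentiableOn ℂ F (dom d) ∧ nTwoSq d F < ⊤

/-- The function `z ↦ f̂(α + iz)`, which the Laplace integral defines for `Im z < 0`, extends
analytically to `F` on `D_d`, and `F ∈ N₂(D_d; X)`. -/
structure LaplaceExtends (α d : ℝ) (f : ℝ → X) (F : ℂ → X) : Prop where
  mem : MemNTwo d F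
  eq_laplace : ∀ z ∈ dom d, z.im < 0 → F z = laplace f (α + Complex.I * z)

end Laplace

section Goal

variable {n : ℕ} {κ : ℝ} {Ω : Set (RSpace n)} {V : Type}
  [NormedAddCommGroup V] [InnerProductSpace ℂ V] [FiniteDimensional ℂ V]

/-- The goal functional `ε(V_R) = ‖û - P û‖²_{ℋ²_α(V)} + ‖(∂ₜu)^ - (∂ₜPu)^‖²_{ℋ²_α(V⋆)}` of the
subspace `V_R = W`, with `P` the `V`-orthogonal projection onto `W`; `u' = ∂ₜu`, and so
`∂ₜ(Pu) = P u'`. -/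
def goal (S : DiscreteSpace κ Ω V) (α : ℝ) (u u' : ℝ → V) (W : Submodule ℂ V) : ℝ≥0∞ :=
  hardySq α (fun s => laplace u s - W.starProjection (laplace u s)) +
  hardySq α (fun s => laplace (fun t => S.toDual (u' t)) s -
    laplace (fun t => S.toDual (W.starProjection (u' t))) s)

/-- The infimum of `ε(V_R)` over all subspaces `V_R ⊆ V` of dimension at most `R`. -/
def bestGoal (S : DiscreteSpace κ Ω V) (α : ℝ) (u u' : ℝ → V) (R : ℕ) : ℝ≥0∞ :=
  ⨅ W ∈ {W : Submodule ℂ V | Module.finrank ℂ W ≤ R}, goal S α u u' W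

/-- The sinc points `z_k = sinh(kϑ)`, for `ϑ = √(2πd/K)`. -/
def sincPoint (d : ℝ) (K : ℕ) (k : ℤ) : ℝ :=
  Real.sinh (k * Real.sqrt (2 * Real.pi * d / K))

/-- All hypotheses on the data: `f` and its derivative in time, the analytic extensions `F` and
`F'` of `z ↦ f̂(α + iz)` and of `z ↦ (∂ₜf)^(α + iz)`, the initial value `f₀ = f(0) ∈ H¹(Ω)`, and
the decay condition with constant `C₀`. -/
structure Admissible (S : DiscreteSpace κ Ω V) (α d C₀ : ℝ) (f f' : ℝ → AntiDual V)
    (F F' : ℂ → AntiDual V) (f₀ : H1 Ω) : Prop where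
  memL2 : MemL2Weighted α f
  extends_f : LaplaceExtends α d f F
  memLp_deriv : MemLp f' 2 (volume.restrict (Ioi (0 : ℝ)))
  primitive : ∀ t : ℝ, 0 ≤ t → f t = f 0 + ∫ r in (0 : ℝ)..t, f' r
  extends_deriv : LaplaceExtends α d f' F'
  initial : f 0 = S.l2Functional f₀.val
  decay : ∀ τ : ℝ, ‖F τ‖ + ‖F' τ‖ ≤ C₀ / Real.sqrt (1 + τ ^ 2)

/-- The rate `R^{1/2} exp(-2 √(π d R / 4))`. -/
def rate (d : ℝ) (R : ℕ) : ℝ :=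
  (R : ℝ) ^ (1 / 2 : ℝ) * Real.exp (-2 * Real.sqrt (Real.pi * d * R / 4))

end Goal

end LaplaceRB

end

/-!
For `A = A_h` and initial value `u₀`, the Laplace transform of the solution is
`û(s) = (s + A)⁻¹ (f̂(s) + u₀)`, and that of `∂ₜu` is the resolvent applied to the transform of
`∂ₜf` plus the initial value of `∂ₜu`. In an eigenbasis `s + A` acts by the symbol `s m + p`, which
for `s = α + i sinh (x + i y)` and `|y| < d` is at least `1 - sin d` times the larger of `p + α m`
and `m cosh x`. So both transforms extend analytically to `α + i D_d`, with a bound that does not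
see the discrete space. The substitution `z = sinh w` maps the strip `|Im w| < d` onto `D_d`, where
sinc interpolation converges exponentially: by the residue theorem its error is an integral over the
edges of the strip of a kernel that decays like `exp (-π d / θ)` in the step size `θ`. The values at
the interpolation nodes are the sinc-point solutions, and the projection error onto their span is at
most the interpolation error. The Poisson kernel of the half-plane reduces the supremum over `σ > α`
in the Hardy norms to the line `Re s = α`.
-/

noncomputable section

namespace LaplaceRB

section RectangleResidues

open scoped Interval

/-- The closed rectangle with opposite corners `z` and `w`. -/
def rect (z w : ℂ) : Set ℂ := [[z.re, w.re]] ×ℂ [[z.im, w.im]]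

/-- The four edges of `rect z w`. -/
def rectBoundary (z w : ℂ) : Set ℂ :=
  {v ∈ rect z w | v.re = z.re ∨ v.re = w.re ∨ v.im = z.im ∨ v.im = w.im}

theorem horizontal_mem_rectBoundary {z w : ℂ} {x y : ℝ} (hx : x ∈ [[z.re, w.re]])
    (hy : y = z.im ∨ y = w.im) : x + y * Complex.I ∈ rectBoundary z w := by
  have hy' : y ∈ [[z.im, w.im]] := by
    rcases hy with rfl | rfl
    exacts [left_mem_uIcc, right_mem_uIcc]
  simp [rectBoundary, rect, Complex.mem_reProdIm, hx, hy, hy']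

theorem vertical_mem_rectBoundary {z w : ℂ} {x y : ℝ} (hx : x = z.re ∨ x = w.re)
    (hy : y ∈ [[z.im, w.im]]) : x + y * Complex.I ∈ rectBoundary z w := by
  have hx' : x ∈ [[z.re, w.re]] := by
    rcases hx with rfl | rfl
    exacts [left_mem_uIcc, right_mem_uIcc]
  simp [rectBoundary, rect, Complex.mem_reProdIm, hx', hy, ← or_assoc, hx]

theorem rect_mem_nhds {z w p : ℂ} (hre : p.re ∈ Ioo z.re w.re) (him : p.im ∈ Ioo z.im w.im) :
    rect z w ∈ 𝓝 p :=
  mem_of_superset ((isOpen_Ioo.reProdIm isOpen_Ioo).mem_nhds ⟨hre, him⟩) fun _ hv =>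
    ⟨Icc_subset_uIcc (Ioo_subset_Icc_self hv.1), Icc_subset_uIcc (Ioo_subset_Icc_self hv.2)⟩

theorem notMem_rectBoundary {z w p : ℂ} (hre : p.re ∈ Ioo z.re w.re)
    (him : p.im ∈ Ioo z.im w.im) : p ∉ rectBoundary z w := by
  rintro ⟨-, h | h | h | h⟩
  exacts [hre.1.ne' h, hre.2.ne h, him.1.ne' h, him.2.ne h]

variable {E : Type*} [NormedAddCommGroup E]

theorem intervalIntegrable_horizontal {f : ℂ → E} {z w : ℂ}
    (hf : ContinuousOn f (rectBoundary z w)) {y : ℝ} (hy : y = z.im ∨ y = w.im) :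
    IntervalIntegrable (fun x : ℝ => f (x + y * Complex.I)) volume z.re w.re :=
  (hf.comp (by fun_prop) fun _ hx => horizontal_mem_rectBoundary hx hy).intervalIntegrable

theorem intervalIntegrable_vertical {f : ℂ → E} {z w : ℂ}
    (hf : ContinuousOn f (rectBoundary z w)) {x : ℝ} (hx : x = z.re ∨ x = w.re) :
    IntervalIntegrable (fun y : ℝ => f (x + y * Complex.I)) volume z.im w.im :=
  (hf.comp (by fun_prop) fun _ hy => vertical_mem_rectBoundary hx hy).intervalIntegrable

variable [NormedSpace ℂ E]

/-- The integral over the boundary of `rect z w`, counterclockwise when `z` is the lower left and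
`w` the upper right corner. -/
def rectIntegral (z w : ℂ) (f : ℂ → E) : E :=
  (∫ x : ℝ in z.re..w.re, f (x + z.im * Complex.I)) -
    (∫ x : ℝ in z.re..w.re, f (x + w.im * Complex.I)) +
    Complex.I • (∫ y : ℝ in z.im..w.im, f (w.re + y * Complex.I)) -
    Complex.I • (∫ y : ℝ in z.im..w.im, f (z.re + y * Complex.I))

theorem rectIntegral_congr {f g : ℂ → E} {z w : ℂ} (h : EqOn f g (rectBoundary z w)) :
    rectIntegral z w f = rectIntegral z w g := by
  unfold rectIntegral
  congr 1
  · congr 1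
    · congr 1 <;> refine intervalIntegral.integral_congr fun x hx => h ?_
      exacts [horizontal_mem_rectBoundary hx (.inl rfl), horizontal_mem_rectBoundary hx (.inr rfl)]
    · exact congrArg _ (intervalIntegral.integral_congr fun y hy =>
        h (vertical_mem_rectBoundary (.inr rfl) hy))
  · exact congrArg _ (intervalIntegral.integral_congr fun y hy =>
      h (vertical_mem_rectBoundary (.inl rfl) hy))

theorem rectIntegral_add {f g : ℂ → E} {z w : ℂ} (hf : ContinuousOn f (rectBoundary z w))
    (hg : ContinuousOn g (rectBoundary z w)) :
    rectIntegral z w (fun v => f v + g v) = rectIntegral z w f + rectIntegral z w g := by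
  unfold rectIntegral
  rw [intervalIntegral.integral_add (intervalIntegrable_horizontal hf (.inl rfl))
      (intervalIntegrable_horizontal hg (.inl rfl)),
    intervalIntegral.integral_add (intervalIntegrable_horizontal hf (.inr rfl))
      (intervalIntegrable_horizontal hg (.inr rfl)),
    intervalIntegral.integral_add (intervalIntegrable_vertical hf (.inr rfl))
      (intervalIntegrable_vertical hg (.inr rfl)),
    intervalIntegral.integral_add (intervalIntegrable_vertical hf (.inl rfl))
      (intervalIntegrable_vertical hg (.inl rfl))]
  module

theorem rectIntegral_smul_const [CompleteSpace E] (z w : ℂ) (f : ℂ → ℂ) (c : E) :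
    rectIntegral z w (fun v => f v • c) = rectIntegral z w f • c := by
  simp only [rectIntegral, intervalIntegral.integral_smul_const]
  module

theorem integral_inv_line {c β : ℂ} {a b : ℝ}
    (h : ∀ x ∈ [[a, b]], c + x * β ∈ Complex.slitPlane) :
    β * ∫ x : ℝ in a..b, (c + x * β)⁻¹ = Complex.log (c + b * β) - Complex.log (c + a * β) := by
  have hderiv : ∀ x ∈ [[a, b]],
      HasDerivAt (fun x : ℝ => Complex.log (c + x * β)) (β * (c + x * β)⁻¹) x := by
    intro x hx
    have hline : HasDerivAt (fun x : ℝ => c + x * β) β x := by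
      simpa using (Complex.ofRealCLM.hasDerivAt.mul_const β).const_add c
    simpa only [div_eq_mul_inv] using hline.clog_real (h x hx)
  have hcont : ContinuousOn (fun x : ℝ => β * (c + x * β)⁻¹) [[a, b]] :=
    continuousOn_const.mul
      (ContinuousOn.inv₀ (by fun_prop) fun x hx => Complex.slitPlane_ne_zero (h x hx))
  rw [← intervalIntegral.integral_const_mul,
    intervalIntegral.integral_eq_sub_of_hasDerivAt hderiv hcont.intervalIntegrable]

theorem log_neg_of_im_pos {z : ℂ} (hz : 0 < z.im) :
    Complex.log (-z) = Complex.log z - Real.pi * Complex.I := by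
  simp only [Complex.log, norm_neg, Complex.arg_neg_eq_arg_sub_pi_of_im_pos hz]
  push_cast
  ring

/-- The logarithm of `v - p` is a primitive on three edges; on the left edge it has to be replaced
by the logarithm of `p - v`, and the two jumps by `π i` add up to `2 π i`. -/
theorem rectIntegral_inv_sub {z w p : ℂ} (hre : p.re ∈ Ioo z.re w.re) (him : p.im ∈ Ioo z.im w.im) :
    rectIntegral z w (fun v => (v - p)⁻¹) = 2 * Real.pi * Complex.I := by
  have bottom := integral_inv_line (c := z.im * Complex.I - p) (β := 1) (a := z.re) (b := w.re)
    fun x _ => Or.inr (by simpa using (sub_neg.2 him.1).ne)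
  have top := integral_inv_line (c := w.im * Complex.I - p) (β := 1) (a := z.re) (b := w.re)
    fun x _ => Or.inr (by simpa using (sub_pos.2 him.2).ne')
  have right := integral_inv_line (c := w.re - p) (β := Complex.I) (a := z.im) (b := w.im)
    fun x _ => Or.inl (by simpa using hre.2)
  have left := integral_inv_line (c := p - z.re) (β := -Complex.I) (a := z.im) (b := w.im)
    fun x _ => Or.inl (by simpa using hre.1)
  have jumpTop := log_neg_of_im_pos (z := z.re + w.im * Complex.I - p) (by simpa using him.2)
  have jumpBottom := log_neg_of_im_pos (z := p - (z.re + z.im * Complex.I)) (by simpa using him.1)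
  have left_neg : ∀ y : ℝ, (z.re + y * Complex.I - p)⁻¹ = -(p - z.re + y * -Complex.I)⁻¹ := by
    intro y
    rw [← inv_neg]
    ring_nf
  simp only [rectIntegral, left_neg, intervalIntegral.integral_neg, smul_eq_mul]
  ring_nf at bottom top right left jumpTop jumpBottom ⊢
  linear_combination bottom - top + right - left - jumpTop - jumpBottom

theorem continuousOn_inv_sub_smul {p : ℂ} {s : Set ℂ} (hp : p ∉ s) (c : E) :
    ContinuousOn (fun v => (v - p)⁻¹ • c) s :=
  ContinuousOn.smul (ContinuousOn.inv₀ (by fun_prop) fun _ hv h => hp (sub_eq_zero.1 h ▸ hv))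
    continuousOn_const

/-- `f` has at worst a simple pole at `p`, with residue `c`. -/
def HasSimplePole (f : ℂ → E) (p : ℂ) (c : E) : Prop :=
  Tendsto (fun v => (v - p) • f v) (𝓝[≠] p) (𝓝 c)

theorem HasSimplePole.sub_of_continuousAt {f g : ℂ → E} {p : ℂ} {c : E} (hf : HasSimplePole f p c)
    (hg : ContinuousAt g p) : HasSimplePole (fun v => f v - g v) p c := by
  have hlim : Tendsto (fun v => (v - p) • g v) (𝓝[≠] p) (𝓝 0) := by
    have : ContinuousAt (fun v => (v - p) • g v) p := by fun_prop
    simpa [ContinuousAt] using this.tendsto.mono_left nhdsWithin_le_nhds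
  simpa [HasSimplePole, smul_sub] using hf.sub hlim

theorem exists_differentiableOn_of_hasSimplePole [CompleteSpace E] {f : ℂ → E} {p : ℂ} {c : E}
    {s : Set ℂ} (hs : s ∈ 𝓝 p) (hf : DifferentiableOn ℂ f (s \ {p})) (hp : HasSimplePole f p c) :
    ∃ g : ℂ → E, DifferentiableOn ℂ g s ∧ ∀ v ≠ p, g v = f v - (v - p)⁻¹ • c := by
  set h : ℂ → E := fun v => f v - (v - p)⁻¹ • c
  have hdiff : DifferentiableOn ℂ h (s \ {p}) :=
    hf.sub fun v hv => (((differentiableAt_id.sub_const p).inv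
      (sub_ne_zero.2 hv.2)).smul_const c).differentiableWithinAt
  have hlittle : (fun v => h v - h p) =o[𝓝[≠] p] fun v => (v - p)⁻¹ := by
    have hzero : Tendsto (fun v => (v - p) • (h v - h p)) (𝓝[≠] p) (𝓝 0) := by
      have := (hp.sub_of_continuousAt (continuousAt_const (y := h p))).sub_const c
      rw [sub_self] at this
      refine this.congr' ?_
      filter_upwards [self_mem_nhdsWithin] with v hv
      simp only [h, smul_sub, smul_inv_smul₀ (sub_ne_zero.2 hv)]
      abel
    refine ((Asymptotics.isBigO_refl (fun v => (v - p)⁻¹) _).smul_isLittleO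
      ((Asymptotics.isLittleO_one_iff ℂ).2 hzero)).congr' ?_ (by simp)
    filter_upwards [self_mem_nhdsWithin] with v hv using inv_smul_smul₀ (sub_ne_zero.2 hv) _
  exact ⟨_, Complex.differentiableOn_update_limUnder_of_isLittleO hs hdiff hlittle,
    fun v hv => Function.update_of_ne hv _ _⟩

theorem rectIntegral_eq_sum_residues [CompleteSpace E] {z w : ℂ} (P : Finset ℂ)
    (hP : ∀ p ∈ P, p.re ∈ Ioo z.re w.re ∧ p.im ∈ Ioo z.im w.im) {f : ℂ → E} {c : ℂ → E}
    (hf : DifferentiableOn ℂ f (rect z w \ P)) (hc : ∀ p ∈ P, HasSimplePole f p (c p)) :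
    rectIntegral z w f = (2 * Real.pi * Complex.I) • ∑ p ∈ P, c p := by
  induction P using Finset.induction_on generalizing f with
  | empty =>
    simpa [rect, rectIntegral] using
      Complex.integral_boundary_rect_eq_zero_of_differentiableOn f z w (by simpa [rect] using hf)
  | insert p P hpP ih =>
    obtain ⟨hre, him⟩ := hP p (by simp)
    have hP' : ∀ q ∈ P, q.re ∈ Ioo z.re w.re ∧ q.im ∈ Ioo z.im w.im :=
      fun q hq => hP q (by simp [hq])
    have hrect : rect z w \ P ∈ 𝓝 p := inter_mem (rect_mem_nhds hre him)
      (P.finite_toSet.isClosed.isOpen_compl.mem_nhds hpP)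
    obtain ⟨g, hg, hgf⟩ := exists_differentiableOn_of_hasSimplePole hrect
      (by simpa [sdiff_sdiff] using hf) (hc p (by simp))
    have hpole : ∀ q ∈ P, HasSimplePole g q (c q) := by
      intro q hq
      have hqp : q ≠ p := by rintro rfl; exact hpP hq
      have hcont : ContinuousAt (fun v => (v - p)⁻¹ • c p) q :=
        (continuousOn_inv_sub_smul (s := {p}ᶜ) (by simp) _).continuousAt (by simpa using hqp)
      refine ((hc q (by simp [hq])).sub_of_continuousAt hcont).congr' ?_
      filter_upwards [nhdsWithin_le_nhds (isOpen_ne.mem_nhds hqp)] with v hv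
      rw [hgf v hv]
    have hp : p ∉ rectBoundary z w := notMem_rectBoundary hre him
    have hg_cont : ContinuousOn g (rectBoundary z w) := hg.continuousOn.mono fun v hv =>
      ⟨hv.1, fun hvP => notMem_rectBoundary (hP' v hvP).1 (hP' v hvP).2 hv⟩
    calc rectIntegral z w f = rectIntegral z w (fun v => g v + (v - p)⁻¹ • c p) :=
          rectIntegral_congr fun v hv => by simp [hgf v (by rintro rfl; exact hp hv)]
      _ = (2 * Real.pi * Complex.I) • ∑ q ∈ insert p P, c q := by
          rw [rectIntegral_add hg_cont (continuousOn_inv_sub_smul hp _),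
            rectIntegral_smul_const, rectIntegral_inv_sub hre him, ih hP' hg hpole,
            Finset.sum_insert hpP, smul_add, add_comm]

theorem hasSimplePole_inv_smul {φ : ℂ → ℂ} {g : ℂ → E} {p : ℂ} (hφ : DifferentiableAt ℂ φ p)
    (hzero : φ p = 0) (hsimple : deriv φ p ≠ 0) (hg : ContinuousAt g p) :
    HasSimplePole (fun v => (φ v)⁻¹ • g v) p ((deriv φ p)⁻¹ • g p) := by
  have hslope := (hasDerivAt_iff_tendsto_slope.1 hφ.hasDerivAt).inv₀ hsimple
  refine (hslope.smul (hg.tendsto.mono_left nhdsWithin_le_nhds)).congr fun v => ?_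
  rw [slope_def_field, hzero, sub_zero, inv_div, div_eq_mul_inv, mul_smul]

theorem rectIntegral_inv_smul_eq_sum [CompleteSpace E] {z w : ℂ} (P : Finset ℂ)
    (hP : ∀ p ∈ P, p.re ∈ Ioo z.re w.re ∧ p.im ∈ Ioo z.im w.im) {φ : ℂ → ℂ} {g : ℂ → E}
    (hφ : DifferentiableOn ℂ φ (rect z w)) (hg : DifferentiableOn ℂ g (rect z w))
    (hzero : ∀ v ∈ rect z w, φ v = 0 ↔ v ∈ P) (hsimple : ∀ p ∈ P, deriv φ p ≠ 0) :
    rectIntegral z w (fun v => (φ v)⁻¹ • g v) =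
      (2 * Real.pi * Complex.I) • ∑ p ∈ P, (deriv φ p)⁻¹ • g p := by
  refine rectIntegral_eq_sum_residues P hP ?_ fun p hp => ?_
  · exact ((hφ.mono sdiff_subset).inv fun v hv h => hv.2 ((hzero v hv.1).1 h)).smul
      (hg.mono sdiff_subset)
  · have hmem := rect_mem_nhds (hP p hp).1 (hP p hp).2
    exact hasSimplePole_inv_smul (hφ.differentiableAt hmem)
      ((hzero p (mem_of_mem_nhds hmem)).2 hp) (hsimple p hp) (hg.continuousOn.continuousAt hmem)

end RectangleResidues

section CauchySchwarz

variable {α : Type*} [MeasurableSpace α] {μ : Measure α}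

theorem lintegral_mul_sq_le {f g : α → ℝ≥0∞} (hf : AEMeasurable f μ) (hg : AEMeasurable g μ) :
    (∫⁻ a, f a * g a ∂μ) ^ 2 ≤ (∫⁻ a, f a ^ 2 ∂μ) * ∫⁻ a, g a ^ 2 ∂μ := by
  have h := ENNReal.lintegral_mul_le_Lp_mul_Lq μ Real.HolderConjugate.two_two hf hg
  simp only [Pi.mul_apply, ENNReal.rpow_two] at h
  calc (∫⁻ a, f a * g a ∂μ) ^ 2
      ≤ ((∫⁻ a, f a ^ 2 ∂μ) ^ (1 / 2 : ℝ) * (∫⁻ a, g a ^ 2 ∂μ) ^ (1 / 2 : ℝ)) ^ 2 := by gcongr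
    _ = (∫⁻ a, f a ^ 2 ∂μ) * ∫⁻ a, g a ^ 2 ∂μ := by
      rw [mul_pow, ← ENNReal.rpow_natCast, ← ENNReal.rpow_natCast, ← ENNReal.rpow_mul,
        ← ENNReal.rpow_mul]
      norm_num

variable {E : Type*} [NormedAddCommGroup E]

theorem enorm_integral_smul_sq_le [NormedSpace ℂ E] {a : α → ℂ} {g : α → E}
    (ha : AEStronglyMeasurable a μ) (hg : AEStronglyMeasurable g μ) :
    ‖∫ t, a t • g t ∂μ‖ₑ ^ 2 ≤ (∫⁻ t, ‖a t‖ₑ ^ 2 ∂μ) * ∫⁻ t, ‖g t‖ₑ ^ 2 ∂μ := by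
  refine le_trans ?_ (lintegral_mul_sq_le ha.enorm hg.enorm)
  gcongr
  simpa only [enorm_smul] using enorm_integral_le_lintegral_enorm fun t => a t • g t

theorem enorm_sq_eq_ofReal (v : E) : ‖v‖ₑ ^ 2 = ENNReal.ofReal (‖v‖ ^ 2) := by
  rw [ENNReal.ofReal_pow (norm_nonneg v), ofReal_norm]

theorem norm_le_of_enorm_sq_le {v : E} {r : ℝ} (hr : 0 ≤ r)
    (h : ‖v‖ₑ ^ 2 ≤ ENNReal.ofReal (r ^ 2)) : ‖v‖ ≤ r := by
  rw [enorm_sq_eq_ofReal, ENNReal.ofReal_le_ofReal_iff (by positivity)] at h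
  exact (pow_le_pow_iff_left₀ (norm_nonneg _) hr two_ne_zero).1 h

end CauchySchwarz

section SincInterpolation

theorem lintegral_eq_abs_mul_lintegral_comp_mul_left (f : ℝ → ℝ≥0∞) {a : ℝ} (ha : a ≠ 0) :
    ∫⁻ x, f x = ENNReal.ofReal |a| * ∫⁻ x, f (a * x) := by
  conv_lhs => rw [← Real.smul_map_volume_mul_left ha]
  rw [lintegral_smul_measure, smul_eq_mul]
  congr 1
  exact (Homeomorph.mulLeft₀ a ha).measurableEmbedding.lintegral_map f

/-- The function whose zeros are `x` and the integers. -/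
def sincDenom (x : ℝ) (w : ℂ) : ℂ := Complex.sin (Real.pi * w) * (w - x)

/-- The kernel of the contour integral for the error at `x` of sinc interpolation on `ℤ`. -/
def sincKernel (x : ℝ) (w : ℂ) : ℂ := (sincDenom x w)⁻¹

theorem measurable_sincKernel (x : ℝ) : Measurable (sincKernel x) := by
  unfold sincKernel sincDenom
  fun_prop

theorem norm_sin_sq (u v : ℝ) :
    ‖Complex.sin (u + v * Complex.I)‖ ^ 2 = Real.sin u ^ 2 + Real.sinh v ^ 2 := by
  rw [Complex.sin_add_mul_I, ← Complex.normSq_eq_norm_sq, ← Complex.ofReal_sin,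
    ← Complex.ofReal_cosh, ← Complex.ofReal_cos, ← Complex.ofReal_sinh, ← Complex.ofReal_mul,
    ← Complex.ofReal_mul, Complex.normSq_add_mul_I, mul_pow, mul_pow, Real.cosh_sq v]
  linear_combination Real.sinh v ^ 2 * Real.sin_sq_add_cos_sq u

theorem norm_sincKernel_sq (x t s : ℝ) :
    ‖sincKernel x (t + s * Complex.I)‖ ^ 2 =
      ((Real.sin (Real.pi * t) ^ 2 + Real.sinh (Real.pi * s) ^ 2) * ((t - x) ^ 2 + s ^ 2))⁻¹ := by
  have hsin := norm_sin_sq (Real.pi * t) (Real.pi * s)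
  have hsub := Complex.normSq_add_mul_I (t - x) s
  rw [Complex.normSq_eq_norm_sq] at hsub
  rw [sincKernel, sincDenom, norm_inv, norm_mul, inv_pow, mul_pow, ← hsin, ← hsub]
  push_cast
  ring_nf

theorem lintegral_inv_sq_add_sq (x : ℝ) {y : ℝ} (hy : 0 < y) :
    ∫⁻ t : ℝ, ENNReal.ofReal (((t - x) ^ 2 + y ^ 2)⁻¹) = ENNReal.ofReal (Real.pi / y) := by
  have h := ProbabilityTheory.lintegral_cauchyPDF_eq_one x (γ := y.toNNReal) (by simpa using hy)
  simp only [ProbabilityTheory.cauchyPDF, ProbabilityTheory.cauchyPDFReal,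
    Real.coe_toNNReal _ hy.le] at h
  have := Real.pi_pos
  rw [← mul_one (ENNReal.ofReal (Real.pi / y)), ← h, ← lintegral_const_mul' _ _ (by simp)]
  refine lintegral_congr fun t => ?_
  rw [← ENNReal.ofReal_mul (by positivity)]
  congr 1
  field_simp

theorem lintegral_sincKernel_horizontal_le (x : ℝ) {s : ℝ} (hs : s ≠ 0) :
    ∫⁻ t : ℝ, ‖sincKernel x (t + s * Complex.I)‖ₑ ^ 2 ≤
      ENNReal.ofReal ((√(Real.pi / |s|) / Real.sinh (Real.pi * |s|)) ^ 2) := by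
  have hpi := Real.pi_pos
  have hs' : 0 < |s| := abs_pos.2 hs
  have : 0 < Real.sinh (Real.pi * |s|) := Real.sinh_pos_iff.2 (by positivity)
  have hsq : Real.sinh (Real.pi * s) ^ 2 = Real.sinh (Real.pi * |s|) ^ 2 := by
    rw [← sq_abs (Real.sinh _), Real.abs_sinh, abs_mul, abs_of_pos hpi]
  calc ∫⁻ t : ℝ, ‖sincKernel x (t + s * Complex.I)‖ₑ ^ 2
      ≤ ∫⁻ t : ℝ, ENNReal.ofReal ((Real.sinh (Real.pi * |s|) ^ 2)⁻¹) *
          ENNReal.ofReal (((t - x) ^ 2 + |s| ^ 2)⁻¹) := by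
        refine lintegral_mono fun t => ?_
        rw [← ENNReal.ofReal_mul (by positivity), enorm_sq_eq_ofReal, norm_sincKernel_sq, hsq,
          mul_inv, sq_abs]
        gcongr
        exact le_add_of_nonneg_left (sq_nonneg _)
    _ = ENNReal.ofReal ((√(Real.pi / |s|) / Real.sinh (Real.pi * |s|)) ^ 2) := by
        rw [lintegral_const_mul' _ _ (by simp), lintegral_inv_sq_add_sq x hs',
          ← ENNReal.ofReal_mul (by positivity), div_pow, Real.sq_sqrt (by positivity),
          inv_mul_eq_div]

theorem half_le_abs_sin_pi_mul {m : ℤ} {X : ℝ} (hX : X ∈ Icc (m + 1 / 4 : ℝ) (m + 3 / 4)) :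
    1 / 2 ≤ |Real.sin (Real.pi * X)| := by
  have hpi := Real.pi_pos
  have hdist : |Real.pi * (X - m - 1 / 2)| ≤ Real.pi / 3 := by
    rw [abs_mul, abs_of_pos hpi]
    have habs : |X - m - 1 / 2| ≤ 1 / 3 := abs_le.2 ⟨by linarith [hX.1], by linarith [hX.2]⟩
    linarith [mul_le_mul_of_nonneg_left habs hpi.le]
  have hsin : |Real.sin (Real.pi * X)| = |Real.cos (Real.pi * (X - m - 1 / 2))| := by
    rw [show Real.pi * X = Real.pi * (X - m - 1 / 2) + Real.pi / 2 + m * Real.pi by ring,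
      Real.sin_add_int_mul_pi, Real.sin_add_pi_div_two, abs_mul, abs_neg_one_zpow, one_mul]
  calc (1 / 2 : ℝ) = Real.cos (Real.pi / 3) := Real.cos_pi_div_three.symm
    _ ≤ Real.cos |Real.pi * (X - m - 1 / 2)| :=
        Real.cos_le_cos_of_nonneg_of_le_pi (abs_nonneg _) (by linarith) hdist
    _ ≤ |Real.sin (Real.pi * X)| := by
        rw [hsin, Real.cos_abs]
        exact le_abs_self _

theorem norm_sincKernel_sq_le_of_half_le {x X : ℝ} (hX : X ≠ x)
    (hsin : 1 / 2 ≤ |Real.sin (Real.pi * X)|) (s : ℝ) :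
    ‖sincKernel x (X + s * Complex.I)‖ ^ 2 ≤ 4 / (X - x) ^ 2 := by
  have : 0 < (X - x) ^ 2 := sq_pos_of_ne_zero (sub_ne_zero.2 hX)
  have hsin_sq : 1 / 4 ≤ Real.sin (Real.pi * X) ^ 2 := by
    rw [← sq_abs]
    nlinarith
  rw [norm_sincKernel_sq, show 4 / (X - x) ^ 2 = (1 / 4 * (X - x) ^ 2)⁻¹ by field_simp]
  gcongr <;> nlinarith [sq_nonneg s, sq_nonneg (Real.sinh (Real.pi * s))]

variable {E : Type*} [NormedAddCommGroup E] {g : ℂ → E} {y d M : ℝ}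

/-- Averaging over `X` finds a vertical line that is far from the zeros of `sin (π w)` and on which
`g` is controlled by its norms on horizontal lines. -/
theorem exists_vertical_line (hg : ContinuousOn g {w | |w.im| < d}) (hy : y < d)
    (hgM : ∀ s : ℝ, s ≠ 0 → |s| < d →
      ∫⁻ t : ℝ, ‖g (t + s * Complex.I)‖ₑ ^ 2 ≤ ENNReal.ofReal (M ^ 2)) (m : ℤ) :
    ∃ X ∈ Icc (m + 1 / 4 : ℝ) (m + 3 / 4),
      ∫⁻ s : ℝ in Ioc (-y) y, ‖g (X + s * Complex.I)‖ₑ ^ 2 ≤ ENNReal.ofReal (4 * y * M ^ 2) := by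
  set I := Icc (m + 1 / 4 : ℝ) (m + 3 / 4)
  have hvol : volume I = ENNReal.ofReal (1 / 2) := by
    rw [Real.volume_Icc]
    ring_nf
  have hstrip : ∀ s ∈ Ioc (-y) y, |s| < d := fun s hs => (abs_le.2 ⟨hs.1.le, hs.2⟩).trans_lt hy
  have hmeas : AEMeasurable (Function.uncurry fun X s : ℝ => ‖g (X + s * Complex.I)‖ₑ ^ 2)
      ((volume.restrict I).prod (volume.restrict (Ioc (-y) y))) := by
    rw [Measure.prod_restrict]
    refine AEMeasurable.pow_const (ContinuousOn.aestronglyMeasurable ?_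
      (measurableSet_Icc.prod measurableSet_Ioc)).enorm 2
    refine hg.comp (f := fun p : ℝ × ℝ => (p.1 + p.2 * Complex.I : ℂ)) (by fun_prop) ?_
    rintro ⟨X, s⟩ ⟨-, hs⟩
    simpa using hstrip s hs
  have htotal : ∫⁻ s : ℝ in Ioc (-y) y, ∫⁻ X in I, ‖g (X + s * Complex.I)‖ₑ ^ 2 ≤
      ENNReal.ofReal (2 * y * M ^ 2) := by
    have hne : ∀ᵐ s : ℝ ∂(volume.restrict (Ioc (-y) y)), s ≠ 0 :=
      ae_restrict_of_ae (by simp [ae_iff])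
    calc ∫⁻ s : ℝ in Ioc (-y) y, ∫⁻ X in I, ‖g (X + s * Complex.I)‖ₑ ^ 2
        ≤ ∫⁻ s : ℝ in Ioc (-y) y, ENNReal.ofReal (M ^ 2) := by
          refine lintegral_mono_ae ?_
          filter_upwards [hne, ae_restrict_mem measurableSet_Ioc] with s hs0 hs
          exact (setLIntegral_le_lintegral _ _).trans (hgM s hs0 (hstrip s hs))
      _ = ENNReal.ofReal (2 * y * M ^ 2) := by
          rw [lintegral_const, Measure.restrict_apply_univ, Real.volume_Ioc,
            ← ENNReal.ofReal_mul (by positivity)]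
          ring_nf
  obtain ⟨X, hX, hXle⟩ := exists_le_setLAverage (by simp [hvol]) (by simp [hvol])
    hmeas.lintegral_prod_right'
  refine ⟨X, hX, hXle.trans ?_⟩
  simp only [Function.uncurry_apply_pair]
  rw [setLAverage_eq, lintegral_lintegral_swap hmeas, hvol]
  refine (ENNReal.div_le_div_right htotal _).trans (le_of_eq ?_)
  rw [← ENNReal.ofReal_div_of_pos (by norm_num)]
  ring_nf

variable [NormedSpace ℂ E]

theorem norm_integral_horizontal_le (x : ℝ) {s a b : ℝ} (hs : s ≠ 0) (hab : a ≤ b)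
    (hg : Continuous fun t : ℝ => g (t + s * Complex.I)) (hM : 0 ≤ M)
    (hgM : ∫⁻ t : ℝ, ‖g (t + s * Complex.I)‖ₑ ^ 2 ≤ ENNReal.ofReal (M ^ 2)) :
    ‖∫ t : ℝ in a..b, sincKernel x (t + s * Complex.I) • g (t + s * Complex.I)‖ ≤
      √(Real.pi / |s|) / Real.sinh (Real.pi * |s|) * M := by
  have : 0 ≤ Real.sinh (Real.pi * |s|) := Real.sinh_nonneg_iff.2 (by positivity)
  have hmeas : Measurable fun t : ℝ => sincKernel x (t + s * Complex.I) :=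
    (measurable_sincKernel x).comp (by fun_prop)
  apply norm_le_of_enorm_sq_le (by positivity)
  rw [intervalIntegral.integral_of_le hab, mul_pow, ENNReal.ofReal_mul (by positivity)]
  refine (enorm_integral_smul_sq_le hmeas.aestronglyMeasurable hg.aestronglyMeasurable).trans ?_
  exact mul_le_mul'
    ((setLIntegral_le_lintegral _ _).trans (lintegral_sincKernel_horizontal_le x hs))
    ((setLIntegral_le_lintegral _ _).trans hgM)

theorem norm_integral_vertical_le {x X : ℝ} (hX : X ≠ x)
    (hsin : 1 / 2 ≤ |Real.sin (Real.pi * X)|) (hy : 0 < y)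
    (hg : ContinuousOn (fun s : ℝ => g (X + s * Complex.I)) (Icc (-y) y)) {B : ℝ} (hB : 0 ≤ B)
    (hgB : ∫⁻ s : ℝ in Ioc (-y) y, ‖g (X + s * Complex.I)‖ₑ ^ 2 ≤ ENNReal.ofReal B) :
    ‖∫ s : ℝ in (-y)..y, sincKernel x (X + s * Complex.I) • g (X + s * Complex.I)‖ ≤
      √(8 * y * B) / |X - x| := by
  have hmeas : Measurable fun s : ℝ => sincKernel x (X + s * Complex.I) :=
    (measurable_sincKernel x).comp (by fun_prop)
  apply norm_le_of_enorm_sq_le (by positivity)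
  rw [intervalIntegral.integral_of_le (by linarith)]
  calc _ ≤ (∫⁻ s : ℝ in Ioc (-y) y, ‖sincKernel x (X + s * Complex.I)‖ₑ ^ 2) *
          ∫⁻ s : ℝ in Ioc (-y) y, ‖g (X + s * Complex.I)‖ₑ ^ 2 :=
        enorm_integral_smul_sq_le hmeas.aestronglyMeasurable
          ((hg.mono Ioc_subset_Icc_self).aestronglyMeasurable measurableSet_Ioc)
    _ ≤ (∫⁻ s : ℝ in Ioc (-y) y, ENNReal.ofReal (4 / (X - x) ^ 2)) * ENNReal.ofReal B := by
        refine mul_le_mul' (lintegral_mono fun s => ?_) hgB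
        rw [enorm_sq_eq_ofReal]
        exact ENNReal.ofReal_le_ofReal (norm_sincKernel_sq_le_of_half_le hX hsin s)
    _ = ENNReal.ofReal ((√(8 * y * B) / |X - x|) ^ 2) := by
        have hwidth : 0 ≤ y - -y := by linarith
        rw [lintegral_const, Measure.restrict_apply_univ, Real.volume_Ioc,
          ← ENNReal.ofReal_mul (by positivity), ← ENNReal.ofReal_mul (by positivity),
          div_pow, sq_abs, Real.sq_sqrt (by positivity)]
        ring_nf

theorem sincDenom_eq_zero_iff {x : ℝ} {w : ℂ} :
    sincDenom x w = 0 ↔ w = x ∨ ∃ k : ℤ, w = k := by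
  have hpi : (Real.pi : ℂ) ≠ 0 := Complex.ofReal_ne_zero.2 Real.pi_ne_zero
  rw [sincDenom, mul_eq_zero, sub_eq_zero, Complex.sin_eq_zero_iff, or_comm]
  simp only [mul_comm (Real.pi : ℂ), mul_left_inj' hpi]

theorem hasDerivAt_sincDenom (x : ℝ) (w : ℂ) :
    HasDerivAt (sincDenom x)
      (Complex.cos (Real.pi * w) * Real.pi * (w - x) + Complex.sin (Real.pi * w)) w := by
  have hsin : HasDerivAt (fun w : ℂ => Complex.sin (Real.pi * w))
      (Complex.cos (Real.pi * w) * Real.pi) w := by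
    simpa using ((hasDerivAt_id w).const_mul (Real.pi : ℂ)).csin
  exact (hsin.mul ((hasDerivAt_id w).sub_const (x : ℂ))).congr_deriv (by simp)

theorem deriv_sincDenom_self (x : ℝ) : deriv (sincDenom x) x = Real.sin (Real.pi * x) := by
  simp [(hasDerivAt_sincDenom x x).deriv]

theorem deriv_sincDenom_intCast (x : ℝ) (k : ℤ) :
    deriv (sincDenom x) k = ((-1) ^ k * Real.pi * (k - x) : ℝ) := by
  have hcos : Complex.cos (Real.pi * k) = ((-1) ^ k : ℝ) := by
    rw [← Real.cos_int_mul_pi k, mul_comm]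
    push_cast
    rfl
  have hsin : Complex.sin (Real.pi * k) = 0 := Complex.sin_eq_zero_iff.2 ⟨k, mul_comm _ _⟩
  rw [(hasDerivAt_sincDenom x k).deriv, hcos, hsin]
  push_cast
  ring

theorem sin_mul_inv_deriv_sincDenom_intCast {x : ℝ} {k : ℤ} (hx : x ≠ k) :
    (Real.sin (Real.pi * x) : ℂ) * (deriv (sincDenom x) k)⁻¹ =
      -(Real.sinc (Real.pi * (x - k)) : ℂ) := by
  have hsub : x - k ≠ 0 := sub_ne_zero.2 hx
  have hsin : Real.sin (Real.pi * (x - k)) = (-1) ^ k * Real.sin (Real.pi * x) := by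
    rw [mul_sub, mul_comm Real.pi (k : ℝ), Real.sin_sub_int_mul_pi]
  have hsign : ((-1 : ℝ) ^ k)⁻¹ = (-1) ^ k := by rw [← inv_zpow, inv_neg_one]
  rw [deriv_sincDenom_intCast, Real.sinc_of_ne_zero (mul_ne_zero Real.pi_ne_zero hsub), hsin,
    ← Complex.ofReal_inv, ← Complex.ofReal_mul, ← Complex.ofReal_neg, mul_inv, mul_inv, hsign,
    ← neg_sub x (k : ℝ), inv_neg]
  congr 1
  field_simp

/-- The partial sum of the sinc interpolation series of `g` on `ℤ`. -/
def sincSum (g : ℂ → E) (N : ℕ) (x : ℝ) : E :=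
  ∑ k ∈ Finset.Icc (-N : ℤ) N, (Real.sinc (Real.pi * (x - k)) : ℂ) • g k

theorem sincSum_intCast (g : ℂ → E) {N : ℕ} {k : ℤ} (hk : k ∈ Finset.Icc (-N : ℤ) N) :
    sincSum g N k = g k := by
  rw [sincSum, Finset.sum_eq_single_of_mem k hk]
  · simp
  · intro l _ hl
    have hne : Real.pi * ((k : ℝ) - l) ≠ 0 :=
      mul_ne_zero Real.pi_ne_zero (sub_ne_zero.2 (by exact_mod_cast hl.symm))
    have hsin : Real.sin (Real.pi * ((k : ℝ) - l)) = 0 := by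
      rw [mul_comm]
      exact_mod_cast Real.sin_int_mul_pi (k - l)
    simp [Real.sinc_of_ne_zero hne, hsin]

theorem sincDenom_eq_zero_iff_of_re_mem {x : ℝ} {N : ℕ} {a b : ℝ} (ha : -N - 1 < a)
    (hb : b < N + 1) {w : ℂ} (hw : w.re ∈ Icc a b) :
    sincDenom x w = 0 ↔ w = x ∨ ∃ k ∈ Finset.Icc (-N : ℤ) N, (k : ℂ) = w := by
  rw [sincDenom_eq_zero_iff]
  refine or_congr_right ⟨?_, fun ⟨k, _, hk⟩ => ⟨k, hk.symm⟩⟩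
  rintro ⟨k, rfl⟩
  rw [Complex.intCast_re] at hw
  have hlow : -N - 1 < k := by exact_mod_cast ha.trans_le hw.1
  have hupp : k < N + 1 := by exact_mod_cast hw.2.trans_lt hb
  exact ⟨k, Finset.mem_Icc.2 ⟨by omega, by omega⟩, rfl⟩

theorem deriv_sincDenom_intCast_ne_zero {x : ℝ} {k : ℤ} (hx : x ≠ k) :
    deriv (sincDenom x) k ≠ 0 := by
  rw [deriv_sincDenom_intCast, Complex.ofReal_ne_zero]
  exact mul_ne_zero (mul_ne_zero (zpow_ne_zero _ (by norm_num)) Real.pi_ne_zero)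
    (sub_ne_zero.2 hx.symm)

theorem sub_sincSum_eq_rectIntegral [CompleteSpace E] (hg : DifferentiableOn ℂ g {w | |w.im| < d})
    (hy0 : 0 < y) (hy : y < d) {x : ℝ} (hx : ∀ k : ℤ, x ≠ k) {N : ℕ} {a b : ℝ}
    (ha : a ∈ Ioo (-N - 1 : ℝ) (-N)) (hb : b ∈ Ioo (N : ℝ) (N + 1)) (hxab : x ∈ Ioo a b) :
    g x - sincSum g N x = ((2 * Real.pi * Complex.I)⁻¹ * Real.sin (Real.pi * x) : ℂ) •
      rectIntegral ⟨a, -y⟩ ⟨b, y⟩ (fun w => sincKernel x w • g w) := by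
  classical
  have hinj : Function.Injective ((↑) : ℤ → ℂ) := Int.cast_injective
  set nodes : Finset ℂ := (Finset.Icc (-N : ℤ) N).image (↑)
  have hx_nodes : (x : ℂ) ∉ nodes := by
    rw [Finset.mem_image]
    rintro ⟨k, -, hk⟩
    exact hx k (by exact_mod_cast hk.symm)
  have hsin : (Real.sin (Real.pi * x) : ℂ) ≠ 0 := by
    rw [Complex.ofReal_ne_zero, Real.sin_ne_zero_iff]
    exact fun k hk => hx k (mul_right_cancel₀ Real.pi_ne_zero (by linarith))
  have hsub : rect ⟨a, -y⟩ ⟨b, y⟩ ⊆ {w | |w.im| < d} := by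
    rintro w ⟨-, hw⟩
    rw [mem_preimage, uIcc_of_le (by linarith)] at hw
    exact (abs_le.2 hw).trans_lt hy
  have hres := rectIntegral_inv_smul_eq_sum (z := ⟨a, -y⟩) (w := ⟨b, y⟩) (φ := sincDenom x) (g := g)
    (insert (x : ℂ) nodes) ?_ ?_ (hg.mono hsub) ?_ ?_
  · have hterm : ∀ k : ℤ, (Real.sin (Real.pi * x) : ℂ) • (deriv (sincDenom x) k)⁻¹ • g k =
        -((Real.sinc (Real.pi * (x - k)) : ℂ) • g k) := fun k => by
      rw [smul_smul, sin_mul_inv_deriv_sincDenom_intCast (hx k), neg_smul]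
    rw [show (fun w => sincKernel x w • g w) = fun w => (sincDenom x w)⁻¹ • g w from rfl, hres,
      Finset.sum_insert hx_nodes, Finset.sum_image hinj.injOn, deriv_sincDenom_self, smul_smul,
      mul_right_comm, inv_mul_cancel₀ Complex.two_pi_I_ne_zero, one_mul, smul_add,
      smul_inv_smul₀ hsin, Finset.smul_sum, Finset.sum_congr rfl fun k _ => hterm k,
      Finset.sum_neg_distrib, ← sub_eq_add_neg]
    rfl
  · have hnode : ∀ k ∈ Finset.Icc (-N : ℤ) N, (k : ℝ) ∈ Ioo a b := by
      intro k hk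
      rw [Finset.mem_Icc] at hk
      have hlow : (-N : ℝ) ≤ k := by exact_mod_cast hk.1
      have hupp : (k : ℝ) ≤ N := by exact_mod_cast hk.2
      exact ⟨by linarith [ha.2], by linarith [hb.1]⟩
    simp only [Finset.forall_mem_insert, nodes, Finset.forall_mem_image, Complex.ofReal_re,
      Complex.ofReal_im, Complex.intCast_re, Complex.intCast_im]
    have him : (0 : ℝ) ∈ Ioo (-y) y := ⟨by linarith, hy0⟩
    exact ⟨⟨hxab, him⟩, fun k hk => ⟨hnode k hk, him⟩⟩
  · exact fun w _ => (hasDerivAt_sincDenom x w).differentiableAt.differentiableWithinAt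
  · rintro w ⟨hw, -⟩
    rw [mem_preimage, uIcc_of_le (hxab.1.trans hxab.2).le] at hw
    rw [Finset.mem_insert, Finset.mem_image]
    exact sincDenom_eq_zero_iff_of_re_mem ha.1 hb.2 hw
  · simp only [Finset.forall_mem_insert, nodes, Finset.forall_mem_image, deriv_sincDenom_self]
    exact ⟨hsin, fun k _ => deriv_sincDenom_intCast_ne_zero (hx k)⟩

theorem norm_rectIntegral_sincKernel_le (hg : ContinuousOn g {w | |w.im| < d}) (hy0 : 0 < y)
    (hy : y < d) (hM : 0 ≤ M)
    (hgM : ∀ s : ℝ, s ≠ 0 → |s| < d →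
      ∫⁻ t : ℝ, ‖g (t + s * Complex.I)‖ₑ ^ 2 ≤ ENNReal.ofReal (M ^ 2)) {x a b : ℝ} {k l : ℤ}
    (ha : a ∈ Icc (k + 1 / 4 : ℝ) (k + 3 / 4)) (hb : b ∈ Icc (l + 1 / 4 : ℝ) (l + 3 / 4))
    (hxab : x ∈ Ioo a b) {B : ℝ} (hB : 0 ≤ B)
    (hgB : ∀ X ∈ ({a, b} : Set ℝ),
      ∫⁻ s : ℝ in Ioc (-y) y, ‖g (X + s * Complex.I)‖ₑ ^ 2 ≤ ENNReal.ofReal B) :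
    ‖rectIntegral ⟨a, -y⟩ ⟨b, y⟩ (fun w => sincKernel x w • g w)‖ ≤
      2 * (√(Real.pi / y) / Real.sinh (Real.pi * y) * M) +
        (√(8 * y * B) / |a - x| + √(8 * y * B) / |b - x|) := by
  have hhor : ∀ s : ℝ, |s| = y →
      ‖∫ t : ℝ in a..b, sincKernel x (t + s * Complex.I) • g (t + s * Complex.I)‖ ≤
        √(Real.pi / y) / Real.sinh (Real.pi * y) * M := by
    intro s hs
    have hs0 : s ≠ 0 := abs_pos.1 (hs ▸ hy0)
    have hcont : Continuous fun t : ℝ => g (t + s * Complex.I) :=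
      hg.comp_continuous (by fun_prop) fun t => by simpa [hs] using hy
    simpa only [hs] using norm_integral_horizontal_le x hs0 (hxab.1.trans hxab.2).le hcont hM
      (hgM s hs0 (hs ▸ hy))
  have hvert : ∀ X : ℝ, ContinuousOn (fun s : ℝ => g (X + s * Complex.I)) (Icc (-y) y) := fun X =>
    hg.comp (by fun_prop) fun s hs => by simpa using (abs_le.2 hs).trans_lt hy
  have hleft := norm_integral_vertical_le hxab.1.ne (half_le_abs_sin_pi_mul ha) hy0 (hvert a) hB
    (hgB a (by simp))
  have hright := norm_integral_vertical_le hxab.2.ne' (half_le_abs_sin_pi_mul hb) hy0 (hvert b) hB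
    (hgB b (by simp))
  rw [two_mul, add_comm (√(8 * y * B) / |a - x|), ← add_assoc]
  refine (norm_sub_le _ _).trans (add_le_add ((norm_add_le _ _).trans (add_le_add
    ((norm_sub_le _ _).trans (add_le_add (hhor (-y) ?_) (hhor y ?_))) ?_)) ?_)
  · rw [abs_neg, abs_of_pos hy0]
  · exact abs_of_pos hy0
  · simpa only [norm_smul, Complex.norm_I, one_mul] using hright
  · simpa only [norm_smul, Complex.norm_I, one_mul] using hleft

theorem sqrt_pi_div_eq {y : ℝ} (hy : 0 < y) : √(Real.pi / y) = Real.pi / √(Real.pi * y) := by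
  have hpi := Real.pi_pos
  rw [eq_div_iff (by positivity), ← Real.sqrt_mul (by positivity),
    show Real.pi / y * (Real.pi * y) = Real.pi ^ 2 by field_simp, Real.sqrt_sq hpi.le]

theorem norm_inv_two_pi_I_mul_sin_le (t : ℝ) :
    ‖((2 * Real.pi * Complex.I)⁻¹ * Real.sin t : ℂ)‖ ≤ (2 * Real.pi)⁻¹ := by
  have hpi := Real.pi_pos
  rw [norm_mul, norm_inv, norm_mul, norm_mul, Complex.norm_I, Complex.norm_ofNat,
    Complex.norm_real, Complex.norm_real, Real.norm_of_nonneg hpi.le, mul_one, Real.norm_eq_abs]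
  exact mul_le_of_le_one_right (by positivity) (Real.abs_sin_le_one _)

theorem norm_sub_sincSum_le_of_add_div_le [CompleteSpace E]
    (hg : DifferentiableOn ℂ g {w | |w.im| < d}) (hy0 : 0 < y) (hy : y < d) (hM : 0 ≤ M)
    (hgM : ∀ s : ℝ, s ≠ 0 → |s| < d →
      ∫⁻ t : ℝ, ‖g (t + s * Complex.I)‖ₑ ^ 2 ≤ ENNReal.ofReal (M ^ 2))
    {x : ℝ} (hx : ∀ k : ℤ, x ≠ k) {ε : ℝ} (hε : 0 < ε) {N : ℕ}
    (hN : |x| + √(8 * y * (4 * y * M ^ 2)) / ε ≤ N) :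
    ‖g x - sincSum g N x‖ ≤ M / (√(Real.pi * y) * Real.sinh (Real.pi * y)) + ε := by
  have : 0 < Real.sinh (Real.pi * y) := Real.sinh_pos_iff.2 (by positivity)
  set V := √(8 * y * (4 * y * M ^ 2))
  have hfar : ∀ X : ℝ, V / ε ≤ |X - x| → V / |X - x| ≤ ε := fun X hX =>
    div_le_of_le_mul₀ (abs_nonneg _) hε.le ((div_le_iff₀' hε).1 hX)
  have hV : 0 ≤ V / ε := by positivity
  obtain ⟨a, ha, haB⟩ := exists_vertical_line hg.continuousOn hy hgM (-N - 1)
  obtain ⟨b, hb, hbB⟩ := exists_vertical_line hg.continuousOn hy hgM N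
  have ha' := ha
  have hb' := hb
  push_cast at ha' hb'
  obtain ⟨hx_low, hx_upp⟩ := abs_le.1 (le_refl |x|)
  have hxab : x ∈ Ioo a b := ⟨by linarith [ha'.2], by linarith [hb'.1]⟩
  have hrect := norm_rectIntegral_sincKernel_le hg.continuousOn hy0 hy hM hgM ha hb hxab
    (B := 4 * y * M ^ 2) (by positivity) (by simp [haB, hbB])
  have hleft : V / |a - x| ≤ ε :=
    hfar a (by rw [abs_sub_comm]; exact le_trans (by linarith [ha'.2]) (le_abs_self _))
  have hright : V / |b - x| ≤ ε := hfar b (le_trans (by linarith [hb'.1]) (le_abs_self _))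
  have hmain : √(Real.pi / y) / Real.sinh (Real.pi * y) * M / Real.pi =
      M / (√(Real.pi * y) * Real.sinh (Real.pi * y)) := by
    rw [sqrt_pi_div_eq hy0]
    field_simp
  rw [sub_sincSum_eq_rectIntegral hg hy0 hy hx ⟨by linarith [ha'.1], by linarith [ha'.2]⟩
    ⟨by linarith [hb'.1], by linarith [hb'.2]⟩ hxab, norm_smul]
  calc _ ≤ (2 * Real.pi)⁻¹ *
          (2 * (√(Real.pi / y) / Real.sinh (Real.pi * y) * M) + (ε + ε)) := by
        refine mul_le_mul (norm_inv_two_pi_I_mul_sin_le _) (hrect.trans ?_) (norm_nonneg _)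
          (by positivity)
        gcongr
    _ = M / (√(Real.pi * y) * Real.sinh (Real.pi * y)) + ε / Real.pi := by
        rw [← hmain]
        field_simp
        ring
    _ ≤ M / (√(Real.pi * y) * Real.sinh (Real.pi * y)) + ε := by
        gcongr
        exact div_le_self hε.le (by linarith [Real.pi_gt_three])

theorem eventually_norm_sub_sincSum_le_of_lt [CompleteSpace E]
    (hg : DifferentiableOn ℂ g {w | |w.im| < d}) (hy0 : 0 < y) (hy : y < d) (hM : 0 ≤ M)
    (hgM : ∀ s : ℝ, s ≠ 0 → |s| < d →
      ∫⁻ t : ℝ, ‖g (t + s * Complex.I)‖ₑ ^ 2 ≤ ENNReal.ofReal (M ^ 2))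
    (x : ℝ) {ε : ℝ} (hε : 0 < ε) :
    ∀ᶠ N : ℕ in atTop,
      ‖g x - sincSum g N x‖ ≤ M / (√(Real.pi * y) * Real.sinh (Real.pi * y)) + ε := by
  by_cases hx : ∃ k : ℤ, x = k
  · obtain ⟨k, rfl⟩ := hx
    have : 0 < Real.sinh (Real.pi * y) := Real.sinh_pos_iff.2 (by positivity)
    filter_upwards [eventually_ge_atTop k.natAbs] with N hN
    rw [sincSum_intCast g (Finset.mem_Icc.2 ⟨by omega, by omega⟩), Complex.ofReal_intCast,
      sub_self, norm_zero]
    positivity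
  · push Not at hx
    filter_upwards [eventually_ge_atTop ⌈|x| + √(8 * y * (4 * y * M ^ 2)) / ε⌉₊] with N hN
    exact norm_sub_sincSum_le_of_add_div_le hg hy0 hy hM hgM hx hε (Nat.ceil_le.1 hN)

theorem eventually_norm_sub_sincSum_le [CompleteSpace E]
    (hg : DifferentiableOn ℂ g {w | |w.im| < d}) (hd : 0 < d) (hM : 0 ≤ M)
    (hgM : ∀ s : ℝ, s ≠ 0 → |s| < d →
      ∫⁻ t : ℝ, ‖g (t + s * Complex.I)‖ₑ ^ 2 ≤ ENNReal.ofReal (M ^ 2))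
    (x : ℝ) {ε : ℝ} (hε : 0 < ε) :
    ∀ᶠ N : ℕ in atTop,
      ‖g x - sincSum g N x‖ ≤ M / (√(Real.pi * d) * Real.sinh (Real.pi * d)) + ε := by
  have hne : √(Real.pi * d) * Real.sinh (Real.pi * d) ≠ 0 := by positivity
  have hcont : ContinuousAt (fun y => M / (√(Real.pi * y) * Real.sinh (Real.pi * y))) d :=
    continuousAt_const.div (by fun_prop) hne
  have hlt : ∀ᶠ y in 𝓝[<] d, M / (√(Real.pi * y) * Real.sinh (Real.pi * y)) <
      M / (√(Real.pi * d) * Real.sinh (Real.pi * d)) + ε / 2 :=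
    (hcont.eventually_lt_const (by linarith)).filter_mono nhdsWithin_le_nhds
  obtain ⟨y, ⟨hyM, hy⟩, hy0⟩ := ((hlt.and self_mem_nhdsWithin).and
    (eventually_nhdsWithin_of_eventually_nhds (eventually_gt_nhds hd))).exists
  filter_upwards [eventually_norm_sub_sincSum_le_of_lt hg hy0 hy hM hgM x (half_pos hε)] with N hN
  linarith

theorem eventually_norm_sub_sum_sinc_le [CompleteSpace E] {θ : ℝ}
    (hg : DifferentiableOn ℂ g {w | |w.im| < d}) (hd : 0 < d) (hθ : 0 < θ) (hM : 0 ≤ M)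
    (hgM : ∀ s : ℝ, s ≠ 0 → |s| < d →
      ∫⁻ t : ℝ, ‖g (t + s * Complex.I)‖ₑ ^ 2 ≤ ENNReal.ofReal (M ^ 2))
    (x : ℝ) {ε : ℝ} (hε : 0 < ε) :
    ∀ᶠ N : ℕ in atTop,
      ‖g x - ∑ k ∈ Finset.Icc (-N : ℤ) N,
          (Real.sinc (Real.pi * (x / θ - k)) : ℂ) • g ((k * θ : ℝ) : ℂ)‖ ≤
        M / (√(Real.pi * d) * Real.sinh (Real.pi * d / θ)) + ε := by
  have := Real.pi_pos
  have hscaled : DifferentiableOn ℂ (fun w : ℂ => g (θ * w)) {w | |w.im| < d / θ} := by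
    refine hg.comp (by fun_prop) fun w hw => ?_
    rw [mem_ofPred_eq, lt_div_iff₀ hθ] at hw
    rwa [mem_ofPred_eq, Complex.im_ofReal_mul, abs_mul, abs_of_pos hθ, mul_comm]
  have hscaledM : ∀ s : ℝ, s ≠ 0 → |s| < d / θ →
      ∫⁻ t : ℝ, ‖g (θ * (t + s * Complex.I))‖ₑ ^ 2 ≤ ENNReal.ofReal ((M / √θ) ^ 2) := by
    intro s hs hsd
    rw [lt_div_iff₀ hθ] at hsd
    have hbound := hgM (θ * s) (by positivity) (by rwa [abs_mul, abs_of_pos hθ, mul_comm])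
    rw [lintegral_eq_abs_mul_lintegral_comp_mul_left _ hθ.ne', abs_of_pos hθ] at hbound
    have harg : ∀ t : ℝ, (θ : ℂ) * (t + s * Complex.I) =
        (θ * t : ℝ) + (θ * s : ℝ) * Complex.I := fun t => by push_cast; ring
    simp only [harg]
    rw [div_pow, Real.sq_sqrt hθ.le, ENNReal.ofReal_div_of_pos hθ, ENNReal.le_div_iff_mul_le
      (by simp [hθ]) (by simp), mul_comm]
    exact hbound
  have h := eventually_norm_sub_sincSum_le hscaled (by positivity) (by positivity) hscaledM
    (x / θ) hε
  have hrate : M / √θ / (√(Real.pi * (d / θ)) * Real.sinh (Real.pi * (d / θ))) =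
      M / (√(Real.pi * d) * Real.sinh (Real.pi * d / θ)) := by
    rw [← mul_div_assoc, Real.sqrt_div (by positivity)]
    field_simp
  have hx : (θ : ℂ) * (x / θ : ℝ) = x := by
    rw [← Complex.ofReal_mul, mul_div_cancel₀ x hθ.ne']
  have hnode : ∀ k : ℤ, (θ : ℂ) * k = (k * θ : ℝ) := fun k => by push_cast; ring
  simpa only [sincSum, hrate, hx, hnode] using h

end SincInterpolation

section StripApproximation

theorem norm_sum_Icc_succ_sub_le {E : Type*} [NormedAddCommGroup E] (v : ℤ → E) (N : ℕ) (w : E) :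
    ‖∑ k ∈ Finset.Icc (-(N + 1 : ℕ) : ℤ) (N + 1 : ℕ), v k - w‖ ≤
      ‖v (N + 1 : ℕ)‖ + ‖v (-(N + 1 : ℕ))‖ + ‖∑ k ∈ Finset.Icc (-N : ℤ) N, v k - w‖ := by
  have hIcc : Finset.Icc (-(N + 1 : ℕ) : ℤ) (N + 1 : ℕ) =
      insert ((N + 1 : ℕ) : ℤ) (insert (-(N + 1 : ℕ) : ℤ) (Finset.Icc (-N : ℤ) N)) := by
    ext k
    simp only [Finset.mem_Icc, Finset.mem_insert]
    omega
  rw [hIcc, Finset.sum_insert (by simp only [Finset.mem_Icc, Finset.mem_insert]; omega),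
    Finset.sum_insert (by simp only [Finset.mem_Icc]; omega), ← add_assoc, add_sub_assoc]
  exact (norm_add_le _ _).trans (add_le_add (norm_add_le _ _) le_rfl)

theorem norm_sum_Icc_sub_sum_Icc_le {E : Type*} [NormedAddCommGroup E] {v : ℤ → E} {A r : ℝ}
    (hr : 0 < r) (hA : 0 ≤ A) {K : ℕ}
    (hv : ∀ k : ℤ, (K : ℤ) < |k| → ‖v k‖ ≤ A * Real.exp (-(|(k : ℝ)| * r))) {N : ℕ}
    (hN : K ≤ N) :
    ‖∑ k ∈ Finset.Icc (-N : ℤ) N, v k - ∑ k ∈ Finset.Icc (-K : ℤ) K, v k‖ ≤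
      2 * A / r * (Real.exp (-(K * r)) - Real.exp (-(N * r))) := by
  induction N, hN using Nat.le_induction with
  | base => simp
  | succ N hN ih =>
    have hNK : (K : ℤ) < |((N + 1 : ℕ) : ℤ)| := by
      rw [Nat.abs_cast]
      omega
    have hpos : ‖v (N + 1 : ℕ)‖ ≤ A * Real.exp (-((N + 1 : ℕ) * r)) := by
      simpa only [Int.cast_natCast, Nat.abs_cast] using hv (N + 1 : ℕ) hNK
    have hneg : ‖v (-(N + 1 : ℕ))‖ ≤ A * Real.exp (-((N + 1 : ℕ) * r)) := by
      simpa only [Int.cast_neg, Int.cast_natCast, abs_neg, Nat.abs_cast] using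
        hv (-(N + 1 : ℕ)) (by rwa [abs_neg])
    have hstep : r * Real.exp (-((N + 1 : ℕ) * r)) ≤
        Real.exp (-(N * r)) - Real.exp (-((N + 1 : ℕ) * r)) := by
      have hexp : Real.exp (-(N * r)) = Real.exp (-((N + 1 : ℕ) * r)) * Real.exp r := by
        rw [← Real.exp_add]
        push_cast
        ring_nf
      nlinarith [Real.add_one_le_exp r, Real.exp_pos (-((N + 1 : ℕ) * r))]
    calc _ ≤ A * Real.exp (-((N + 1 : ℕ) * r)) + A * Real.exp (-((N + 1 : ℕ) * r)) +
          2 * A / r * (Real.exp (-(K * r)) - Real.exp (-(N * r))) :=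
          (norm_sum_Icc_succ_sub_le v N _).trans (add_le_add (add_le_add hpos hneg) ih)
      _ = 2 * A / r * (r * Real.exp (-((N + 1 : ℕ) * r)) +
          (Real.exp (-(K * r)) - Real.exp (-(N * r)))) := by field_simp; ring
      _ ≤ 2 * A / r * ((Real.exp (-(N * r)) - Real.exp (-((N + 1 : ℕ) * r))) +
          (Real.exp (-(K * r)) - Real.exp (-(N * r)))) := by gcongr
      _ = _ := by ring

theorem lintegral_exp_neg_abs_le (c : ℝ) :
    ∫⁻ x in {x : ℝ | c < |x|}, ENNReal.ofReal (Real.exp (-|x|)) ≤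
      ENNReal.ofReal (2 * Real.exp (-c)) := by
  have hright : ∫⁻ x in Ioi c, ENNReal.ofReal (Real.exp (-x)) =
      ENNReal.ofReal (Real.exp (-c)) := by
    rw [← ofReal_integral_eq_lintegral_ofReal (integrableOn_exp_neg_Ioi c)
      (Eventually.of_forall fun x => (Real.exp_pos _).le), integral_exp_neg_Ioi]
  have hleft : ∫⁻ x in Iic (-c), ENNReal.ofReal (Real.exp x) = ENNReal.ofReal (Real.exp (-c)) := by
    rw [← ofReal_integral_eq_lintegral_ofReal (integrableOn_exp_Iic _)
      (Eventually.of_forall fun x => (Real.exp_pos _).le), integral_exp_Iic]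
  have hsub : {x : ℝ | c < |x|} ⊆ Ioi c ∪ Iic (-c) := fun x hx =>
    (lt_abs.1 (mem_ofPred_eq ▸ hx)).imp id fun h => le_neg.2 h.le
  calc _ ≤ (∫⁻ x in Ioi c, ENNReal.ofReal (Real.exp (-|x|))) +
        ∫⁻ x in Iic (-c), ENNReal.ofReal (Real.exp (-|x|)) :=
        (lintegral_mono_set hsub).trans (lintegral_union_le _ _ _)
    _ ≤ (∫⁻ x in Ioi c, ENNReal.ofReal (Real.exp (-x))) +
        ∫⁻ x in Iic (-c), ENNReal.ofReal (Real.exp x) := by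
      gcongr with x x
      · exact le_abs_self x
      · linarith [neg_abs_le x]
    _ = _ := by
      rw [hright, hleft, ← ENNReal.ofReal_add (Real.exp_pos _).le (Real.exp_pos _).le, two_mul]

theorem inv_sinh_le {u v : ℝ} (hu : 0 < u) (huv : u ≤ v) :
    (Real.sinh v)⁻¹ ≤ 2 / (1 - Real.exp (-(2 * u))) * Real.exp (-v) := by
  have hpos : 0 < 1 - Real.exp (-(2 * u)) := by
    rw [sub_pos, Real.exp_lt_one_iff]
    linarith
  have hsinh : Real.sinh v = Real.exp v * (1 - Real.exp (-(2 * v))) / 2 := by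
    rw [Real.sinh_eq, mul_sub, ← Real.exp_add]
    ring_nf
  calc (Real.sinh v)⁻¹ ≤ (Real.exp v * (1 - Real.exp (-(2 * u))) / 2)⁻¹ := by
        rw [hsinh]
        gcongr
    _ = 2 / (1 - Real.exp (-(2 * u))) * Real.exp (-v) := by
        rw [Real.exp_neg v]
        field_simp

variable {V : Type*} [NormedAddCommGroup V] [InnerProductSpace ℂ V]

theorem norm_sub_starProjection_le (W : Submodule ℂ V) [W.HasOrthogonalProjection] (v : V) {w : V}
    (hw : w ∈ W) : ‖v - W.starProjection v‖ ≤ ‖v - w‖ := by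
  have h : v - W.starProjection v = Wᗮ.starProjection (v - w) := by
    rw [Submodule.starProjection_orthogonal_val, map_sub, Submodule.starProjection_eq_self_iff.2 hw]
    abel
  rw [h]
  exact Submodule.norm_starProjection_apply_le _ _

theorem norm_sub_starProjection_le_self (W : Submodule ℂ V) [W.HasOrthogonalProjection] (v : V) :
    ‖v - W.starProjection v‖ ≤ ‖v‖ := by
  simpa using norm_sub_starProjection_le W v W.zero_mem

theorem abs_sinc_le_of_le {x θ r : ℝ} (hθ : 0 < θ) (k : ℤ) (hr : 0 < r) (h : r ≤ |x - k * θ|) :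
    |Real.sinc (Real.pi * (x / θ - k))| ≤ θ / (Real.pi * r) := by
  have hpi := Real.pi_pos
  have harg : Real.pi * (x / θ - k) = Real.pi * (x - k * θ) / θ := by field_simp
  have hne : Real.pi * (x / θ - k) ≠ 0 := by
    rw [harg]
    exact div_ne_zero (mul_ne_zero hpi.ne' (abs_pos.1 (hr.trans_le h))) hθ.ne'
  rw [Real.sinc_of_ne_zero hne, harg, abs_div, abs_div, abs_mul, abs_of_pos hpi, abs_of_pos hθ,
    div_div_eq_mul_div]
  gcongr
  exact mul_le_of_le_one_left hθ.le (Real.abs_sin_le_one _)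

variable {g : ℂ → V} {d M B θ : ℝ}

theorem norm_sinc_smul_le_of_lt_abs (hθ : 0 < θ)
    (hgB : ∀ x : ℝ, ‖g x‖ ≤ B * Real.exp (-(|x| / 2))) {K : ℕ} {x : ℝ} (hxK : |x| + 1 ≤ K * θ)
    {k : ℤ} (hk : (K : ℤ) < |k|) :
    ‖(Real.sinc (Real.pi * (x / θ - k)) : ℂ) • g ((k * θ : ℝ) : ℂ)‖ ≤
      θ / Real.pi * B * Real.exp (-(|(k : ℝ)| * (θ / 2))) := by
  have hKk : (K : ℝ) ≤ |(k : ℝ)| := by exact_mod_cast hk.le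
  have hdist : 1 ≤ |x - k * θ| := by
    have htriangle := abs_sub_abs_le_abs_sub (k * θ) x
    rw [abs_sub_comm, abs_mul, abs_of_pos hθ] at htriangle
    nlinarith
  rw [norm_smul, Complex.norm_real, Real.norm_eq_abs, mul_assoc (θ / Real.pi)]
  gcongr
  · simpa only [mul_one] using abs_sinc_le_of_le hθ k one_pos hdist
  · refine (hgB _).trans_eq ?_
    rw [abs_mul, abs_of_pos hθ, mul_div_assoc]

theorem norm_sub_starProjection_le_of_nodes [CompleteSpace V]
    (hg : DifferentiableOn ℂ g {w | |w.im| < d}) (hd : 0 < d) (hM : 0 ≤ M) (hB : 0 ≤ B)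
    (hgM : ∀ s : ℝ, s ≠ 0 → |s| < d →
      ∫⁻ t : ℝ, ‖g (t + s * Complex.I)‖ₑ ^ 2 ≤ ENNReal.ofReal (M ^ 2))
    (hgB : ∀ x : ℝ, ‖g x‖ ≤ B * Real.exp (-(|x| / 2))) (hθ : 0 < θ) {K : ℕ}
    (W : Submodule ℂ V) [W.HasOrthogonalProjection]
    (hW : ∀ k : ℤ, |k| ≤ K → g ((k * θ : ℝ) : ℂ) ∈ W) {x : ℝ} (hxK : |x| + 1 ≤ K * θ) :
    ‖g x - W.starProjection (g x)‖ ≤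
      M / (√(Real.pi * d) * Real.sinh (Real.pi * d / θ)) + 2 * B * Real.exp (-(K * θ / 2)) := by
  have hpi := Real.pi_pos
  set v : ℤ → V := fun k => (Real.sinc (Real.pi * (x / θ - k)) : ℂ) • g ((k * θ : ℝ) : ℂ)
  have hmem : ∑ k ∈ Finset.Icc (-K : ℤ) K, v k ∈ W :=
    W.sum_mem fun k hk => W.smul_mem _ (hW k (abs_le.2 (Finset.mem_Icc.1 hk)))
  refine (norm_sub_starProjection_le W _ hmem).trans (le_of_forall_pos_le_add fun ε hε => ?_)
  obtain ⟨N, hN, hKN⟩ := ((eventually_norm_sub_sum_sinc_le hg hd hθ hM hgM x hε).and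
    (eventually_ge_atTop K)).exists
  have htail := norm_sum_Icc_sub_sum_Icc_le (v := v) (half_pos hθ) (by positivity)
    (fun k hk => norm_sinc_smul_le_of_lt_abs hθ hgB hxK hk) hKN
  have htail' : 2 * (θ / Real.pi * B) / (θ / 2) *
      (Real.exp (-(K * (θ / 2))) - Real.exp (-(N * (θ / 2)))) ≤
        2 * B * Real.exp (-(K * θ / 2)) := by
    have hfour : 4 / Real.pi ≤ 2 := by
      rw [div_le_iff₀ hpi]
      linarith [Real.pi_gt_three]
    calc _ ≤ 2 * (θ / Real.pi * B) / (θ / 2) * Real.exp (-(K * (θ / 2))) := by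
          gcongr
          exact sub_le_self _ (Real.exp_pos _).le
      _ = 4 / Real.pi * B * Real.exp (-(K * θ / 2)) := by field_simp; ring
      _ ≤ 2 * B * Real.exp (-(K * θ / 2)) := by gcongr
  linarith [norm_sub_le_norm_sub_add_norm_sub (g x) (∑ k ∈ Finset.Icc (-N : ℤ) N, v k)
    (∑ k ∈ Finset.Icc (-K : ℤ) K, v k)]

/-- The bound for the squared error of the projection onto the span of the nodes `|k| ≤ K`, without
the factor `exp (-L)`, at points `x` with `|x| ≤ L - 1`, where `L = √(2πdK) ≥ √(2πd)`. -/
def coreConst (d M B : ℝ) : ℝ :=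
  2 * (4 / (Real.pi * d * (1 - Real.exp (-√(2 * Real.pi * d))) ^ 2) * M ^ 2 + 4 * B ^ 2)

/-- The constant of the sinc approximation in the strip of half-width `d`. -/
def stripConst (d : ℝ) : ℝ :=
  4 * √(2 * Real.pi * d) *
    (4 / (Real.pi * d * (1 - Real.exp (-√(2 * Real.pi * d))) ^ 2) + 4) + 6

theorem stripConst_pos {d : ℝ} (hd : 0 < d) : 0 < stripConst d := by
  have := Real.pi_pos
  unfold stripConst
  positivity

theorem coreConst_nonneg {d : ℝ} (hd : 0 < d) (M B : ℝ) : 0 ≤ coreConst d M B := by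
  have := Real.pi_pos
  unfold coreConst
  positivity

theorem natCast_mul_sqrt_two_pi_div {K : ℕ} (hK : 1 ≤ K) (d : ℝ) :
    K * √(2 * Real.pi * d / K) = √(2 * Real.pi * d * K) := by
  have hK0 : (0 : ℝ) < K := by exact_mod_cast hK
  rw [← Real.sqrt_sq hK0.le, ← Real.sqrt_mul (sq_nonneg _), Real.sqrt_sq hK0.le]
  congr 1
  field_simp

theorem pi_mul_div_sqrt_two_pi_div {K : ℕ} (hK : 1 ≤ K) (hd : 0 < d) :
    Real.pi * d / √(2 * Real.pi * d / K) = √(2 * Real.pi * d * K) / 2 := by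
  have := Real.pi_pos
  have : (0 : ℝ) < K := by exact_mod_cast hK
  rw [← natCast_mul_sqrt_two_pi_div hK, div_eq_div_iff (by positivity) two_ne_zero,
    mul_assoc (K : ℝ), Real.mul_self_sqrt (by positivity)]
  field_simp

theorem sq_norm_sub_starProjection_le_of_nodes [CompleteSpace V]
    (hg : DifferentiableOn ℂ g {w | |w.im| < d}) (hd : 0 < d) (hM : 0 ≤ M) (hB : 0 ≤ B)
    (hgM : ∀ s : ℝ, s ≠ 0 → |s| < d →
      ∫⁻ t : ℝ, ‖g (t + s * Complex.I)‖ₑ ^ 2 ≤ ENNReal.ofReal (M ^ 2))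
    (hgB : ∀ x : ℝ, ‖g x‖ ≤ B * Real.exp (-(|x| / 2))) {K : ℕ} (hK : 1 ≤ K)
    (W : Submodule ℂ V) [W.HasOrthogonalProjection]
    (hW : ∀ k : ℤ, |k| ≤ K → g ((k * √(2 * Real.pi * d / K) : ℝ) : ℂ) ∈ W) {x : ℝ}
    (hx : |x| ≤ √(2 * Real.pi * d * K) - 1) :
    ‖g x - W.starProjection (g x)‖ ^ 2 ≤
      coreConst d M B * Real.exp (-√(2 * Real.pi * d * K)) := by
  have := Real.pi_pos
  have : (0 : ℝ) < K := by exact_mod_cast hK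
  set l := √(2 * Real.pi * d)
  set L := √(2 * Real.pi * d * K)
  have hl : 0 < l := by positivity
  have hlL : l ≤ L := Real.sqrt_le_sqrt (le_mul_of_one_le_right (by positivity)
    (by exact_mod_cast hK))
  set q := 1 - Real.exp (-l) with hq
  have hq0 : 0 < q := sub_pos.2 (Real.exp_lt_one_iff.2 (by linarith))
  have herror := norm_sub_starProjection_le_of_nodes hg hd hM hB hgM hgB (by positivity) W hW
    (x := x) (by rw [natCast_mul_sqrt_two_pi_div hK]; linarith)
  rw [pi_mul_div_sqrt_two_pi_div hK hd, natCast_mul_sqrt_two_pi_div hK] at herror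
  have hsinh : (Real.sinh (L / 2))⁻¹ ≤ 2 / q * Real.exp (-(L / 2)) := by
    have h := inv_sinh_le (half_pos hl) (by linarith : l / 2 ≤ L / 2)
    rwa [mul_div_cancel₀ l two_ne_zero] at h
  have hexp : Real.exp (-(L / 2)) ^ 2 = Real.exp (-L) := by
    rw [← Real.exp_nat_mul]
    ring_nf
  calc ‖g x - W.starProjection (g x)‖ ^ 2
      ≤ (M / √(Real.pi * d) * (2 / q * Real.exp (-(L / 2))) +
          2 * B * Real.exp (-(L / 2))) ^ 2 := by
        gcongr
        refine herror.trans ?_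
        rw [← div_div, div_eq_mul_inv (M / √(Real.pi * d))]
        gcongr
    _ = (M / √(Real.pi * d) * (2 / q) + 2 * B) ^ 2 * Real.exp (-L) := by
        rw [← hexp]
        ring
    _ ≤ 2 * ((M / √(Real.pi * d) * (2 / q)) ^ 2 + (2 * B) ^ 2) * Real.exp (-L) := by
        gcongr
        exact add_sq_le
    _ = coreConst d M B * Real.exp (-L) := by
        rw [coreConst, ← hq, mul_pow, div_pow, Real.sq_sqrt (by positivity)]
        field_simp
        ring

theorem lintegral_enorm_sq_le_of_le_of_lt {E : Type*} [NormedAddCommGroup E] {f : ℝ → E}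
    {r X B : ℝ} (hr : 0 ≤ r + 1) (hX : 0 ≤ X) (hcore : ∀ x, |x| ≤ r → ‖f x‖ ^ 2 ≤ X)
    (htail : ∀ x, ‖f x‖ ≤ B * Real.exp (-(|x| / 2))) :
    ∫⁻ x, ‖f x‖ₑ ^ 2 ≤ ENNReal.ofReal (2 * (r + 1) * X + 2 * B ^ 2 * Real.exp (-r)) := by
  have hinner : ∫⁻ x in Icc (-r) r, ‖f x‖ₑ ^ 2 ≤ ENNReal.ofReal (2 * (r + 1) * X) := by
    calc _ ≤ ∫⁻ _ : ℝ in Icc (-r) r, ENNReal.ofReal X := by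
          refine setLIntegral_mono' measurableSet_Icc fun x hx => ?_
          rw [enorm_sq_eq_ofReal]
          exact ENNReal.ofReal_le_ofReal (hcore x (abs_le.2 hx))
      _ ≤ _ := by
          rw [lintegral_const, Measure.restrict_apply_univ, Real.volume_Icc,
            ← ENNReal.ofReal_mul hX, mul_comm]
          gcongr
          linarith
  have houter : ∫⁻ x in {x : ℝ | r < |x|}, ‖f x‖ₑ ^ 2 ≤
      ENNReal.ofReal (2 * B ^ 2 * Real.exp (-r)) := by
    calc _ ≤ ∫⁻ x in {x : ℝ | r < |x|}, ENNReal.ofReal (B ^ 2) *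
          ENNReal.ofReal (Real.exp (-|x|)) := by
          refine lintegral_mono fun x => ?_
          have hexp : Real.exp (-(|x| / 2)) ^ 2 = Real.exp (-|x|) := by
            rw [← Real.exp_nat_mul]
            ring_nf
          rw [enorm_sq_eq_ofReal, ← ENNReal.ofReal_mul (by positivity), ← hexp, ← mul_pow]
          gcongr
          exact htail x
      _ ≤ ENNReal.ofReal (B ^ 2) * ENNReal.ofReal (2 * Real.exp (-r)) := by
          rw [lintegral_const_mul' _ _ (by simp)]
          gcongr
          exact lintegral_exp_neg_abs_le _
      _ = _ := by
          rw [← ENNReal.ofReal_mul (by positivity)]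
          ring_nf
  have hcover : (univ : Set ℝ) ⊆ Icc (-r) r ∪ {x : ℝ | r < |x|} := fun x _ =>
    (le_or_gt |x| r).imp abs_le.1 id
  rw [← setLIntegral_univ, ENNReal.ofReal_add (by positivity) (by positivity)]
  exact (lintegral_mono_set hcover).trans ((lintegral_union_le _ _ _).trans
    (add_le_add hinner houter))

theorem lintegral_sub_starProjection_le_of_nodes [CompleteSpace V]
    (hg : DifferentiableOn ℂ g {w | |w.im| < d}) (hd : 0 < d) (hM : 0 ≤ M) (hB : 0 ≤ B)
    (hgM : ∀ s : ℝ, s ≠ 0 → |s| < d →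
      ∫⁻ t : ℝ, ‖g (t + s * Complex.I)‖ₑ ^ 2 ≤ ENNReal.ofReal (M ^ 2))
    (hgB : ∀ x : ℝ, ‖g x‖ ≤ B * Real.exp (-(|x| / 2))) {K : ℕ} (hK : 1 ≤ K)
    (W : Submodule ℂ V) [W.HasOrthogonalProjection]
    (hW : ∀ k : ℤ, |k| ≤ K → g ((k * √(2 * Real.pi * d / K) : ℝ) : ℂ) ∈ W) :
    ∫⁻ x : ℝ, ‖g x - W.starProjection (g x)‖ₑ ^ 2 ≤
      ENNReal.ofReal (stripConst d * (√K * Real.exp (-√(2 * Real.pi * d * K)) *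
        (M ^ 2 + B ^ 2))) := by
  have := Real.pi_pos
  have hK1 : 1 ≤ √(K : ℝ) := Real.one_le_sqrt.2 (by exact_mod_cast hK)
  have hcore := coreConst_nonneg hd M B
  set l := √(2 * Real.pi * d) with hl
  set L := √(2 * Real.pi * d * K)
  have hLl : L = l * √K := Real.sqrt_mul (by positivity) _
  have hL0 : 0 ≤ L := Real.sqrt_nonneg _
  refine (lintegral_enorm_sq_le_of_le_of_lt (r := L - 1) (by linarith) (by positivity)
    (fun x hx => sq_norm_sub_starProjection_le_of_nodes hg hd hM hB hgM hgB hK W hW hx)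
    fun x => (norm_sub_starProjection_le_self W _).trans (hgB x)).trans ?_
  apply ENNReal.ofReal_le_ofReal
  have hexp : Real.exp (-(L - 1)) ≤ 3 * Real.exp (-L) := by
    rw [neg_sub, sub_eq_add_neg, Real.exp_add]
    gcongr
    exact (Real.exp_one_lt_d9.trans (by norm_num)).le
  have hA : 0 ≤ 4 / (Real.pi * d * (1 - Real.exp (-l)) ^ 2) := by positivity
  have hconst : 2 * l * coreConst d M B + 6 * B ^ 2 ≤ stripConst d * (M ^ 2 + B ^ 2) := by
    rw [stripConst, coreConst, ← hl]
    set A := 4 / (Real.pi * d * (1 - Real.exp (-l)) ^ 2)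
    have hdiff : 0 ≤ 4 * l * A * B ^ 2 + 16 * l * M ^ 2 + 6 * M ^ 2 := by positivity
    linarith
  calc 2 * (L - 1 + 1) * (coreConst d M B * Real.exp (-L)) + 2 * B ^ 2 * Real.exp (-(L - 1))
      ≤ 2 * L * (coreConst d M B * Real.exp (-L)) + 2 * B ^ 2 * (3 * Real.exp (-L)) * √K := by
        rw [sub_add_cancel]
        refine add_le_add le_rfl (le_trans ?_ (le_mul_of_one_le_right (by positivity) hK1))
        gcongr
    _ = √K * Real.exp (-L) * (2 * l * coreConst d M B + 6 * B ^ 2) := by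
        rw [hLl]
        ring
    _ ≤ √K * Real.exp (-L) * (stripConst d * (M ^ 2 + B ^ 2)) := by gcongr
    _ = _ := by ring

end StripApproximation

section Hyperbolic

theorem sinh_add_mul_I (x s : ℝ) : Complex.sinh (x + s * Complex.I) =
    (Real.sinh x * Real.cos s : ℝ) + (Real.cosh x * Real.sin s : ℝ) * Complex.I := by
  rw [Complex.sinh_add, Complex.cosh_mul_I, Complex.sinh_mul_I]
  push_cast
  ring

theorem cosh_add_mul_I (x s : ℝ) : Complex.cosh (x + s * Complex.I) =
    (Real.cosh x * Real.cos s : ℝ) + (Real.sinh x * Real.sin s : ℝ) * Complex.I := by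
  rw [Complex.cosh_add, Complex.cosh_mul_I, Complex.sinh_mul_I]
  push_cast
  ring

theorem cosh_re_pos {w : ℂ} (hw : |w.im| < Real.pi / 2) : 0 < (Complex.cosh w).re := by
  rw [← Complex.re_add_im w, cosh_add_mul_I]
  simp only [Complex.add_re, Complex.ofReal_re, Complex.mul_re, Complex.I_re, mul_zero,
    Complex.ofReal_im, Complex.I_im, mul_one, sub_self, add_zero]
  exact mul_pos (Real.cosh_pos _) (Real.cos_pos_of_mem_Ioo (abs_lt.1 hw))

theorem norm_cosh_add_mul_I_le (x s : ℝ) :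
    ‖Complex.cosh (x + s * Complex.I)‖ ≤ Real.cosh x := by
  refine (le_abs_self _).trans (abs_le_of_sq_le_sq ?_ (Real.cosh_pos x).le)
  rw [cosh_add_mul_I, ← Complex.normSq_eq_norm_sq, Complex.normSq_add_mul_I]
  nlinarith [Real.cosh_sq x, Real.sin_sq_add_cos_sq s, sq_nonneg (Real.sin s)]

theorem sinh_mem_dom {d : ℝ} (hd : d ≤ Real.pi / 2) {w : ℂ} (hw : |w.im| < d) :
    Complex.sinh w ∈ dom d := by
  have hcosh : (1 + Complex.sinh w ^ 2) ^ (1 / 2 : ℂ) = Complex.cosh w := by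
    rw [add_comm, ← Complex.cosh_sq, one_div]
    exact Complex.sq_cpow_two_inv (cosh_re_pos (hw.trans_le hd))
  change |Complex.arg (Complex.sinh w + (1 + Complex.sinh w ^ 2) ^ (1 / 2 : ℂ))| < d
  have := Real.pi_pos
  have := abs_lt.1 hw
  rw [hcosh, Complex.sinh_add_cosh, ← Complex.log_im, Complex.log_exp (by linarith) (by linarith)]
  exact hw

theorem inv_cosh_le_two_mul_exp_neg_abs (x : ℝ) :
    (Real.cosh x)⁻¹ ≤ 2 * Real.exp (-|x|) := by
  rw [inv_le_iff_one_le_mul₀ (Real.cosh_pos x), ← Real.cosh_abs, Real.cosh_eq]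
  have : Real.exp (-|x|) * Real.exp |x| = 1 := by rw [← Real.exp_add, neg_add_cancel, Real.exp_zero]
  nlinarith [sq_nonneg (Real.exp (-|x|))]

theorem lintegral_inv_cosh_le : ∫⁻ x : ℝ, ENNReal.ofReal ((Real.cosh x)⁻¹) ≤ 4 := by
  have hpos : {x : ℝ | 0 < |x|} =ᵐ[volume] univ := by
    have : {x : ℝ | 0 < |x|} = {0}ᶜ := by ext; simp [abs_pos]
    rw [this]
    exact ae_eq_univ.2 (by simp)
  have hexp := lintegral_exp_neg_abs_le 0
  rw [setLIntegral_congr hpos, setLIntegral_univ] at hexp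
  calc _ ≤ ∫⁻ x : ℝ, ENNReal.ofReal 2 * ENNReal.ofReal (Real.exp (-|x|)) := by
        refine lintegral_mono fun x => ?_
        rw [← ENNReal.ofReal_mul zero_le_two]
        exact ENNReal.ofReal_le_ofReal (inv_cosh_le_two_mul_exp_neg_abs x)
    _ ≤ ENNReal.ofReal 2 * ENNReal.ofReal (2 * Real.exp (-0)) := by
        rw [lintegral_const_mul' _ _ ENNReal.ofReal_ne_top]
        gcongr
    _ = 4 := by
        rw [← ENNReal.ofReal_mul zero_le_two, neg_zero, Real.exp_zero]
        norm_num

theorem lintegral_eq_lintegral_cosh_mul_comp_sinh (f : ℝ → ℝ≥0∞) :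
    ∫⁻ τ : ℝ, f τ = ∫⁻ x : ℝ, ENNReal.ofReal (Real.cosh x) * f (Real.sinh x) := by
  have := lintegral_image_eq_lintegral_abs_deriv_mul (s := univ) MeasurableSet.univ
    (fun x _ => (Real.hasDerivAt_sinh x).hasDerivWithinAt) Real.sinh_injective.injOn f
  simpa only [image_univ, Real.sinh_surjective.range_eq, setLIntegral_univ,
    abs_of_pos (Real.cosh_pos _)] using this

/-- The scalar by which `s + A` acts on an eigenvector on which the embedding `V ⊆ V⋆` has the
eigenvalue `m` and the operator `A` has the eigenvalue `p`. -/
def symbol (m p : ℝ) (s : ℂ) : ℂ := s * m + p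

theorem symbol_ne_zero {m p : ℝ} {s : ℂ} (hm : 0 < m) (hp : 0 ≤ p) (hs : 0 < s.re) :
    symbol m p s ≠ 0 := by
  intro hzero
  have hre := congrArg Complex.re hzero
  simp only [symbol, Complex.add_re, Complex.mul_re, Complex.ofReal_re, Complex.ofReal_im,
    mul_zero, sub_zero, Complex.zero_re] at hre
  linarith [mul_pos hs hm]

theorem norm_symbol_sq (x s α m p : ℝ) :
    ‖symbol m p (α + Complex.I * Complex.sinh (x + s * Complex.I))‖ ^ 2 =
      (p + α * m - m * Real.cosh x * Real.sin s) ^ 2 +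
        ((m * Real.cosh x) ^ 2 - m ^ 2) * (1 - Real.sin s ^ 2) := by
  have hsymbol : symbol m p (α + Complex.I * Complex.sinh (x + s * Complex.I)) =
      ((p + α * m - m * Real.cosh x * Real.sin s : ℝ) : ℂ) +
        ((m * Real.sinh x * Real.cos s : ℝ) : ℂ) * Complex.I := by
    rw [symbol, sinh_add_mul_I]
    push_cast
    linear_combination (Complex.cosh x * Complex.sin s * m : ℂ) * Complex.I_sq
  rw [hsymbol, ← Complex.normSq_eq_norm_sq, Complex.normSq_add_mul_I, ← Real.cos_sq', mul_pow,
    mul_pow, Real.sinh_sq]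
  ring

theorem one_sub_mul_le_sub_mul {a b σ S : ℝ} (ha : 0 ≤ a) (hab : a ≤ b) (hσ : σ ≤ S)
    (hS : 0 ≤ S) : (1 - S) * b ≤ b - a * σ := by
  have : a * σ ≤ b * S := (mul_le_mul_of_nonneg_left hσ ha).trans
    (mul_le_mul_of_nonneg_right hab hS)
  linarith

theorem mul_max_le_norm_symbol {d s x α m p : ℝ} (hd : d < Real.pi / 2) (hs : |s| ≤ d)
    (hm : 0 ≤ m) (hmp : m ≤ p + α * m) :
    (1 - Real.sin d) * max (p + α * m) (m * Real.cosh x) ≤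
      ‖symbol m p (α + Complex.I * Complex.sinh (x + s * Complex.I))‖ := by
  have hd₀ : 0 ≤ d := (abs_nonneg s).trans hs
  have hsin : Real.sin s ≤ Real.sin d := Real.sin_le_sin_of_le_of_le_pi_div_two
    (by linarith [abs_le.1 hs]) hd.le (abs_le.1 hs).2
  have hsin₀ : 0 ≤ Real.sin d :=
    Real.sin_nonneg_of_nonneg_of_le_pi hd₀ (by linarith [Real.pi_pos])
  have hcos : 0 ≤ 1 - Real.sin s ^ 2 := by
    rw [← Real.cos_sq']
    positivity
  have hmc : m ≤ m * Real.cosh x := le_mul_of_one_le_right hm (Real.one_le_cosh x)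
  have hpos : 0 ≤ 1 - Real.sin d := sub_nonneg.2 (Real.sin_le_one d)
  refine (le_abs_self _).trans (abs_le_of_sq_le_sq ?_ (norm_nonneg _))
  rw [norm_symbol_sq]
  set a := m * Real.cosh x
  set ν := p + α * m
  have hν : 0 ≤ ν := hm.trans hmp
  have ha : 0 ≤ a := hm.trans hmc
  rcases le_total a ν with h | h
  · rw [max_eq_left h]
    have hsq := pow_le_pow_left₀ (by positivity) (one_sub_mul_le_sub_mul ha h hsin hsin₀) 2
    have : 0 ≤ (a ^ 2 - m ^ 2) * (1 - Real.sin s ^ 2) :=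
      mul_nonneg (sub_nonneg.2 (pow_le_pow_left₀ hm hmc 2)) hcos
    linarith
  · -- the expression for `‖symbol‖ ^ 2` is symmetric in `a` and `ν`
    rw [max_eq_right h]
    have hsq := pow_le_pow_left₀ (by positivity) (one_sub_mul_le_sub_mul hν h hsin hsin₀) 2
    have : 0 ≤ (ν ^ 2 - m ^ 2) * (1 - Real.sin s ^ 2) :=
      mul_nonneg (sub_nonneg.2 (pow_le_pow_left₀ hm hmp 2)) hcos
    linarith

end Hyperbolic

section Resolvent

variable {V : Type} [NormedAddCommGroup V] [InnerProductSpace ℂ V] {ι : Type*} [Fintype ι]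

theorem norm_sum_smul_sq (b : OrthonormalBasis ι ℂ V) (x : ι → ℂ) :
    ‖∑ j, x j • b j‖ ^ 2 = ∑ j, ‖x j‖ ^ 2 := by
  rw [← b.sum_sq_norm_inner_right]
  exact Finset.sum_congr rfl fun i _ => by rw [b.orthonormal.inner_right_fintype]

theorem norm_sum_smul_le (b : OrthonormalBasis ι ℂ V) {x y : ι → ℂ} {C : ℝ} (hC : 0 ≤ C)
    (h : ∀ j, ‖x j‖ ≤ C * ‖y j‖) : ‖∑ j, x j • b j‖ ≤ C * ‖∑ j, y j • b j‖ := by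
  refine (le_abs_self _).trans (abs_le_of_sq_le_sq ?_ (by positivity))
  rw [mul_pow, norm_sum_smul_sq, norm_sum_smul_sq, Finset.mul_sum]
  refine Finset.sum_le_sum fun j _ => ?_
  rw [← mul_pow]
  exact pow_le_pow_left₀ (norm_nonneg _) (h j) 2

theorem norm_sum_antiDual_smul_le (b : OrthonormalBasis ι ℂ V) (φ : AntiDual V) :
    ‖∑ j, φ (b j) • b j‖ ≤ ‖φ‖ := by
  set v := ∑ j, φ (b j) • b j with hv
  have happly : φ v = (‖v‖ ^ 2 : ℝ) := by
    rw [norm_sum_smul_sq, hv, map_sum]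
    push_cast
    refine Finset.sum_congr rfl fun j _ => ?_
    rw [map_smulₛₗ, smul_eq_mul, Complex.conj_mul']
  have hle := φ.le_opNorm v
  rw [happly, Complex.norm_real, Real.norm_of_nonneg (by positivity), sq] at hle
  rcases (norm_nonneg v).eq_or_lt with h | h
  · exact h ▸ norm_nonneg _
  · exact le_of_mul_le_mul_right hle h

/-- The solution `w` of `(s + A) w = φ + q`, in an orthonormal basis of `V` in which the embedding
`V ⊆ V⋆` has the eigenvalues `m j` and the operator `A` has the eigenvalues `p j`. -/
def resolvent (b : OrthonormalBasis ι ℂ V) (m p : ι → ℝ) (s : ℂ) (φ : AntiDual V) (q : V) : V :=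
  ∑ j, ((φ (b j) + m j * inner ℂ (b j) q) / symbol (m j) (p j) s) • b j

theorem norm_resolvent_le (b : OrthonormalBasis ι ℂ V) {m p : ι → ℝ} {s : ℂ} (φ : AntiDual V)
    (q : V) {C c : ℝ} (hC : 0 ≤ C) (hc : 0 < c) (hm : ∀ j, 0 ≤ m j)
    (hsymbol : ∀ j, 1 ≤ C * ‖symbol (m j) (p j) s‖)
    (hsymbol' : ∀ j, m j * c ≤ C * ‖symbol (m j) (p j) s‖) :
    ‖resolvent b m p s φ q‖ ≤ C * (‖φ‖ + ‖q‖ / c) := by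
  have hpos : ∀ j, 0 < ‖symbol (m j) (p j) s‖ := fun j =>
    pos_of_mul_pos_right (one_pos.trans_le (hsymbol j)) hC
  have hsplit : resolvent b m p s φ q = ∑ j, (φ (b j) / symbol (m j) (p j) s) • b j +
      ∑ j, ((m j * inner ℂ (b j) q) / symbol (m j) (p j) s) • b j := by
    simp only [resolvent, ← Finset.sum_add_distrib, add_div, add_smul]
  rw [hsplit, mul_add]
  refine (norm_add_le _ _).trans (add_le_add ?_ ?_)
  · refine (norm_sum_smul_le b (y := fun j => φ (b j)) hC fun j => ?_).trans
      (mul_le_mul_of_nonneg_left (norm_sum_antiDual_smul_le b φ) hC)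
    rw [norm_div, div_le_iff₀ (hpos j), mul_right_comm]
    exact le_mul_of_one_le_left (norm_nonneg _) (hsymbol j)
  · rw [mul_div_assoc', mul_comm C, mul_div_assoc, mul_comm ‖q‖]
    nth_rw 2 [← b.sum_repr' q]
    refine norm_sum_smul_le b (div_nonneg hC hc.le) fun j => ?_
    rw [norm_div, norm_mul, Complex.norm_real, Real.norm_of_nonneg (hm j), div_le_iff₀ (hpos j),
      mul_right_comm]
    refine mul_le_mul_of_nonneg_right ?_ (norm_nonneg _)
    rw [div_mul_eq_mul_div, le_div_iff₀ hc]
    exact hsymbol' j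

end Resolvent

section LineIntegrals

/-- Evaluation of antilinear functionals at `v`. -/
def AntiDual.evalCLM {V : Type} [NormedAddCommGroup V] [InnerProductSpace ℂ V] (v : V) :
    AntiDual V →L[ℂ] ℂ :=
  LinearMap.mkContinuous
    { toFun := fun φ => φ v
      map_add' := fun _ _ => rfl
      map_smul' := fun _ _ => rfl } ‖v‖ fun φ => by
    rw [mul_comm]
    exact φ.le_opNorm v

@[simp]
theorem AntiDual.evalCLM_apply {V : Type} [NormedAddCommGroup V] [InnerProductSpace ℂ V] (v : V)
    (φ : AntiDual V) : AntiDual.evalCLM v φ = φ v :=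
  rfl

theorem lintegral_line_le_nTwoSq {X : Type} [NormedAddCommGroup X] [NormedSpace ℂ X]
    (d : ℝ) (F : ℂ → X) {s : ℝ} (hs : s ≠ 0) (hsd : |s| < d) :
    ∫⁻ x : ℝ, ‖F (Complex.sinh (x + s * Complex.I))‖ₑ ^ 2 *
      ‖Complex.cosh (x + s * Complex.I)‖ₑ ≤ nTwoSq d F := by
  refine le_trans ?_ (le_iSup₂ (f := fun y (_ : y ∈ Ioo 0 d) => boundaryIntegral y F) |s|
    ⟨abs_pos.2 hs, hsd⟩)
  rw [boundaryIntegral]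
  rcases lt_or_gt_of_ne hs with h | h
  · have (x : ℝ) : (x : ℂ) - Complex.I * (|s| : ℝ) = x + s * Complex.I := by
      rw [abs_of_neg h]; push_cast; ring
    simp only [this]
    exact le_add_self
  · simp only [abs_of_pos h, mul_comm Complex.I]
    exact le_self_add

variable {V : Type} [NormedAddCommGroup V] [InnerProductSpace ℂ V] {ι : Type*}
  {m p : ι → ℝ} {α β d C₀ : ℝ} {Φ : ℂ → AntiDual V} {q : V}

/-- The eigenvalues `m j ≥ 0` of the embedding `V ⊆ V⋆` and `p j` of the operator `A` are those of a
problem in which `A + α` dominates the embedding and, up to the factor `β`, the norm of `V`. -/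
structure IsCoercive (m p : ι → ℝ) (α β : ℝ) : Prop where
  nonneg : ∀ j, 0 ≤ m j
  le_add : ∀ j, m j ≤ p j + α * m j
  one_le_mul_add : ∀ j, 1 ≤ β * (p j + α * m j)
  one_le : 1 ≤ β

/-- The bound for `(α + iz + A)⁻¹ : V⋆ → V` in the domain `D_d`. -/
def resolventConst (β d : ℝ) : ℝ := β * (1 - Real.sin d)⁻¹

theorem one_sub_sin_pos (hd : d ∈ Ioo 0 (Real.pi / 2)) : 0 < 1 - Real.sin d := by
  have := Real.sin_lt_sin_of_lt_of_le_pi_div_two (by linarith [hd.1, hd.2]) le_rfl hd.2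
  rwa [Real.sin_pi_div_two, ← sub_pos] at this

theorem IsCoercive.resolventConst_pos (h : IsCoercive m p α β) (hd : d ∈ Ioo 0 (Real.pi / 2)) :
    0 < resolventConst β d :=
  mul_pos (one_pos.trans_le h.one_le) (inv_pos.2 (one_sub_sin_pos hd))

theorem IsCoercive.max_le_mul_norm_symbol (h : IsCoercive m p α β)
    (hd : d ∈ Ioo 0 (Real.pi / 2)) (x : ℝ) {s : ℝ} (hs : |s| ≤ d) (j : ι) :
    max 1 (m j * Real.cosh x) ≤ resolventConst β d *
      ‖symbol (m j) (p j) (α + Complex.I * Complex.sinh (x + s * Complex.I))‖ := by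
  have hβ : 0 ≤ β := zero_le_one.trans h.one_le
  have hsymbol := mul_max_le_norm_symbol (x := x) hd.2 hs (h.nonneg j) (h.le_add j)
  rw [← le_inv_mul_iff₀ (one_sub_sin_pos hd)] at hsymbol
  rw [resolventConst, mul_assoc]
  refine le_trans ?_ (mul_le_mul_of_nonneg_left hsymbol hβ)
  have hmc : 0 ≤ m j * Real.cosh x := mul_nonneg (h.nonneg j) (Real.cosh_pos x).le
  refine max_le ?_ ?_
  · exact (h.one_le_mul_add j).trans (mul_le_mul_of_nonneg_left (le_max_left _ _) hβ)
  · exact (le_mul_of_one_le_left hmc h.one_le).trans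
      (mul_le_mul_of_nonneg_left (le_max_right _ _) hβ)

theorem IsCoercive.symbol_ne_zero (h : IsCoercive m p α β) (hd : d ∈ Ioo 0 (Real.pi / 2))
    {w : ℂ} (hw : |w.im| ≤ d) (j : ι) :
    symbol (m j) (p j) (α + Complex.I * Complex.sinh w) ≠ 0 := by
  have hmax := (le_max_left _ _).trans (h.max_le_mul_norm_symbol hd w.re hw j)
  rw [Complex.re_add_im] at hmax
  exact norm_pos_iff.1 (pos_of_mul_pos_right (one_pos.trans_le hmax) (h.resolventConst_pos hd).le)

variable [Fintype ι] {b : OrthonormalBasis ι ℂ V}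

theorem IsCoercive.norm_resolvent_le (h : IsCoercive m p α β) (hd : d ∈ Ioo 0 (Real.pi / 2))
    (φ : AntiDual V) (q : V) (x : ℝ) {s : ℝ} (hs : |s| ≤ d) :
    ‖resolvent b m p (α + Complex.I * Complex.sinh (x + s * Complex.I)) φ q‖ ≤
      resolventConst β d * (‖φ‖ + ‖q‖ / Real.cosh x) :=
  LaplaceRB.norm_resolvent_le b φ q (h.resolventConst_pos hd).le (Real.cosh_pos x) h.nonneg
    (fun j => (le_max_left _ _).trans (h.max_le_mul_norm_symbol hd x hs j))
    fun j => (le_max_right _ _).trans (h.max_le_mul_norm_symbol hd x hs j)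

/-- The pull-back of `z ↦ (α + iz + A)⁻¹ (Φ z + q)` to the strip by `z = sinh w`, with the weight
`√(cosh w)` that turns `|dz|` into `|dw|`. -/
def stripResolvent (b : OrthonormalBasis ι ℂ V) (m p : ι → ℝ) (α : ℝ) (Φ : ℂ → AntiDual V)
    (q : V) (w : ℂ) : V :=
  Complex.cosh w ^ (((2 : ℕ) : ℂ)⁻¹) •
    resolvent b m p (α + Complex.I * Complex.sinh w) (Φ (Complex.sinh w)) q

theorem norm_stripResolvent_sq (w : ℂ) :
    ‖stripResolvent b m p α Φ q w‖ ^ 2 = ‖Complex.cosh w‖ *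
      ‖resolvent b m p (α + Complex.I * Complex.sinh w) (Φ (Complex.sinh w)) q‖ ^ 2 := by
  rw [stripResolvent, norm_smul, mul_pow, ← norm_pow, Complex.cpow_nat_inv_pow _ two_ne_zero]

theorem differentiableOn_stripResolvent (h : IsCoercive m p α β)
    (hd : d ∈ Ioo 0 (Real.pi / 2)) (hΦ : DifferentiableOn ℂ Φ (dom d)) :
    DifferentiableOn ℂ (stripResolvent b m p α Φ q) {w | |w.im| < d} := by
  have hsinh : DifferentiableOn ℂ Complex.sinh {w | |w.im| < d} :=
    Complex.differentiable_sinh.differentiableOn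
  have hweight : DifferentiableOn ℂ (fun w => Complex.cosh w ^ (((2 : ℕ) : ℂ)⁻¹))
      {w | |w.im| < d} :=
    Complex.differentiable_cosh.differentiableOn.cpow_const fun w hw =>
      Or.inl (cosh_re_pos (lt_trans hw hd.2))
  refine hweight.smul (DifferentiableOn.fun_sum fun j _ =>
    (DifferentiableOn.div ?_ ?_ fun w hw => h.symbol_ne_zero hd (le_of_lt hw) j).smul_const _)
  · exact ((AntiDual.evalCLM (b j)).differentiable.comp_differentiableOn
      (hΦ.comp hsinh fun w hw => sinh_mem_dom hd.2.le hw)).add_const _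
  · exact (((hsinh.const_mul _).const_add _).mul_const _).add_const _

theorem norm_stripResolvent_sq_le (h : IsCoercive m p α β) (hd : d ∈ Ioo 0 (Real.pi / 2))
    (x : ℝ) {s : ℝ} (hs : |s| ≤ d) :
    ‖stripResolvent b m p α Φ q (x + s * Complex.I)‖ ^ 2 ≤ 2 * resolventConst β d ^ 2 *
      (‖Φ (Complex.sinh (x + s * Complex.I))‖ ^ 2 * ‖Complex.cosh (x + s * Complex.I)‖ +
        ‖q‖ ^ 2 * (Real.cosh x)⁻¹) := by
  have := Real.cosh_pos x
  have hcosh := norm_cosh_add_mul_I_le x s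
  have hres := h.norm_resolvent_le (b := b) hd (Φ (Complex.sinh (x + s * Complex.I))) q x hs
  rw [norm_stripResolvent_sq]
  set c := ‖Complex.cosh (x + s * Complex.I)‖
  set C := resolventConst β d
  set f := ‖Φ (Complex.sinh (x + s * Complex.I))‖
  calc _ ≤ c * (C * (f + ‖q‖ / Real.cosh x)) ^ 2 := by gcongr
    _ = c * C ^ 2 * (f + ‖q‖ / Real.cosh x) ^ 2 := by ring
    _ ≤ c * C ^ 2 * (2 * (f ^ 2 + (‖q‖ / Real.cosh x) ^ 2)) := by
      gcongr
      exact add_sq_le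
    _ = 2 * C ^ 2 * (f ^ 2 * c + c * (‖q‖ / Real.cosh x) ^ 2) := by ring
    _ ≤ 2 * C ^ 2 * (f ^ 2 * c + Real.cosh x * (‖q‖ / Real.cosh x) ^ 2) := by gcongr
    _ = _ := by field_simp

theorem lintegral_stripResolvent_line_le (h : IsCoercive m p α β)
    (hd : d ∈ Ioo 0 (Real.pi / 2)) {s : ℝ} (hs : s ≠ 0) (hsd : |s| < d) :
    ∫⁻ x : ℝ, ‖stripResolvent b m p α Φ q (x + s * Complex.I)‖ₑ ^ 2 ≤
      ENNReal.ofReal (2 * resolventConst β d ^ 2) *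
        (nTwoSq d Φ + ENNReal.ofReal (4 * ‖q‖ ^ 2)) := by
  calc _ ≤ ∫⁻ x : ℝ, ENNReal.ofReal (2 * resolventConst β d ^ 2) *
        (‖Φ (Complex.sinh (x + s * Complex.I))‖ₑ ^ 2 * ‖Complex.cosh (x + s * Complex.I)‖ₑ +
          ENNReal.ofReal (‖q‖ ^ 2) * ENNReal.ofReal ((Real.cosh x)⁻¹)) := by
        refine lintegral_mono fun x => ?_
        have := Real.cosh_pos x
        rw [enorm_sq_eq_ofReal, enorm_sq_eq_ofReal, ← ofReal_norm,
          ← ENNReal.ofReal_mul (by positivity), ← ENNReal.ofReal_mul (by positivity),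
          ← ENNReal.ofReal_add (by positivity) (by positivity),
          ← ENNReal.ofReal_mul (by positivity)]
        exact ENNReal.ofReal_le_ofReal (norm_stripResolvent_sq_le h hd x hsd.le)
    _ = ENNReal.ofReal (2 * resolventConst β d ^ 2) *
        ((∫⁻ x : ℝ, ‖Φ (Complex.sinh (x + s * Complex.I))‖ₑ ^ 2 *
          ‖Complex.cosh (x + s * Complex.I)‖ₑ) +
          ENNReal.ofReal (‖q‖ ^ 2) * ∫⁻ x : ℝ, ENNReal.ofReal ((Real.cosh x)⁻¹)) := by
        rw [lintegral_const_mul' _ _ ENNReal.ofReal_ne_top, lintegral_add_right _ (by fun_prop),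
          lintegral_const_mul' _ _ ENNReal.ofReal_ne_top]
    _ ≤ _ := by
        rw [mul_comm 4, ENNReal.ofReal_mul (p := ‖q‖ ^ 2) (by positivity), ENNReal.ofReal_ofNat]
        gcongr
        · exact lintegral_line_le_nTwoSq d Φ hs hsd
        · exact lintegral_inv_cosh_le

theorem norm_stripResolvent_ofReal_sq_le (h : IsCoercive m p α β)
    (hd : d ∈ Ioo 0 (Real.pi / 2)) (hC : ∀ τ : ℝ, ‖Φ τ‖ ≤ C₀ / √(1 + τ ^ 2)) (x : ℝ) :
    ‖stripResolvent b m p α Φ q x‖ ^ 2 ≤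
      resolventConst β d ^ 2 * (C₀ + ‖q‖) ^ 2 * (Real.cosh x)⁻¹ := by
  have hx := Real.cosh_pos x
  have hconst := h.resolventConst_pos hd
  have hres : ‖resolvent b m p (α + Complex.I * Real.sinh x) (Φ (Real.sinh x)) q‖ ≤
      resolventConst β d * ((C₀ + ‖q‖) / Real.cosh x) := by
    have hres := h.norm_resolvent_le (b := b) hd (Φ (Real.sinh x)) q x (s := 0)
      (by rw [abs_zero]; exact hd.1.le)
    rw [Complex.ofReal_zero, zero_mul, add_zero, ← Complex.ofReal_sinh] at hres
    refine hres.trans (mul_le_mul_of_nonneg_left ?_ hconst.le)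
    rw [add_div, ← Real.sqrt_sq hx.le, Real.cosh_sq']
    gcongr
    exact hC _
  rw [norm_stripResolvent_sq, ← Complex.ofReal_cosh, ← Complex.ofReal_sinh, Complex.norm_real,
    Real.norm_of_nonneg hx.le]
  calc _ ≤ Real.cosh x * (resolventConst β d * ((C₀ + ‖q‖) / Real.cosh x)) ^ 2 := by gcongr
    _ = _ := by field_simp

theorem norm_stripResolvent_ofReal_le (h : IsCoercive m p α β) (hd : d ∈ Ioo 0 (Real.pi / 2))
    (hC₀ : 0 ≤ C₀) (hC : ∀ τ : ℝ, ‖Φ τ‖ ≤ C₀ / √(1 + τ ^ 2)) (x : ℝ) :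
    ‖stripResolvent b m p α Φ q x‖ ≤
      √2 * resolventConst β d * (C₀ + ‖q‖) * Real.exp (-(|x| / 2)) := by
  have hconst := h.resolventConst_pos hd
  refine (le_abs_self _).trans (abs_le_of_sq_le_sq ?_ (by positivity))
  have hexp : Real.exp (-(|x| / 2)) ^ 2 = Real.exp (-|x|) := by
    rw [← Real.exp_nat_mul]
    congr 1
    push_cast
    ring
  calc _ ≤ resolventConst β d ^ 2 * (C₀ + ‖q‖) ^ 2 * (Real.cosh x)⁻¹ :=
        norm_stripResolvent_ofReal_sq_le h hd hC x
    _ ≤ resolventConst β d ^ 2 * (C₀ + ‖q‖) ^ 2 * (2 * Real.exp (-|x|)) := by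
        gcongr
        exact inv_cosh_le_two_mul_exp_neg_abs x
    _ = _ := by
        rw [mul_pow, mul_pow, mul_pow, hexp, Real.sq_sqrt zero_le_two]
        ring

theorem nonneg_of_decay (hC : ∀ τ : ℝ, ‖Φ τ‖ ≤ C₀ / √(1 + τ ^ 2)) : 0 ≤ C₀ := by
  simpa using (norm_nonneg _).trans (hC 0)

theorem lintegral_resolvent_eq (W : Submodule ℂ V) [W.HasOrthogonalProjection] :
    ∫⁻ τ : ℝ, ‖resolvent b m p (α + Complex.I * τ) (Φ τ) q -
        W.starProjection (resolvent b m p (α + Complex.I * τ) (Φ τ) q)‖ₑ ^ 2 =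
      ∫⁻ x : ℝ, ‖stripResolvent b m p α Φ q x -
        W.starProjection (stripResolvent b m p α Φ q x)‖ₑ ^ 2 := by
  rw [lintegral_eq_lintegral_cosh_mul_comp_sinh]
  refine lintegral_congr fun x => ?_
  rw [stripResolvent, map_smul, ← smul_sub, enorm_smul, mul_pow, ← enorm_pow,
    Complex.cpow_nat_inv_pow _ two_ne_zero, ← Complex.ofReal_cosh, ← Complex.ofReal_sinh,
    ← ofReal_norm (E := ℂ), Complex.norm_real, Real.norm_of_nonneg (Real.cosh_pos x).le]

theorem lintegral_resolvent_sub_starProjection_le [CompleteSpace V] (h : IsCoercive m p α β)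
    (hd : d ∈ Ioo 0 (Real.pi / 2)) (hΦ : MemNTwo d Φ) (hC : ∀ τ : ℝ, ‖Φ τ‖ ≤ C₀ / √(1 + τ ^ 2))
    {K : ℕ} (hK : 1 ≤ K) (W : Submodule ℂ V) [W.HasOrthogonalProjection]
    (hW : ∀ k : ℤ, |k| ≤ K → resolvent b m p (α + Complex.I * sincPoint d K k)
      (Φ (sincPoint d K k)) q ∈ W) :
    ∫⁻ τ : ℝ, ‖resolvent b m p (α + Complex.I * τ) (Φ τ) q -
        W.starProjection (resolvent b m p (α + Complex.I * τ) (Φ τ) q)‖ₑ ^ 2 ≤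
      ENNReal.ofReal (10 * stripConst d * resolventConst β d ^ 2 *
        (√K * Real.exp (-√(2 * Real.pi * d * K)))) *
          (nTwoSq d Φ + ENNReal.ofReal ((C₀ + ‖q‖) ^ 2)) := by
  have hC₀ := nonneg_of_decay hC
  have hconst := h.resolventConst_pos hd
  have hstrip := stripConst_pos hd.1
  lift nTwoSq d Φ to NNReal using hΦ.2.ne with N hN
  rw [← ENNReal.ofReal_coe_nnreal]
  have hline : ∀ s : ℝ, s ≠ 0 → |s| < d →
      ∫⁻ x : ℝ, ‖stripResolvent b m p α Φ q (x + s * Complex.I)‖ₑ ^ 2 ≤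
        ENNReal.ofReal (√(2 * resolventConst β d ^ 2 * (N + 4 * ‖q‖ ^ 2)) ^ 2) := by
    intro s hs hsd
    refine (lintegral_stripResolvent_line_le h hd hs hsd).trans (le_of_eq ?_)
    rw [← hN, ← ENNReal.ofReal_coe_nnreal, ← ENNReal.ofReal_add N.coe_nonneg (by positivity),
      ← ENNReal.ofReal_mul (by positivity), Real.sq_sqrt (by positivity)]
  have hnodes : ∀ k : ℤ, |k| ≤ K →
      stripResolvent b m p α Φ q ((k * √(2 * Real.pi * d / K) : ℝ) : ℂ) ∈ W := by
    intro k hk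
    rw [stripResolvent, ← Complex.ofReal_sinh]
    exact W.smul_mem _ (hW k hk)
  rw [lintegral_resolvent_eq]
  refine (lintegral_sub_starProjection_le_of_nodes (differentiableOn_stripResolvent h hd hΦ.1)
    hd.1 (Real.sqrt_nonneg _) (by positivity) hline (norm_stripResolvent_ofReal_le h hd hC₀ hC) hK
    W hnodes).trans ?_
  rw [← ENNReal.ofReal_add N.coe_nonneg (by positivity), ← ENNReal.ofReal_mul (by positivity)]
  apply ENNReal.ofReal_le_ofReal
  rw [Real.sq_sqrt (by positivity), mul_pow, mul_pow, Real.sq_sqrt zero_le_two]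
  have hq : ‖q‖ ^ 2 ≤ (C₀ + ‖q‖) ^ 2 := by
    gcongr
    linarith
  set C := resolventConst β d
  calc _ ≤ stripConst d * (√K * Real.exp (-√(2 * Real.pi * d * K)) *
        (2 * C ^ 2 * (5 * N + 4 * (C₀ + ‖q‖) ^ 2) + 2 * C ^ 2 * (C₀ + ‖q‖) ^ 2)) := by
        gcongr
        linarith [N.coe_nonneg]
    _ = _ := by ring

theorem lintegral_resolvent_sub_starProjection_le_const (h : IsCoercive m p α β)
    (hd : d ∈ Ioo 0 (Real.pi / 2)) (hC : ∀ τ : ℝ, ‖Φ τ‖ ≤ C₀ / √(1 + τ ^ 2))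
    (W : Submodule ℂ V) [W.HasOrthogonalProjection] :
    ∫⁻ τ : ℝ, ‖resolvent b m p (α + Complex.I * τ) (Φ τ) q -
        W.starProjection (resolvent b m p (α + Complex.I * τ) (Φ τ) q)‖ₑ ^ 2 ≤
      ENNReal.ofReal (4 * resolventConst β d ^ 2 * (C₀ + ‖q‖) ^ 2) := by
  rw [lintegral_resolvent_eq]
  calc _ ≤ ∫⁻ x : ℝ, ENNReal.ofReal (resolventConst β d ^ 2 * (C₀ + ‖q‖) ^ 2) *
        ENNReal.ofReal ((Real.cosh x)⁻¹) := by
        refine lintegral_mono fun x => ?_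
        rw [enorm_sq_eq_ofReal, ← ENNReal.ofReal_mul (by positivity)]
        apply ENNReal.ofReal_le_ofReal
        refine le_trans ?_ (norm_stripResolvent_ofReal_sq_le (b := b) (q := q) h hd hC x)
        gcongr
        exact norm_sub_starProjection_le_self W _
    _ ≤ ENNReal.ofReal (resolventConst β d ^ 2 * (C₀ + ‖q‖) ^ 2) * ENNReal.ofReal 4 := by
        rw [lintegral_const_mul' _ _ ENNReal.ofReal_ne_top, ENNReal.ofReal_ofNat]
        gcongr
        exact lintegral_inv_cosh_le
    _ = _ := by
        rw [← ENNReal.ofReal_mul (by positivity)]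
        ring_nf

end LineIntegrals

section LaplaceTransform

variable {X : Type} [NormedAddCommGroup X] [NormedSpace ℂ X] {f : ℝ → X} {s : ℂ}

/-- The Laplace integral of `f` at `s` converges absolutely. -/
def LaplaceIntegrable (f : ℝ → X) (s : ℂ) : Prop :=
  IntegrableOn (fun t : ℝ => Complex.exp (-s * t) • f t) (Ioi 0)

theorem norm_exp_neg_mul (s : ℂ) (t : ℝ) :
    ‖Complex.exp (-s * t)‖ = Real.exp (-s.re * t) := by
  simp [Complex.norm_exp]

theorem integral_exp_neg_mul_Ioi (hs : 0 < s.re) :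
    ∫ t : ℝ in Ioi 0, Complex.exp (-s * t) = s⁻¹ := by
  rw [integral_exp_mul_complex_Ioi (by simpa using hs)]
  simp [neg_div_neg_eq]

theorem norm_exp_neg_mul_smul_le {s' : ℂ} (hs : s.re ≤ s'.re) {t : ℝ} (ht : 0 ≤ t) (x : X) :
    ‖Complex.exp (-s' * t) • x‖ ≤ ‖Complex.exp (-s * t) • x‖ := by
  rw [norm_smul, norm_smul, norm_exp_neg_mul, norm_exp_neg_mul]
  gcongr

theorem LaplaceIntegrable.mono {s' : ℂ} (hf : LaplaceIntegrable f s) (hs : s.re ≤ s'.re) :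
    LaplaceIntegrable f s' := by
  have hmeas : AEStronglyMeasurable (fun t : ℝ => Complex.exp (-s' * t) • f t)
      (volume.restrict (Ioi 0)) := by
    have hmul := (Continuous.aestronglyMeasurable
      (f := fun t : ℝ => Complex.exp (-(s' - s) * t)) (by fun_prop)).smul
        hf.aestronglyMeasurable
    refine hmul.congr (Eventually.of_forall fun t => ?_)
    simp only [Pi.smul_apply', smul_smul, ← Complex.exp_add]
    ring_nf
  refine Integrable.mono hf hmeas ?_
  filter_upwards [ae_restrict_mem measurableSet_Ioi] with t ht
  exact norm_exp_neg_mul_smul_le hs (le_of_lt ht) (f t)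

theorem LaplaceIntegrable.of_norm_le {A η : ℝ} (hs : η < s.re)
    (hm : AEStronglyMeasurable f (volume.restrict (Ioi (0 : ℝ))))
    (hf : ∀ t : ℝ, 0 < t → ‖f t‖ ≤ A * Real.exp (η * t)) : LaplaceIntegrable f s := by
  have hexp := (integrableOn_exp_mul_Ioi (a := -(s.re - η)) (by linarith) 0).const_mul A
  refine Integrable.mono' hexp
    (AEStronglyMeasurable.smul (Continuous.aestronglyMeasurable (by fun_prop)) hm) ?_
  filter_upwards [ae_restrict_mem measurableSet_Ioi] with t ht
  rw [norm_smul, norm_exp_neg_mul]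
  calc _ ≤ Real.exp (-s.re * t) * (A * Real.exp (η * t)) := by gcongr; exact hf t ht
    _ = A * Real.exp (-(s.re - η) * t) := by
      rw [mul_left_comm, ← Real.exp_add]; ring_nf

theorem LaplaceIntegrable.of_memLp (hf : MemLp f 2 (volume.restrict (Ioi (0 : ℝ))))
    (hs : 0 < s.re) : LaplaceIntegrable f s := by
  have hexp : MemLp (fun t : ℝ => Complex.exp (-s * t)) 2 (volume.restrict (Ioi (0 : ℝ))) := by
    rw [memLp_two_iff_integrable_sq_norm (Continuous.aestronglyMeasurable (by fun_prop))]
    refine (integrableOn_exp_mul_Ioi (a := -2 * s.re) (by linarith) 0).congr_fun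
      (fun t _ => ?_) measurableSet_Ioi
    simp only [norm_exp_neg_mul, ← Real.exp_nat_mul]
    congr 1
    push_cast
    ring
  exact memLp_one_iff_integrable.1 (hf.smul hexp)

theorem LaplaceIntegrable.add {g : ℝ → X} (hf : LaplaceIntegrable f s)
    (hg : LaplaceIntegrable g s) : LaplaceIntegrable (fun t => f t + g t) s :=
  (Integrable.add hf hg).congr (Eventually.of_forall fun _ => (smul_add _ _ _).symm)

theorem laplace_add {g : ℝ → X} (hf : LaplaceIntegrable f s) (hg : LaplaceIntegrable g s) :
    laplace (fun t => f t + g t) s = laplace f s + laplace g s := by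
  simp only [laplace, smul_add]
  exact integral_add hf hg

theorem laplaceIntegrable_const (hs : 0 < s.re) (x : X) : LaplaceIntegrable (fun _ => x) s :=
  (integrableOn_exp_mul_complex_Ioi (by simpa using hs) 0).smul_const x

theorem laplace_congr {g : ℝ → X} (h : ∀ᵐ t ∂(volume.restrict (Ioi (0 : ℝ))), f t = g t) :
    laplace f s = laplace g s :=
  integral_congr_ae (h.mono fun t ht => congrArg (Complex.exp (-s * t) • ·) ht)

theorem LaplaceIntegrable.congr {g : ℝ → X} (hf : LaplaceIntegrable f s)
    (h : ∀ᵐ t ∂(volume.restrict (Ioi (0 : ℝ))), f t = g t) : LaplaceIntegrable g s :=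
  Integrable.congr hf (h.mono fun t ht => congrArg (Complex.exp (-s * t) • ·) ht)

theorem LaplaceIntegrable.clm_comp {Y : Type} [NormedAddCommGroup Y] [NormedSpace ℂ Y]
    (T : X →L[ℂ] Y) (hf : LaplaceIntegrable f s) : LaplaceIntegrable (fun t => T (f t)) s :=
  (T.integrable_comp hf).congr (Eventually.of_forall fun _ => map_smul T _ _)

theorem continuousOn_laplace (hf : LaplaceIntegrable f s) :
    ContinuousOn (laplace f) {z | s.re ≤ z.re} := by
  refine continuousOn_of_dominated
    (F := fun z t => Complex.exp (-z * (t : ℝ)) • f t)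
    (bound := fun t => ‖Complex.exp (-s * t) • f t‖)
    (fun z hz => (hf.mono hz).aestronglyMeasurable) (fun z hz => ?_) hf.norm
    (Eventually.of_forall fun t => by fun_prop)
  filter_upwards [ae_restrict_mem measurableSet_Ioi] with t ht
  exact norm_exp_neg_mul_smul_le hz (le_of_lt ht) (f t)

theorem continuous_laplace_line {α : ℝ} (hf : LaplaceIntegrable f α) :
    Continuous fun τ : ℝ => laplace f (α + Complex.I * τ) :=
  (continuousOn_laplace hf).comp_continuous (by fun_prop) fun τ => by simp

/-- The pairing under which `e^{-st} ∫₀ᵗ f` is the convolution of `e^{-st} f` with `e^{-st}`. -/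
def smulPairing (X : Type) [NormedAddCommGroup X] [NormedSpace ℂ X] : X →L[ℝ] ℂ →L[ℝ] X :=
  (ContinuousLinearMap.lsmul ℝ ℂ : ℂ →L[ℝ] X →L[ℝ] X).flip

theorem integral_smulPairing_exp (f : ℝ → X) (s : ℂ) (x : ℝ) :
    ∫ t in (0 : ℝ)..x, smulPairing X (Complex.exp (-s * t) • f t)
      (Complex.exp (-s * (x - t : ℝ))) = Complex.exp (-s * x) • ∫ t in (0 : ℝ)..x, f t := by
  rw [← intervalIntegral.integral_smul]
  refine intervalIntegral.integral_congr fun t _ => ?_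
  simp only [smulPairing, ContinuousLinearMap.flip_apply, ContinuousLinearMap.lsmul_apply]
  rw [smul_smul, ← Complex.exp_add]
  congr 2
  push_cast
  ring

theorem LaplaceIntegrable.primitive (hs : 0 < s.re) (hf : LaplaceIntegrable f s) :
    LaplaceIntegrable (fun t => ∫ r in (0 : ℝ)..t, f r) s := by
  have hconv := integrable_posConvolution hf
    (integrableOn_exp_mul_complex_Ioi (a := -s) (by simpa using hs) 0) (smulPairing X)
  unfold posConvolution at hconv
  simp only [integral_smulPairing_exp] at hconv
  rwa [integrable_indicator_iff measurableSet_Ioi] at hconv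

theorem LaplaceIntegrable.of_primitive {f' : ℝ → X} {f₀ : X} (hs : 0 < s.re)
    (hf' : LaplaceIntegrable f' s)
    (hprim : ∀ t : ℝ, 0 ≤ t → f t = f₀ + ∫ r in (0 : ℝ)..t, f' r) : LaplaceIntegrable f s := by
  refine ((laplaceIntegrable_const hs f₀).add (hf'.primitive hs)).congr ?_
  filter_upwards [ae_restrict_mem measurableSet_Ioi] with t ht using (hprim t (le_of_lt ht)).symm

variable [CompleteSpace X]

theorem laplace_clm_comp {Y : Type} [NormedAddCommGroup Y] [NormedSpace ℂ Y] [CompleteSpace Y]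
    (T : X →L[ℂ] Y) (hf : LaplaceIntegrable f s) :
    laplace (fun t => T (f t)) s = T (laplace f s) := by
  simp only [laplace, ← map_smul T]
  exact T.integral_comp_comm hf

theorem laplace_const (hs : 0 < s.re) (x : X) : laplace (fun _ => x) s = s⁻¹ • x := by
  rw [laplace, integral_smul_const, integral_exp_neg_mul_Ioi hs]

theorem laplace_primitive (hs : 0 < s.re) (hf : LaplaceIntegrable f s) :
    laplace (fun t => ∫ r in (0 : ℝ)..t, f r) s = s⁻¹ • laplace f s := by
  have hconv := integral_posConvolution hf
    (integrableOn_exp_mul_complex_Ioi (a := -s) (by simpa using hs) 0) (smulPairing X)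
  simp only [integral_smulPairing_exp] at hconv
  rw [laplace, hconv, integral_exp_neg_mul_Ioi hs]
  rfl

theorem smul_laplace_of_primitive {f' : ℝ → X} {f₀ : X} (hs : 0 < s.re)
    (hf' : LaplaceIntegrable f' s)
    (hprim : ∀ t : ℝ, 0 ≤ t → f t = f₀ + ∫ r in (0 : ℝ)..t, f' r) :
    s • laplace f s = f₀ + laplace f' s := by
  have hs0 : s ≠ 0 := by rintro rfl; simp at hs
  have hsplit : laplace f s = laplace (fun t => f₀ + ∫ r in (0 : ℝ)..t, f' r) s := by
    refine laplace_congr ?_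
    filter_upwards [ae_restrict_mem measurableSet_Ioi] with t ht using hprim t (le_of_lt ht)
  rw [hsplit, laplace_add (laplaceIntegrable_const hs f₀) (hf'.primitive hs), laplace_const hs,
    laplace_primitive hs hf', ← smul_add, smul_inv_smul₀ hs0]

end LaplaceTransform

section BoundaryValues

variable {X : Type} [NormedAddCommGroup X] [NormedSpace ℂ X]

theorem im_sinh_add_mul_I (x y : ℝ) :
    (Complex.sinh (x + y * Complex.I)).im = Real.cosh x * Real.sin y := by
  rw [sinh_add_mul_I]
  simp [-Complex.ofReal_sin, -Complex.ofReal_cos, -Complex.ofReal_sinh, -Complex.ofReal_cosh]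

theorem LaplaceExtends.eq_on_line {α d : ℝ} {f : ℝ → X} {F : ℂ → X}
    (hd : d ∈ Ioo 0 (Real.pi / 2)) (h : LaplaceExtends α d f F) (hf : LaplaceIntegrable f α)
    (τ : ℝ) : F τ = laplace f (α + Complex.I * τ) := by
  obtain ⟨x, rfl⟩ := Real.sinh_surjective τ
  -- approach the real axis from below, along a curve inside `D_d`
  set γ : ℝ → ℂ := fun ε => Complex.sinh (x + (-ε : ℝ) * Complex.I) with hγ
  have hγ₀ : γ 0 = (Real.sinh x : ℝ) := by simp [hγ]
  have hγ_tendsto : Tendsto γ (𝓝[>] 0) (𝓝 (γ 0)) :=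
    (Continuous.tendsto (by fun_prop) 0).mono_left nhdsWithin_le_nhds
  have hmem : ∀ ε : ℝ, |ε| < d → γ ε ∈ dom d := fun ε hε =>
    sinh_mem_dom hd.2.le (by simpa using hε)
  have hd_mem : ∀ᶠ ε in 𝓝[>] (0 : ℝ), γ ε ∈ dom d := by
    filter_upwards [Ioo_mem_nhdsGT hd.1] with ε hε
    exact hmem ε (by rw [abs_of_pos hε.1]; exact hε.2)
  have him : ∀ᶠ ε in 𝓝[>] (0 : ℝ), (γ ε).im < 0 := by
    filter_upwards [Ioo_mem_nhdsGT hd.1] with ε hε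
    rw [hγ]
    simp only [im_sinh_add_mul_I, Real.sin_neg]
    have := mul_pos (Real.cosh_pos x)
      (Real.sin_pos_of_pos_of_lt_pi hε.1 (by linarith [hε.2, hd.2, Real.pi_pos]))
    linarith
  have hF : Tendsto (fun ε => F (γ ε)) (𝓝[>] 0) (𝓝 (F (γ 0))) :=
    (h.mem.1.continuousOn (γ 0) (hmem 0 (by simpa using hd.1))).tendsto.comp
      (tendsto_nhdsWithin_iff.2 ⟨hγ_tendsto, hd_mem⟩)
  have hL : Tendsto (fun ε => laplace f (α + Complex.I * γ ε)) (𝓝[>] 0)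
      (𝓝 (laplace f (α + Complex.I * γ 0))) := by
    have hz₀ : (α + Complex.I * γ 0 : ℂ) ∈ {z : ℂ | (α : ℂ).re ≤ z.re} := by
      rw [hγ₀]
      simp [-Complex.ofReal_sinh]
    refine ((continuousOn_laplace hf) _ hz₀).tendsto.comp
      (tendsto_nhdsWithin_iff.2 ⟨(hγ_tendsto.const_mul _).const_add _, ?_⟩)
    filter_upwards [him] with ε hε
    simpa using hε.le
  rw [← hγ₀]
  refine tendsto_nhds_unique hF (hL.congr' ?_)
  filter_upwards [hd_mem, him] with ε hε hε' using (h.eq_laplace _ hε hε').symm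

end BoundaryValues

section HardySpace

/-- The Poisson kernel of the half-plane at distance `b` from the boundary, in the frequency
variable `ξ`: it is the Fourier transform of `e^{-b|t|}`. -/
def poissonKernel (b ξ : ℝ) : ℝ := 2 * b / (b ^ 2 + (2 * Real.pi * ξ) ^ 2)

variable {b : ℝ} (hb : 0 < b)
include hb

theorem poissonKernel_nonneg (ξ : ℝ) : 0 ≤ poissonKernel b ξ := by
  unfold poissonKernel
  positivity

theorem continuous_poissonKernel : Continuous (poissonKernel b) := by
  unfold poissonKernel
  refine Continuous.div (by fun_prop) (by fun_prop) fun ξ => ?_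
  positivity

theorem integrable_poissonKernel : Integrable (poissonKernel b) := by
  have := Real.pi_pos
  have hinv := (integrable_inv_one_add_sq.comp_mul_left' (R := 2 * Real.pi / b)
    (by positivity)).const_mul (2 / b)
  refine hinv.congr (Eventually.of_forall fun ξ => ?_)
  simp only [poissonKernel]
  field_simp

theorem inv_sub_add_inv_add_eq_poissonKernel (ξ : ℝ) :
    ((b : ℂ) - (2 * Real.pi * ξ : ℝ) * Complex.I)⁻¹ + (b + (2 * Real.pi * ξ : ℝ) * Complex.I)⁻¹ =
      poissonKernel b ξ := by
  have hne : ∀ σ : ℝ, (b : ℂ) + σ * Complex.I ≠ 0 := fun σ h => hb.ne' (by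
    simpa using congrArg Complex.re h)
  have hne' := hne (-(2 * Real.pi * ξ))
  rw [Complex.ofReal_neg, neg_mul, ← sub_eq_add_neg] at hne'
  rw [inv_add_inv hne' (hne _), poissonKernel]
  push_cast
  congr 1
  · ring
  · linear_combination (-(2 * Real.pi * ξ : ℂ) ^ 2) * Complex.I_sq

theorem integrable_exp_neg_abs : Integrable fun t : ℝ => (Real.exp (-(b * |t|)) : ℂ) := by
  have hneg : IntegrableOn (fun t : ℝ => Real.exp (-(b * |t|))) (Iic 0) := by
    refine (integrableOn_exp_mul_Iic hb 0).congr_fun (fun t ht => ?_) measurableSet_Iic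
    simp only [abs_of_nonpos (mem_Iic.1 ht)]
    ring_nf
  have hpos : IntegrableOn (fun t : ℝ => Real.exp (-(b * |t|))) (Ioi 0) := by
    refine (integrableOn_exp_mul_Ioi (a := -b) (by linarith) 0).congr_fun (fun t ht => ?_)
      measurableSet_Ioi
    simp only [abs_of_pos (mem_Ioi.1 ht)]
    ring_nf
  have hunion := hneg.union hpos
  rw [Iic_union_Ioi, integrableOn_univ] at hunion
  exact hunion.ofReal

theorem integral_Iic_exp_mul_exp_neg_abs (σ : ℝ) :
    ∫ t : ℝ in Iic 0, Complex.exp ((-(σ * t) : ℝ) * Complex.I) * (Real.exp (-(b * |t|)) : ℂ) =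
      ((b : ℂ) - σ * Complex.I)⁻¹ := by
  have hexp := integral_exp_mul_complex_Iic (a := b - σ * Complex.I) (by simpa using hb) 0
  rw [Complex.ofReal_zero, mul_zero, Complex.exp_zero, one_div] at hexp
  rw [← hexp]
  refine setIntegral_congr_fun measurableSet_Iic fun t ht => ?_
  simp only [abs_of_nonpos (mem_Iic.1 ht), Complex.ofReal_exp, ← Complex.exp_add]
  congr 1
  push_cast
  ring

theorem integral_Ioi_exp_mul_exp_neg_abs (σ : ℝ) :
    ∫ t : ℝ in Ioi 0, Complex.exp ((-(σ * t) : ℝ) * Complex.I) * (Real.exp (-(b * |t|)) : ℂ) =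
      ((b : ℂ) + σ * Complex.I)⁻¹ := by
  rw [← integral_exp_neg_mul_Ioi (show 0 < (b + σ * Complex.I : ℂ).re by simpa using hb)]
  refine setIntegral_congr_fun measurableSet_Ioi fun t ht => ?_
  simp only [abs_of_pos (mem_Ioi.1 ht), Complex.ofReal_exp, ← Complex.exp_add]
  congr 1
  push_cast
  ring

theorem fourier_exp_neg_abs (ξ : ℝ) :
    FourierTransform.fourier (fun t : ℝ => (Real.exp (-(b * |t|)) : ℂ)) ξ = poissonKernel b ξ := by
  have hphase : ∀ t : ℝ, -2 * Real.pi * t * ξ = -(2 * Real.pi * ξ * t) := fun t => by ring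
  simp only [Real.fourier_real_eq_integral_exp_smul, hphase, smul_eq_mul]
  have hint : Integrable fun t : ℝ =>
      Complex.exp ((-(2 * Real.pi * ξ * t) : ℝ) * Complex.I) * (Real.exp (-(b * |t|)) : ℂ) :=
    (integrable_exp_neg_abs hb).bdd_mul (c := 1)
      (Continuous.aestronglyMeasurable (by fun_prop))
      (Eventually.of_forall fun t => (Complex.norm_exp_ofReal_mul_I _).le)
  rw [← intervalIntegral.integral_Iic_add_Ioi (b := 0) hint.integrableOn hint.integrableOn,
    integral_Iic_exp_mul_exp_neg_abs hb, integral_Ioi_exp_mul_exp_neg_abs hb,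
    inv_sub_add_inv_add_eq_poissonKernel hb]

theorem integral_poissonKernel_mul_exp (t : ℝ) :
    ∫ ξ : ℝ, (poissonKernel b ξ : ℂ) * Complex.exp ((2 * Real.pi * ξ * t : ℝ) * Complex.I) =
      (Real.exp (-(b * |t|)) : ℂ) := by
  have hF : FourierTransform.fourier (fun t : ℝ => (Real.exp (-(b * |t|)) : ℂ)) =
      fun ξ => (poissonKernel b ξ : ℂ) := funext (fourier_exp_neg_abs hb)
  have hinv := congrFun (Continuous.fourierInv_fourier_eq
    (f := fun t : ℝ => (Real.exp (-(b * |t|)) : ℂ)) (by fun_prop) (integrable_exp_neg_abs hb)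
    (by rw [hF]; exact (integrable_poissonKernel hb).ofReal)) t
  rw [hF, Real.fourierInv_eq'] at hinv
  rw [← hinv]
  refine integral_congr_ae (Eventually.of_forall fun ξ => ?_)
  simp only [smul_eq_mul, RCLike.inner_apply, conj_trivial]
  rw [mul_comm]
  ring_nf

theorem lintegral_poissonKernel : ∫⁻ ξ : ℝ, ENNReal.ofReal (poissonKernel b ξ) = 1 := by
  have hint : ∫ ξ : ℝ, poissonKernel b ξ = 1 := by
    have hzero := integral_poissonKernel_mul_exp hb 0
    simp only [mul_zero, Complex.ofReal_zero, zero_mul, Complex.exp_zero, mul_one, abs_zero,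
      neg_zero, Real.exp_zero, Complex.ofReal_one] at hzero
    rw [integral_complex_ofReal] at hzero
    exact_mod_cast hzero
  rw [← ofReal_integral_eq_lintegral_ofReal (integrable_poissonKernel hb)
    (Eventually.of_forall (poissonKernel_nonneg hb)), hint, ENNReal.ofReal_one]

variable {X : Type} [NormedAddCommGroup X] [NormedSpace ℂ X] {f : ℝ → X}

theorem integrable_poissonKernel_mul_exp_smul {s : ℂ} (hf : LaplaceIntegrable f s) :
    Integrable (Function.uncurry fun (ξ t : ℝ) =>
      ((poissonKernel b ξ : ℂ) * Complex.exp ((2 * Real.pi * ξ * t : ℝ) * Complex.I)) •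
        (Complex.exp (-s * t) • f t))
      (volume.prod (volume.restrict (Ioi 0))) := by
  have hkernel : Integrable (fun z : ℝ × ℝ => (poissonKernel b z.1 : ℂ) •
      (Complex.exp (-s * z.2) • f z.2)) (volume.prod (volume.restrict (Ioi 0))) :=
    Integrable.smul_prod (integrable_poissonKernel hb).ofReal hf
  have hphase := Integrable.bdd_smul (φ := fun z : ℝ × ℝ =>
      Complex.exp ((2 * Real.pi * z.1 * z.2 : ℝ) * Complex.I)) hkernel 1
    (Continuous.aestronglyMeasurable (by fun_prop))
    (Eventually.of_forall fun z => (Complex.norm_exp_ofReal_mul_I _).le)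
  refine hphase.congr (Eventually.of_forall fun z => ?_)
  simp only [Function.uncurry, Pi.smul_apply', smul_smul]
  ring_nf

variable [CompleteSpace X] {α : ℝ} (hf : LaplaceIntegrable f α)
include hf

theorem laplace_eq_integral_poissonKernel (τ : ℝ) :
    laplace f ((α + b : ℝ) + Complex.I * τ) =
      ∫ ξ : ℝ, (poissonKernel b ξ : ℂ) •
        laplace f (α + Complex.I * (τ - 2 * Real.pi * ξ : ℝ)) := by
  have hshift : ∀ ξ : ℝ, (poissonKernel b ξ : ℂ) •
      laplace f (α + Complex.I * (τ - 2 * Real.pi * ξ : ℝ)) =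
        ∫ t in Ioi (0 : ℝ), ((poissonKernel b ξ : ℂ) *
          Complex.exp ((2 * Real.pi * ξ * t : ℝ) * Complex.I)) •
            (Complex.exp (-(α + Complex.I * τ) * t) • f t) := by
    intro ξ
    rw [laplace, ← integral_smul]
    refine integral_congr_ae (Eventually.of_forall fun t => ?_)
    simp only
    rw [smul_smul, smul_smul, mul_assoc (poissonKernel b ξ : ℂ), ← Complex.exp_add]
    congr 3
    push_cast
    ring
  simp only [hshift]
  rw [integral_integral_swap (integrable_poissonKernel_mul_exp_smul hb (hf.mono (by simp))),
    laplace]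
  refine setIntegral_congr_fun measurableSet_Ioi fun t ht => ?_
  rw [integral_smul_const, integral_poissonKernel_mul_exp hb, abs_of_pos ht, smul_smul,
    Complex.ofReal_exp, ← Complex.exp_add]
  congr 2
  push_cast
  ring

theorem enorm_laplace_sq_le_lintegral_poissonKernel (τ : ℝ) :
    ‖laplace f ((α + b : ℝ) + Complex.I * τ)‖ₑ ^ 2 ≤
      ∫⁻ ξ : ℝ, ENNReal.ofReal (poissonKernel b ξ) *
        ‖laplace f (α + Complex.I * (τ - 2 * Real.pi * ξ : ℝ))‖ₑ ^ 2 := by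
  have hline := continuous_laplace_line hf
  set ρ : ℝ → ℝ := fun ξ => √(poissonKernel b ξ)
  have hρ_cont : Continuous ρ := (continuous_poissonKernel hb).sqrt
  have hρ_sq : ∀ ξ, ρ ξ ^ 2 = poissonKernel b ξ := fun ξ =>
    Real.sq_sqrt (poissonKernel_nonneg hb ξ)
  have hρ_enorm : ∀ ξ, ‖(ρ ξ : ℂ)‖ₑ ^ 2 = ENNReal.ofReal (poissonKernel b ξ) := fun ξ => by
    rw [enorm_sq_eq_ofReal, Complex.norm_real, Real.norm_eq_abs, sq_abs, hρ_sq]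
  have hsplit : ∀ ξ : ℝ, (poissonKernel b ξ : ℂ) •
      laplace f (α + Complex.I * (τ - 2 * Real.pi * ξ : ℝ)) =
        (ρ ξ : ℂ) • ((ρ ξ : ℂ) • laplace f (α + Complex.I * (τ - 2 * Real.pi * ξ : ℝ))) := by
    intro ξ
    rw [smul_smul, ← Complex.ofReal_mul, ← sq, hρ_sq]
  rw [laplace_eq_integral_poissonKernel hb hf]
  simp only [hsplit]
  have hshift : Continuous fun ξ : ℝ => laplace f (α + Complex.I * (τ - 2 * Real.pi * ξ : ℝ)) :=
    hline.comp (f := fun ξ : ℝ => τ - 2 * Real.pi * ξ) (by fun_prop)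
  refine (enorm_integral_smul_sq_le (Continuous.aestronglyMeasurable (by fun_prop))
    (Continuous.aestronglyMeasurable (by fun_prop))).trans (le_of_eq ?_)
  simp only [enorm_smul, mul_pow, hρ_enorm]
  rw [lintegral_poissonKernel hb, one_mul]

theorem lintegral_laplace_line_add_le :
    ∫⁻ τ : ℝ, ‖laplace f ((α + b : ℝ) + Complex.I * τ)‖ₑ ^ 2 ≤
      ∫⁻ τ : ℝ, ‖laplace f (α + Complex.I * τ)‖ₑ ^ 2 := by
  have hmeas : Measurable (poissonKernel b) := (continuous_poissonKernel hb).measurable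
  have hline : Measurable fun τ : ℝ => ‖laplace f (α + Complex.I * τ)‖ₑ ^ 2 :=
    (continuous_laplace_line hf).enorm.measurable.pow_const 2
  calc ∫⁻ τ : ℝ, ‖laplace f ((α + b : ℝ) + Complex.I * τ)‖ₑ ^ 2
      ≤ ∫⁻ τ : ℝ, ∫⁻ ξ : ℝ, ENNReal.ofReal (poissonKernel b ξ) *
          ‖laplace f (α + Complex.I * (τ - 2 * Real.pi * ξ : ℝ))‖ₑ ^ 2 :=
        lintegral_mono (enorm_laplace_sq_le_lintegral_poissonKernel hb hf)
    _ = ∫⁻ ξ : ℝ, ∫⁻ τ : ℝ, ENNReal.ofReal (poissonKernel b ξ) *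
          ‖laplace f (α + Complex.I * (τ - 2 * Real.pi * ξ : ℝ))‖ₑ ^ 2 := by
      refine lintegral_lintegral_swap (Measurable.aemeasurable ?_)
      exact (hmeas.comp measurable_snd).ennreal_ofReal.mul
        (hline.comp (measurable_fst.sub (measurable_snd.const_mul (2 * Real.pi))))
    _ = ∫⁻ ξ : ℝ, ENNReal.ofReal (poissonKernel b ξ) *
          ∫⁻ τ : ℝ, ‖laplace f (α + Complex.I * τ)‖ₑ ^ 2 := by
      refine lintegral_congr fun ξ => ?_
      rw [lintegral_const_mul' _ _ ENNReal.ofReal_ne_top,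
        lintegral_sub_right_eq_self (fun τ : ℝ => ‖laplace f (α + Complex.I * τ)‖ₑ ^ 2)
          (2 * Real.pi * ξ)]
    _ = ∫⁻ τ : ℝ, ‖laplace f (α + Complex.I * τ)‖ₑ ^ 2 := by
      rw [lintegral_mul_const _ hmeas.ennreal_ofReal, lintegral_poissonKernel hb, one_mul]

omit hb in
theorem hardySq_laplace_le :
    hardySq α (laplace f) ≤ ∫⁻ τ : ℝ, ‖laplace f (α + Complex.I * τ)‖ₑ ^ 2 := by
  refine iSup₂_le fun σ hσ => ?_
  have hline := lintegral_laplace_line_add_le (sub_pos.2 hσ) hf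
  rw [add_sub_cancel] at hline
  refine le_trans (ENNReal.div_le_of_le_mul (le_mul_of_one_le_right' ?_)) hline
  rw [← ENNReal.ofReal_one]
  exact ENNReal.ofReal_le_ofReal (by linarith [Real.pi_gt_three])

end HardySpace

section Evolution

theorem intervalIntegrable_of_memLp_two {X : Type}
    [NormedAddCommGroup X] {f : ℝ → X} {T : ℝ} (hT : 0 ≤ T)
    (hf : MemLp f 2 (volume.restrict (Ioc 0 T))) : IntervalIntegrable f volume 0 T := by
  rw [intervalIntegrable_iff_integrableOn_Ioc_of_le hT]
  exact hf.integrable one_le_two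

section Primitive

variable {X : Type} [NormedAddCommGroup X] [NormedSpace ℝ X] {f f' g : ℝ → X} {f₀ : X}

theorem continuousOn_of_primitive
    (hint : ∀ T : ℝ, 0 ≤ T → IntervalIntegrable f' volume 0 T)
    (hprim : ∀ t : ℝ, 0 ≤ t → f t = f₀ + ∫ r in (0 : ℝ)..t, f' r) :
    ContinuousOn f (Ici 0) := by
  intro t ht
  have ht₀ : (0 : ℝ) ≤ t := ht
  have hcont : ContinuousOn f (Icc 0 (t + 1)) := by
    have hle : 0 ≤ t + 1 := by linarith
    have hcont := intervalIntegral.continuousOn_primitive_interval (a := 0) (b := t + 1)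
      (f := f') (μ := volume) (by
        rw [uIcc_of_le hle, ← intervalIntegrable_iff_integrableOn_Icc_of_le hle]
        exact hint _ hle)
    rw [uIcc_of_le hle] at hcont
    exact (continuousOn_const.add hcont).congr fun x hx => hprim x hx.1
  refine (hcont t ⟨ht₀, by linarith⟩).mono_of_mem_nhdsWithin ?_
  rw [← Ici_inter_Iic]
  exact inter_mem_nhdsWithin _ (Iic_mem_nhds (by linarith))

theorem hasDerivWithinAt_of_primitive [CompleteSpace X] (hg : ContinuousOn g (Ici 0))
    (hfg : ∀ᵐ t ∂(volume.restrict (Ioi (0 : ℝ))), f' t = g t)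
    (hprim : ∀ t : ℝ, 0 ≤ t → f t = f₀ + ∫ r in (0 : ℝ)..t, f' r) {t : ℝ} (ht : 0 ≤ t) :
    HasDerivWithinAt f (g t) (Ici t) t := by
  have heq : ∀ x : ℝ, 0 ≤ x → f x = f₀ + ∫ r in (0 : ℝ)..x, g r := by
    intro x hx
    rw [hprim x hx, intervalIntegral.integral_of_le hx, intervalIntegral.integral_of_le hx]
    exact congrArg _ (integral_congr_ae
      (ae_restrict_of_ae_restrict_of_subset Ioc_subset_Ioi_self hfg))
  have hIci : Ici t ⊆ Ici 0 := Ici_subset_Ici.2 ht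
  have hderiv := intervalIntegral.integral_hasDerivWithinAt_right (a := 0) (b := t) (f := g)
    (s := Ici t) (t := Ioi t)
    (hg.mono (by rw [uIcc_of_le ht]; exact Icc_subset_Ici_self)).intervalIntegrable
    ((hg.mono (Ioi_subset_Ici_self.trans hIci)).stronglyMeasurableAtFilter_nhdsWithin
      measurableSet_Ioi t)
    ((hg t ht).mono (Ioi_subset_Ici_self.trans hIci))
  exact (hderiv.const_add f₀).congr (fun x hx => heq x (hIci hx)) (heq t ht)

theorem norm_le_mul_exp_of_hasDerivWithinAt {l η A : ℝ} (hl : 0 < l + η)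
    (hfc : ContinuousOn f (Ici 0))
    (hf : ∀ t : ℝ, 0 ≤ t → HasDerivWithinAt f (g t - l • f t) (Ici t) t)
    (hg : ∀ t : ℝ, 0 ≤ t → ‖g t‖ ≤ A * Real.exp (η * t)) {t : ℝ} (ht : 0 ≤ t) :
    ‖f t‖ ≤ (‖f 0‖ + A / (l + η)) * Real.exp (η * t) := by
  have hA : 0 ≤ A := by simpa using (norm_nonneg _).trans (hg 0 le_rfl)
  set M := ‖f 0‖ + A / (l + η) with hM
  have hexp : ∀ (a x : ℝ), HasDerivAt (fun x : ℝ => Real.exp (a * x)) (Real.exp (a * x) * a) x :=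
    fun a x => by simpa using ((hasDerivAt_id x).const_mul a).exp
  -- with the integrating factor `e^{lt}` the derivative is `e^{lt} g`
  have hbound : ‖Real.exp (l * t) • f t‖ ≤ M * Real.exp ((l + η) * t) := by
    refine image_norm_le_of_norm_deriv_right_le_deriv_boundary (a := 0) (b := t)
      (f := fun x => Real.exp (l * x) • f x) (B := fun x => M * Real.exp ((l + η) * x))
      (ContinuousOn.smul (by fun_prop) (hfc.mono Icc_subset_Ici_self))
      (fun x hx => (hexp l x).hasDerivWithinAt.smul (hf x hx.1)) ?_
      (fun x => (hexp (l + η) x).const_mul M) ?_ ⟨ht, le_rfl⟩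
    · have : 0 ≤ A / (l + η) := by positivity
      simpa [hM] using this
    · intro x hx
      have hMA : A ≤ M * (l + η) := by
        rw [hM, add_mul, div_mul_cancel₀ _ hl.ne']
        exact le_add_of_nonneg_left (by positivity)
      have hsimp : Real.exp (l * x) • (g x - l • f x) + (Real.exp (l * x) * l) • f x =
          Real.exp (l * x) • g x := by
        rw [smul_sub, smul_smul, sub_add_cancel]
      rw [hsimp, norm_smul, Real.norm_of_nonneg (Real.exp_pos _).le]
      calc _ ≤ Real.exp (l * x) * (M * (l + η) * Real.exp (η * x)) := by
            gcongr
            exact (hg x hx.1).trans (by gcongr)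
        _ = M * (Real.exp ((l + η) * x) * (l + η)) := by rw [add_mul l, Real.exp_add]; ring
  rw [norm_smul, Real.norm_of_nonneg (Real.exp_pos _).le, add_mul l, Real.exp_add,
    mul_left_comm] at hbound
  exact le_of_mul_le_mul_left hbound (Real.exp_pos _)

end Primitive

theorem exists_norm_le_mul_exp_of_primitive {X : Type} [NormedAddCommGroup X] [NormedSpace ℂ X]
    {f f' : ℝ → X} {f₀ : X} {η : ℝ} (hη : 0 < η)
    (hf' : MemLp f' 2 (volume.restrict (Ioi (0 : ℝ))))
    (hprim : ∀ t : ℝ, 0 ≤ t → f t = f₀ + ∫ r in (0 : ℝ)..t, f' r) :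
    ∃ A : ℝ, ∀ t : ℝ, 0 ≤ t → ‖f t‖ ≤ A * Real.exp (η * t) := by
  have hint : LaplaceIntegrable f' η := LaplaceIntegrable.of_memLp hf' (by simpa using hη)
  set J := ∫ r in Ioi (0 : ℝ), ‖Complex.exp (-(η : ℂ) * r) • f' r‖
  refine ⟨‖f₀‖ + J, fun t ht => ?_⟩
  have hJ_bound : ‖∫ r in (0 : ℝ)..t, f' r‖ ≤ J * Real.exp (η * t) := by
    rw [intervalIntegral.integral_of_le ht]
    calc _ ≤ ∫ r in Ioc 0 t, ‖f' r‖ := norm_integral_le_integral_norm _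
      _ ≤ ∫ r in Ioc 0 t, Real.exp (η * t) * ‖Complex.exp (-(η : ℂ) * r) • f' r‖ := by
        refine integral_mono_of_nonneg (Eventually.of_forall fun r => norm_nonneg _)
          ((IntegrableOn.mono_set hint.norm Ioc_subset_Ioi_self).const_mul _) ?_
        filter_upwards [ae_restrict_mem measurableSet_Ioc] with r hr
        rw [norm_smul, norm_exp_neg_mul, ← mul_assoc, ← Real.exp_add]
        refine le_mul_of_one_le_left (norm_nonneg _) (Real.one_le_exp ?_)
        simp only [Complex.ofReal_re]
        nlinarith [hr.2]
      _ = Real.exp (η * t) * ∫ r in Ioc 0 t, ‖Complex.exp (-(η : ℂ) * r) • f' r‖ :=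
        integral_const_mul _ _
      _ ≤ Real.exp (η * t) * J := by
        gcongr
        exact setIntegral_mono_set hint.norm (Eventually.of_forall fun r => norm_nonneg _)
          Ioc_subset_Ioi_self.eventuallyLE
      _ = _ := mul_comm _ _
  rw [hprim t ht, add_mul]
  exact (norm_add_le _ _).trans (add_le_add
    (le_mul_of_one_le_right (norm_nonneg _) (Real.one_le_exp (by positivity))) hJ_bound)

variable {V : Type} [NormedAddCommGroup V] [InnerProductSpace ℂ V] {ι : Type*} [Fintype ι]

theorem LaplaceIntegrable.of_coordinates (b : OrthonormalBasis ι ℂ V) {u : ℝ → V} {s : ℂ}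
    (h : ∀ j, LaplaceIntegrable (fun t => inner ℂ (b j) (u t)) s) : LaplaceIntegrable u s := by
  refine Integrable.congr (integrable_finsetSum Finset.univ fun j _ => (h j).smul_const (b j))
    (Eventually.of_forall fun t => ?_)
  beta_reduce
  nth_rw 2 [← b.sum_repr' (u t)]
  simp only [Finset.smul_sum, smul_smul, smul_eq_mul]

/-- The evolution equation in diagonal form: in the orthonormal basis `b` of `V` it uncouples into
the scalar equations `m_j u_j' + p_j u_j = f_j`. Here `f'` and `u'` are the time derivatives of the
source `f` and of the solution `u`, whose initial value is `u₀`. -/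
structure IsDiagonalEvolution (b : OrthonormalBasis ι ℂ V) (m p : ι → ℝ)
    (f f' : ℝ → AntiDual V) (u₀ : V) (u u' : ℝ → V) : Prop where
  pos : ∀ j, 0 < m j
  nonneg : ∀ j, 0 ≤ p j
  memLp_source : MemLp f' 2 (volume.restrict (Ioi (0 : ℝ)))
  source : ∀ t : ℝ, 0 ≤ t → f t = f 0 + ∫ r in (0 : ℝ)..t, f' r
  memLp : ∀ T : ℝ, MemLp u' 2 (volume.restrict (Ioc 0 T))
  primitive : ∀ t : ℝ, 0 ≤ t → u t = u₀ + ∫ r in (0 : ℝ)..t, u' r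
  equation : ∀ᵐ t ∂(volume.restrict (Ioi (0 : ℝ))), ∀ j,
    m j * inner ℂ (b j) (u' t) + p j * inner ℂ (b j) (u t) = f t (b j)

namespace IsDiagonalEvolution

variable {b : OrthonormalBasis ι ℂ V} {m p : ι → ℝ} {f f' : ℝ → AntiDual V} {u u' : ℝ → V}
  {u₀ : V} {s : ℂ}

theorem intervalIntegrable (h : IsDiagonalEvolution b m p f f' u₀ u u') {T : ℝ} (hT : 0 ≤ T) :
    IntervalIntegrable u' volume 0 T :=
  intervalIntegrable_of_memLp_two hT (h.memLp T)

theorem continuousOn (h : IsDiagonalEvolution b m p f f' u₀ u u') : ContinuousOn u (Ici 0) :=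
  continuousOn_of_primitive (fun _ => h.intervalIntegrable) h.primitive

theorem continuousOn_coord (h : IsDiagonalEvolution b m p f f' u₀ u u') (j : ι) :
    ContinuousOn (fun t => inner ℂ (b j) (u t)) (Ici 0) :=
  (innerSL ℂ (b j)).continuous.comp_continuousOn h.continuousOn

theorem continuousOn_source (h : IsDiagonalEvolution b m p f f' u₀ u u') :
    ContinuousOn f (Ici 0) :=
  continuousOn_of_primitive (fun _ hT => intervalIntegrable_of_memLp_two hT
    (h.memLp_source.mono_measure (Measure.restrict_mono Ioc_subset_Ioi_self le_rfl))) h.source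

theorem laplaceIntegrable_source (h : IsDiagonalEvolution b m p f f' u₀ u u') (hs : 0 < s.re) :
    LaplaceIntegrable f s :=
  (LaplaceIntegrable.of_memLp h.memLp_source hs).of_primitive hs h.source

variable [FiniteDimensional ℂ V]

theorem hasDerivWithinAt_coord (h : IsDiagonalEvolution b m p f f' u₀ u u') (j : ι) {t : ℝ}
    (ht : 0 ≤ t) :
    HasDerivWithinAt (fun t => inner ℂ (b j) (u t))
      ((m j : ℂ)⁻¹ * f t (b j) - (p j / m j) • inner ℂ (b j) (u t)) (Ici t) t := by
  have hm : (m j : ℂ) ≠ 0 := by exact_mod_cast (h.pos j).ne'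
  refine hasDerivWithinAt_of_primitive (f₀ := inner ℂ (b j) u₀)
    (f' := fun t => inner ℂ (b j) (u' t))
    (g := fun t => (m j : ℂ)⁻¹ * f t (b j) - (p j / m j) • inner ℂ (b j) (u t)) ?_ ?_ ?_ ht
  · exact (continuousOn_const.mul ((AntiDual.evalCLM (b j)).continuous.comp_continuousOn
      h.continuousOn_source)).sub ((h.continuousOn_coord j).fun_const_smul _)
  · filter_upwards [h.equation] with t ht
    rw [← ht j, Complex.real_smul]
    push_cast
    field_simp
    ring
  · intro t ht
    have := FiniteDimensional.complete ℂ V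
    rw [h.primitive t ht, inner_add_right]
    exact congrArg _ ((innerSL ℂ (b j)).intervalIntegral_comp_comm (h.intervalIntegrable ht)).symm

theorem exists_norm_coord_le (h : IsDiagonalEvolution b m p f f' u₀ u u') (j : ι) {η : ℝ}
    (hη : 0 < η) : ∃ B : ℝ, ∀ t : ℝ, 0 ≤ t → ‖inner ℂ (b j) (u t)‖ ≤ B * Real.exp (η * t) := by
  obtain ⟨A, hA⟩ := exists_norm_le_mul_exp_of_primitive hη h.memLp_source h.source
  have hm := h.pos j
  have hp := h.nonneg j
  refine ⟨_, fun t ht => norm_le_mul_exp_of_hasDerivWithinAt (A := (m j)⁻¹ * A)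
    (l := p j / m j) (by positivity) (h.continuousOn_coord j)
    (fun t ht => h.hasDerivWithinAt_coord j ht) (fun t ht => ?_) ht⟩
  rw [norm_mul, norm_inv, Complex.norm_real, Real.norm_of_nonneg hm.le, mul_assoc]
  gcongr
  calc ‖f t (b j)‖ ≤ ‖f t‖ * ‖b j‖ := (f t).le_opNorm (b j)
    _ = ‖f t‖ := by rw [b.norm_eq_one, mul_one]
    _ ≤ A * Real.exp (η * t) := hA t ht

theorem laplaceIntegrable_coord (h : IsDiagonalEvolution b m p f f' u₀ u u') (hs : 0 < s.re)
    (j : ι) : LaplaceIntegrable (fun t => inner ℂ (b j) (u t)) s := by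
  obtain ⟨B, hB⟩ := h.exists_norm_coord_le j (half_pos hs)
  exact LaplaceIntegrable.of_norm_le (half_lt_self hs)
    (((h.continuousOn_coord j).mono Ioi_subset_Ici_self).aestronglyMeasurable
      measurableSet_Ioi) fun t ht => hB t ht.le

theorem laplaceIntegrable (h : IsDiagonalEvolution b m p f f' u₀ u u') (hs : 0 < s.re) :
    LaplaceIntegrable u s :=
  LaplaceIntegrable.of_coordinates b (h.laplaceIntegrable_coord hs)

theorem laplaceIntegrable_deriv (h : IsDiagonalEvolution b m p f f' u₀ u u') (hs : 0 < s.re) :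
    LaplaceIntegrable u' s := by
  refine LaplaceIntegrable.of_coordinates b fun j => ?_
  have hm : (m j : ℂ) ≠ 0 := by exact_mod_cast (h.pos j).ne'
  have hf := (h.laplaceIntegrable_source hs).clm_comp (AntiDual.evalCLM (b j))
  refine Integrable.congr ((hf.sub
    (Integrable.const_mul (h.laplaceIntegrable_coord hs j) (p j : ℂ))).const_mul (m j : ℂ)⁻¹) ?_
  filter_upwards [h.equation] with t ht
  simp only [Pi.sub_apply, smul_eq_mul, AntiDual.evalCLM_apply, ← ht j]
  field_simp
  ring

theorem smul_laplace (h : IsDiagonalEvolution b m p f f' u₀ u u') (hs : 0 < s.re) :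
    s • laplace u s = u₀ + laplace u' s :=
  have := FiniteDimensional.complete ℂ V
  smul_laplace_of_primitive hs (h.laplaceIntegrable_deriv hs) h.primitive

theorem laplace_equation (h : IsDiagonalEvolution b m p f f' u₀ u u') (hs : 0 < s.re) (j : ι) :
    m j * inner ℂ (b j) (laplace u' s) + p j * inner ℂ (b j) (laplace u s) =
      laplace f s (b j) := by
  have := FiniteDimensional.complete ℂ V
  have hu := h.laplaceIntegrable hs
  have hu' := h.laplaceIntegrable_deriv hs
  have hf := laplace_clm_comp (AntiDual.evalCLM (b j)) (h.laplaceIntegrable_source hs)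
  have hu'_smul := hu'.clm_comp ((m j : ℂ) • innerSL ℂ (b j))
  have hu_smul := hu.clm_comp ((p j : ℂ) • innerSL ℂ (b j))
  calc _ = laplace (fun t => ((m j : ℂ) • innerSL ℂ (b j)) (u' t) +
        ((p j : ℂ) • innerSL ℂ (b j)) (u t)) s := by
        rw [laplace_add hu'_smul hu_smul, laplace_clm_comp _ hu', laplace_clm_comp _ hu]
        simp
    _ = laplace (fun t => AntiDual.evalCLM (b j) (f t)) s := by
        refine laplace_congr ?_
        filter_upwards [h.equation] with t ht
        simpa using ht j
    _ = laplace f s (b j) := hf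

theorem laplace_eq_resolvent (h : IsDiagonalEvolution b m p f f' u₀ u u') (hs : 0 < s.re) :
    laplace u s = resolvent b m p s (laplace f s) u₀ := by
  rw [← b.sum_repr' (laplace u s), resolvent]
  refine Finset.sum_congr rfl fun j _ => congrArg (· • b j) ?_
  have hderiv := congrArg (inner ℂ (b j)) (h.smul_laplace hs)
  rw [inner_add_right, inner_smul_right] at hderiv
  rw [eq_div_iff (symbol_ne_zero (h.pos j) (h.nonneg j) hs), ← h.laplace_equation hs j, symbol]
  linear_combination (m j : ℂ) * hderiv

/-- Here `q` is the initial value of `u'`, so that `u'` solves the evolution problem with source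
`f'`. -/
theorem laplace_deriv_eq_resolvent (h : IsDiagonalEvolution b m p f f' u₀ u u') (hs : 0 < s.re)
    {q : V} (hq : ∀ j, f 0 (b j) - p j * inner ℂ (b j) u₀ = m j * inner ℂ (b j) q) :
    laplace u' s = resolvent b m p s (laplace f' s) q := by
  rw [← b.sum_repr' (laplace u' s), resolvent]
  refine Finset.sum_congr rfl fun j _ => congrArg (· • b j) ?_
  have hderiv := congrArg (inner ℂ (b j)) (h.smul_laplace hs)
  rw [inner_add_right, inner_smul_right] at hderiv
  have hsource : s * laplace f s (b j) = f 0 (b j) + laplace f' s (b j) := by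
    simpa using congrArg (fun φ : AntiDual V => φ (b j)) (smul_laplace_of_primitive hs
      (LaplaceIntegrable.of_memLp h.memLp_source hs) h.source)
  rw [eq_div_iff (symbol_ne_zero (h.pos j) (h.nonneg j) hs), ← hq j, symbol]
  linear_combination s * h.laplace_equation hs j - p j * hderiv + hsource

end IsDiagonalEvolution

end Evolution

section Sobolev

variable {n : ℕ} {Ω : Set (RSpace n)} {φ ψ : RSpace n → ℂ}

namespace IsTestFunction

theorem continuous (hφ : IsTestFunction Ω φ) : Continuous φ :=
  hφ.smooth.continuous

theorem differentiable (hφ : IsTestFunction Ω φ) : Differentiable ℝ φ :=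
  hφ.smooth.differentiable (by simp)

theorem star (hφ : IsTestFunction Ω φ) : IsTestFunction Ω fun x => starRingEnd ℂ (φ x) where
  smooth := Complex.conjCLE.contDiff.comp hφ.smooth
  compact := hφ.compact.comp_left (g := starRingEnd ℂ) (map_zero _)
  support := (closure_mono (Function.support_comp_subset (map_zero (starRingEnd ℂ)) φ)).trans
    hφ.support

theorem ofReal {g : RSpace n → ℝ} (hg : ContDiff ℝ ∞ g) (hcompact : HasCompactSupport g)
    (hsupport : tsupport g ⊆ Ω) : IsTestFunction Ω fun x => (g x : ℂ) where
  smooth := Complex.ofRealCLM.contDiff.comp hg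
  compact := hcompact.comp_left (g := ((↑) : ℝ → ℂ)) Complex.ofReal_zero
  support := (closure_mono (Function.support_comp_subset Complex.ofReal_zero g)).trans hsupport

theorem partialDeriv_star (hφ : IsTestFunction Ω φ) (i : Fin n) (x : RSpace n) :
    partialDeriv i (fun x => starRingEnd ℂ (φ x)) x = starRingEnd ℂ (partialDeriv i φ x) :=
  congrArg (fun L : RSpace n →L[ℝ] ℂ => L (EuclideanSpace.single i 1))
    (Complex.conjCLE.toContinuousLinearMap.hasFDerivAt.comp x
      (hφ.differentiable x).hasFDerivAt).fderiv

theorem continuous_partialDeriv (hφ : IsTestFunction Ω φ) (i : Fin n) :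
    Continuous (partialDeriv i φ) :=
  (hφ.smooth.continuous_fderiv (by simp)).clm_apply continuous_const

theorem hasCompactSupport_partialDeriv (hφ : IsTestFunction Ω φ) (i : Fin n) :
    HasCompactSupport (partialDeriv i φ) :=
  hφ.compact.fderiv_apply (𝕜 := ℝ) _

theorem eq_zero_of_notMem (hφ : IsTestFunction Ω φ) {x : RSpace n} (hx : x ∉ Ω) : φ x = 0 :=
  image_eq_zero_of_notMem_tsupport fun h => hx (hφ.support h)

theorem memLp (hφ : IsTestFunction Ω φ) : MemLp φ 2 (volume.restrict Ω) :=
  (hφ.continuous.memLp_of_hasCompactSupport hφ.compact).restrict _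

theorem memLp_partialDeriv (hφ : IsTestFunction Ω φ) (i : Fin n) :
    MemLp (partialDeriv i φ) 2 (volume.restrict Ω) :=
  ((hφ.continuous_partialDeriv i).memLp_of_hasCompactSupport
    (hφ.hasCompactSupport_partialDeriv i)).restrict _

theorem memLp_single (hψ : IsTestFunction Ω ψ) (i : Fin n) :
    MemLp (fun x => (EuclideanSpace.single i (ψ x) : CSpace n)) 2 (volume.restrict Ω) := by
  have hcont : Continuous fun x => (EuclideanSpace.single i (ψ x) : CSpace n) :=
    (PiLp.continuous_toLp 2 _).comp ((continuous_single i).comp hψ.continuous)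
  exact hψ.memLp.of_le hcont.aestronglyMeasurable
    (Eventually.of_forall fun x => (PiLp.norm_single ..).le)

theorem setIntegral_mul_partialDeriv (hφ : IsTestFunction Ω φ) (hψ : IsTestFunction Ω ψ)
    (i : Fin n) :
    ∫ x in Ω, φ x * partialDeriv i ψ x = -∫ x in Ω, partialDeriv i φ x * ψ x := by
  rw [setIntegral_eq_integral_of_forall_compl_eq_zero
      fun x hx => by rw [hφ.eq_zero_of_notMem hx, zero_mul],
    setIntegral_eq_integral_of_forall_compl_eq_zero
      fun x hx => by rw [hψ.eq_zero_of_notMem hx, mul_zero]]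
  refine integral_mul_fderiv_eq_neg_fderiv_mul_of_integrable ?_ ?_ ?_
    (fun x _ => hφ.differentiable x) (fun x _ => hψ.differentiable x)
  · exact ((hφ.continuous_partialDeriv i).mul hψ.continuous).integrable_of_hasCompactSupport
      hψ.compact.mul_left
  · exact (hφ.continuous.mul (hψ.continuous_partialDeriv i)).integrable_of_hasCompactSupport
      hφ.compact.mul_right
  · exact (hφ.continuous.mul hψ.continuous).integrable_of_hasCompactSupport hφ.compact.mul_right

end IsTestFunction

/-- `h` is the weak divergence of `g` on `Ω`, tested against `C_c^∞(Ω)`. -/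
def HasWeakDiv (Ω : Set (RSpace n)) (g : L2 Ω (CSpace n)) (h : L2 Ω ℂ) : Prop :=
  ∀ φ : RSpace n → ℂ, IsTestFunction Ω φ →
    ∫ x in Ω, ∑ i, g x i * partialDeriv i φ x = -∫ x in Ω, h x * φ x

theorem HasWeakDiv.inner_snd_eq_neg_inner_fst {p : L2 Ω ℂ × L2 Ω (CSpace n)} (hp : p ∈ H10 Ω)
    {g : L2 Ω (CSpace n)} {h : L2 Ω ℂ} (hg : HasWeakDiv Ω g h) :
    inner ℂ p.2 g = -inner ℂ p.1 h := by
  have hclosed : IsClosed {p : L2 Ω ℂ × L2 Ω (CSpace n) | inner ℂ p.2 g = -inner ℂ p.1 h} :=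
    isClosed_eq (by fun_prop) (by fun_prop)
  refine closure_minimal ?_ hclosed hp
  rintro p ⟨φ, hφ, hfst, hsnd⟩
  have hgrad : ∫ x in Ω, inner ℂ (p.2 x) (g x) =
      ∫ x in Ω, ∑ i, g x i * partialDeriv i (fun x => starRingEnd ℂ (φ x)) x := by
    refine integral_congr_ae ?_
    filter_upwards [hsnd] with x hx
    simp only [PiLp.inner_apply, hφ.partialDeriv_star, RCLike.inner_apply, hx]
  have hval : ∫ x in Ω, inner ℂ (p.1 x) (h x) = ∫ x in Ω, h x * starRingEnd ℂ (φ x) := by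
    refine integral_congr_ae ?_
    filter_upwards [hfst] with x hx
    rw [RCLike.inner_apply, hx]
  rw [Set.mem_ofPred_eq, MeasureTheory.L2.inner_def, MeasureTheory.L2.inner_def, hgrad, hval]
  exact hg _ hφ.star

theorem IsTestFunction.hasWeakDiv_single (hψ : IsTestFunction Ω ψ) (i : Fin n) :
    HasWeakDiv Ω ((hψ.memLp_single i).toLp _) ((hψ.memLp_partialDeriv i).toLp _) := by
  intro φ hφ
  have hfield : ∫ x in Ω, ∑ j, ((hψ.memLp_single i).toLp _ : L2 Ω (CSpace n)) x j *
      partialDeriv j φ x = ∫ x in Ω, ψ x * partialDeriv i φ x := by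
    refine integral_congr_ae ?_
    filter_upwards [(hψ.memLp_single i).coeFn_toLp] with x hx
    simp only [hx, PiLp.single_apply, ite_mul, zero_mul, Finset.sum_ite_eq', Finset.mem_univ,
      if_true]
  have hdiv : ∫ x in Ω, ((hψ.memLp_partialDeriv i).toLp _ : L2 Ω ℂ) x * φ x =
      ∫ x in Ω, partialDeriv i ψ x * φ x := by
    refine integral_congr_ae ?_
    filter_upwards [(hψ.memLp_partialDeriv i).coeFn_toLp] with x hx
    rw [hx]
  rw [hfield, hdiv]
  exact hψ.setIntegral_mul_partialDeriv hφ i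

theorem setIntegral_mul_star_snd_eq_zero {p : L2 Ω ℂ × L2 Ω (CSpace n)} (hp : p ∈ H10 Ω)
    (hzero : p.1 = 0) (i : Fin n) (hψ : IsTestFunction Ω ψ) :
    ∫ x in Ω, ψ x * starRingEnd ℂ (p.2 x i) = 0 := by
  have hinner := (hψ.hasWeakDiv_single i).inner_snd_eq_neg_inner_fst hp
  rw [hzero, inner_zero_left, neg_zero, MeasureTheory.L2.inner_def] at hinner
  rw [← hinner]
  refine integral_congr_ae ?_
  filter_upwards [(hψ.memLp_single i).coeFn_toLp] with x hx
  simp only [hx, PiLp.inner_apply, RCLike.inner_apply, PiLp.single_apply, ite_mul, zero_mul,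
    Finset.sum_ite_eq', Finset.mem_univ, if_true]

theorem ae_eq_zero_of_setIntegral_mul_eq_zero (hΩ : IsOpen Ω) {g : RSpace n → ℂ}
    (hg : MemLp g 2 (volume.restrict Ω))
    (h : ∀ ψ : RSpace n → ℂ, IsTestFunction Ω ψ → ∫ x in Ω, ψ x * g x = 0) :
    ∀ᵐ x ∂(volume.restrict Ω), g x = 0 := by
  rw [ae_restrict_iff' hΩ.measurableSet]
  refine hΩ.ae_eq_zero_of_integral_contDiff_smul_eq_zero
    (locallyIntegrableOn_of_locallyIntegrable_restrict (hg.locallyIntegrable one_le_two))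
    fun η hη hcompact hsupport => ?_
  have htest := IsTestFunction.ofReal hη hcompact hsupport
  rw [← h _ htest, setIntegral_eq_integral_of_forall_compl_eq_zero
    fun x hx => by rw [htest.eq_zero_of_notMem hx, zero_mul]]
  exact integral_congr_ae (Eventually.of_forall fun x => Complex.real_smul)

theorem snd_eq_zero_of_fst_eq_zero (hΩ : IsOpen Ω) {p : L2 Ω ℂ × L2 Ω (CSpace n)}
    (hp : p ∈ H10 Ω) (hzero : p.1 = 0) : p.2 = 0 := by
  have hmem : ∀ i, MemLp (fun x => starRingEnd ℂ (p.2 x i)) 2 (volume.restrict Ω) := fun i =>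
    (Lp.memLp p.2).continuousLinearMap_comp (Complex.conjCLE.toContinuousLinearMap ∘L
      (EuclideanSpace.proj (𝕜 := ℂ) i).restrictScalars ℝ)
  have hcoord : ∀ᵐ x ∂(volume.restrict Ω), ∀ i, starRingEnd ℂ (p.2 x i) = 0 :=
    ae_all_iff.2 fun i => ae_eq_zero_of_setIntegral_mul_eq_zero hΩ (hmem i)
      fun ψ hψ => setIntegral_mul_star_snd_eq_zero hp hzero i hψ
  refine Lp.eq_zero_iff_ae_eq_zero.2 ?_
  filter_upwards [hcoord] with x hx
  ext i
  exact (map_eq_zero _).1 (hx i)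

end Sobolev

section Poincare

variable {n : ℕ} {Ω : Set (RSpace n)} {φ : RSpace n → ℂ}

theorem fderiv_norm_sq_single (hφ : Differentiable ℝ φ) (i : Fin n) (x : RSpace n) :
    fderiv ℝ (fun x => ‖φ x‖ ^ 2) x (EuclideanSpace.single i 1) =
      2 * inner ℝ (φ x) (partialDeriv i φ x) := by
  rw [(hφ x).hasFDerivAt.norm_sq.fderiv, smul_apply, nsmul_eq_mul,
    Nat.cast_ofNat]
  rfl

theorem IsTestFunction.integral_norm_sq_eq (hφ : IsTestFunction Ω φ) (i : Fin n) :
    ∫ x in Ω, ‖φ x‖ ^ 2 = -∫ x in Ω, x i * (2 * inner ℝ (φ x) (partialDeriv i φ x)) := by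
  rw [setIntegral_eq_integral_of_forall_compl_eq_zero
      fun x hx => by simp [hφ.eq_zero_of_notMem hx],
    setIntegral_eq_integral_of_forall_compl_eq_zero
      fun x hx => by simp [hφ.eq_zero_of_notMem hx]]
  have hcoord : ∀ x, fderiv ℝ (fun x : RSpace n => x i) x (EuclideanSpace.single i 1) = 1 := by
    intro x
    rw [show (fun x : RSpace n => x i) = EuclideanSpace.proj (𝕜 := ℝ) i from rfl,
      ContinuousLinearMap.fderiv]
    simp
  have hcompact : HasCompactSupport fun x => ‖φ x‖ ^ 2 :=
    hφ.compact.comp_left (g := fun z : ℂ => ‖z‖ ^ 2) (by simp)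
  have hproj : Continuous fun x : RSpace n => x i := by fun_prop
  have hinner : Continuous fun x => 2 * inner ℝ (φ x) (partialDeriv i φ x) :=
    continuous_const.mul (hφ.continuous.inner (hφ.continuous_partialDeriv i))
  have hsq : Continuous fun x => ‖φ x‖ ^ 2 := hφ.continuous.norm.pow 2
  have := integral_mul_fderiv_eq_neg_fderiv_mul_of_integrable (μ := volume)
    (f := fun x : RSpace n => x i) (g := fun x => ‖φ x‖ ^ 2) (v := EuclideanSpace.single i 1)
    ?_ ?_ ?_ (fun x _ => by fun_prop) fun x _ => (hφ.differentiable x).norm_sq ℝ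
  · simp only [hcoord, fderiv_norm_sq_single hφ.differentiable, one_mul] at this
    rw [this, neg_neg]
  · simp only [hcoord, one_mul]
    exact hsq.integrable_of_hasCompactSupport hcompact
  · simp only [fderiv_norm_sq_single hφ.differentiable]
    exact (hproj.mul hinner).integrable_of_hasCompactSupport
      ((hφ.compact.comp₂_left (hφ.hasCompactSupport_partialDeriv i)
        (m := fun z w : ℂ => 2 * inner ℝ z w) (by simp)).mul_left)
  · exact (hproj.mul hsq).integrable_of_hasCompactSupport hcompact.mul_left

theorem L2_norm_sq_eq_integral {X : Type} [NormedAddCommGroup X] [InnerProductSpace ℂ X]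
    (g : L2 Ω X) : ‖g‖ ^ 2 = ∫ x in Ω, ‖g x‖ ^ 2 := by
  have hinner : ∫ x in Ω, inner ℂ (g x) (g x) = ((∫ x in Ω, ‖g x‖ ^ 2 : ℝ) : ℂ) := by
    rw [← integral_complex_ofReal]
    exact integral_congr_ae (Eventually.of_forall fun x => by simp [inner_self_eq_norm_sq_to_K])
  rw [← MeasureTheory.L2.inner_def, inner_self_eq_norm_sq_to_K] at hinner
  exact Complex.ofReal_injective ((Complex.ofReal_pow _ _).trans hinner)

theorem integrable_norm_sq {X : Type} [NormedAddCommGroup X] (g : L2 Ω X) :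
    Integrable (fun x => ‖g x‖ ^ 2) (volume.restrict Ω) :=
  (memLp_two_iff_integrable_sq_norm (Lp.aestronglyMeasurable g)).1 (Lp.memLp g)

theorem norm_mul_two_mul_inner_le {L t : ℝ} (ht : |t| ≤ L) {z w : ℂ} {b : ℝ} (hw : ‖w‖ ≤ b) :
    ‖-(t * (2 * inner ℝ z w))‖ ≤ 2⁻¹ * ‖z‖ ^ 2 + 2 * L ^ 2 * b ^ 2 := by
  have hinner : |inner ℝ z w| ≤ ‖z‖ * b :=
    (abs_real_inner_le_norm z w).trans (by gcongr)
  have hprod : |t| * |inner ℝ z w| ≤ L * (‖z‖ * b) :=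
    mul_le_mul ht hinner (abs_nonneg _) ((abs_nonneg t).trans ht)
  rw [norm_neg, norm_mul, norm_mul, Real.norm_two, Real.norm_eq_abs, Real.norm_eq_abs]
  linarith [sq_nonneg (‖z‖ - 2 * (L * b)), mul_pow L b 2]

theorem norm_fst_le_of_mem_H10 {i : Fin n} {L : ℝ} (hL : 0 ≤ L) (hΩ : ∀ x ∈ Ω, |x i| ≤ L)
    (hΩm : MeasurableSet Ω) {p : L2 Ω ℂ × L2 Ω (CSpace n)} (hp : p ∈ H10 Ω) :
    ‖p.1‖ ≤ 2 * L * ‖p.2‖ := by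
  refine closure_minimal ?_ (isClosed_le (by fun_prop) (by fun_prop) :
    IsClosed {p : L2 Ω ℂ × L2 Ω (CSpace n) | ‖p.1‖ ≤ 2 * L * ‖p.2‖}) hp
  rintro p ⟨φ, hφ, hfst, hsnd⟩
  have hval := (integrable_norm_sq p.1).const_mul 2⁻¹
  have hgrad := (integrable_norm_sq p.2).const_mul (2 * L ^ 2)
  have hsq : ‖p.1‖ ^ 2 ≤ 2⁻¹ * ‖p.1‖ ^ 2 + 2 * L ^ 2 * ‖p.2‖ ^ 2 := by
    calc ‖p.1‖ ^ 2 = ∫ x in Ω, ‖φ x‖ ^ 2 := by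
          rw [L2_norm_sq_eq_integral]
          exact integral_congr_ae (hfst.mono fun x hx => by simp only [hx])
      _ = ∫ x in Ω, -(x i * (2 * inner ℝ (φ x) (partialDeriv i φ x))) := by
          rw [hφ.integral_norm_sq_eq i, integral_neg]
      _ ≤ ∫ x in Ω, (2⁻¹ * ‖p.1 x‖ ^ 2 + 2 * L ^ 2 * ‖p.2 x‖ ^ 2) := by
          refine (Real.le_norm_self _).trans ?_
          refine norm_integral_le_of_norm_le
            (g := fun x => 2⁻¹ * ‖p.1 x‖ ^ 2 + 2 * L ^ 2 * ‖p.2 x‖ ^ 2) (hval.add hgrad) ?_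
          filter_upwards [hfst, hsnd, ae_restrict_mem hΩm] with x hφx hgradx hx
          rw [← hφx, ← hgradx i]
          exact norm_mul_two_mul_inner_le (hΩ x hx) (PiLp.norm_apply_le _ i)
      _ = 2⁻¹ * ‖p.1‖ ^ 2 + 2 * L ^ 2 * ‖p.2‖ ^ 2 := by
          rw [integral_add hval hgrad, integral_const_mul, integral_const_mul,
            ← L2_norm_sq_eq_integral p.1, ← L2_norm_sq_eq_integral p.2]
  refine (sq_le_sq₀ (norm_nonneg _) (by positivity)).1 ?_
  linarith [mul_pow (2 * L) ‖p.2‖ 2, mul_pow 2 L 2]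

end Poincare

section Spectral

theorem inner_eq_inner_add_of_norm_sq {V X Y : Type} [NormedAddCommGroup V]
    [InnerProductSpace ℂ V] [NormedAddCommGroup X] [InnerProductSpace ℂ X] [NormedAddCommGroup Y]
    [InnerProductSpace ℂ Y] {κ : ℝ} (E₁ : V →ₗ[ℂ] X) (E₂ : V →ₗ[ℂ] Y)
    (h : ∀ v, ‖v‖ ^ 2 = ‖E₂ v‖ ^ 2 + κ * ‖E₁ v‖ ^ 2) (v w : V) :
    inner ℂ v w = inner ℂ (E₂ v) (E₂ w) + κ * inner ℂ (E₁ v) (E₁ w) := by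
  have hsq : ∀ v, (‖v‖ : ℂ) ^ 2 = (‖E₂ v‖ : ℂ) ^ 2 + κ * (‖E₁ v‖ : ℂ) ^ 2 := fun v => by
    exact_mod_cast h v
  have hpolarization : ∀ {E : Type} [NormedAddCommGroup E] [InnerProductSpace ℂ E] (x y : E),
      inner ℂ x y = ((‖x + y‖ : ℂ) ^ 2 - (‖x - y‖ : ℂ) ^ 2 +
        ((‖x - Complex.I • y‖ : ℂ) ^ 2 - (‖x + Complex.I • y‖ : ℂ) ^ 2) * Complex.I) / 4 :=
    fun x y => inner_eq_sum_norm_sq_div_four x y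
  rw [hpolarization, hpolarization, hpolarization, hsq, hsq, hsq, hsq]
  simp only [map_add, map_sub, map_smul]
  ring

theorem exists_orthonormalBasis_inner_map_eq {V X : Type} [NormedAddCommGroup V]
    [InnerProductSpace ℂ V] [FiniteDimensional ℂ V] [NormedAddCommGroup X]
    [InnerProductSpace ℂ X] [CompleteSpace X] (E : V →ₗ[ℂ] X) :
    ∃ (b : OrthonormalBasis (Fin (Module.finrank ℂ V)) ℂ V) (m : Fin (Module.finrank ℂ V) → ℝ),
      ∀ j v, inner ℂ (E (b j)) (E v) = m j * inner ℂ (b j) v := by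
  have := FiniteDimensional.complete ℂ V
  set T : V →ₗ[ℂ] V := (ContinuousLinearMap.adjoint (LinearMap.toContinuousLinearMap E) ∘L
    LinearMap.toContinuousLinearMap E).toLinearMap
  have hleft : ∀ v w, inner ℂ (T v) w = inner ℂ (E v) (E w) := fun v w =>
    ContinuousLinearMap.adjoint_inner_left (LinearMap.toContinuousLinearMap E) w (E v)
  have hright : ∀ v w, inner ℂ v (T w) = inner ℂ (E v) (E w) := fun v w =>
    ContinuousLinearMap.adjoint_inner_right (LinearMap.toContinuousLinearMap E) v (E w)
  have hsymmetric : T.IsSymmetric := fun v w => by rw [hleft, hright]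
  refine ⟨hsymmetric.eigenvectorBasis rfl, hsymmetric.eigenvalues rfl, fun j v => ?_⟩
  rw [← hleft, hsymmetric.apply_eigenvectorBasis rfl, inner_smul_left]
  exact congrArg (· * _) (Complex.conj_ofReal _)

theorem norm_sq_map_eq_of_inner_map_eq {V X : Type} [NormedAddCommGroup V] [InnerProductSpace ℂ V]
    [NormedAddCommGroup X] [InnerProductSpace ℂ X] {v : V} {x : X} {l : ℝ} (hv : ‖v‖ = 1)
    (h : inner ℂ x x = l * inner ℂ v v) : ‖x‖ ^ 2 = l := by
  rw [inner_self_eq_norm_sq_to_K, inner_self_eq_norm_sq_to_K, hv] at h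
  refine Complex.ofReal_injective ((Complex.ofReal_pow _ _).trans (h.trans ?_))
  rw [RCLike.ofReal_one, one_pow, mul_one]

namespace DiscreteSpace

variable {n : ℕ} {κ : ℝ} {Ω : Set (RSpace n)} {V : Type}
  [NormedAddCommGroup V] [InnerProductSpace ℂ V] (S : DiscreteSpace κ Ω V)

theorem inner_eq (v w : V) : inner ℂ v w =
    inner ℂ (S.emb v).2 (S.emb w).2 + κ * inner ℂ (S.emb v).1 (S.emb w).1 :=
  inner_eq_inner_add_of_norm_sq ((LinearMap.fst ℂ _ _).comp S.emb)
    ((LinearMap.snd ℂ _ _).comp S.emb) S.norm_sq v w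

theorem emb_fst_ne_zero (hΩ : IsOpen Ω) {v : V} (hv : v ≠ 0) : (S.emb v).1 ≠ 0 := by
  intro hfst
  have hnorm := S.norm_sq v
  rw [snd_eq_zero_of_fst_eq_zero hΩ (S.emb_mem v) hfst, hfst] at hnorm
  exact hv (by simpa using hnorm)

theorem norm_emb_snd_le (hκ : 0 ≤ κ) (v : V) : ‖(S.emb v).2‖ ≤ ‖v‖ := by
  refine (sq_le_sq₀ (norm_nonneg _) (norm_nonneg _)).1 ?_
  rw [S.norm_sq]
  exact le_add_of_nonneg_right (by positivity)

theorem norm_emb_fst_le_of_pos (hκ : 0 < κ) (v : V) : ‖(S.emb v).1‖ ≤ (√κ)⁻¹ * ‖v‖ := by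
  rw [inv_mul_eq_div, le_div_iff₀ (Real.sqrt_pos.2 hκ)]
  refine (sq_le_sq₀ (by positivity) (norm_nonneg _)).1 ?_
  rw [S.norm_sq, mul_pow, Real.sq_sqrt hκ.le, mul_comm]
  exact le_add_of_nonneg_left (by positivity)

theorem exists_norm_emb_fst_le (hΩ : IsOpen Ω) (hκ : 0 ≤ κ)
    (hκΩ : 0 < κ ∨ ∃ (i : Fin n) (L : ℝ), ∀ x ∈ Ω, |x i| ≤ L) :
    ∃ c : ℝ, ∀ (V : Type) [NormedAddCommGroup V] [InnerProductSpace ℂ V]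
      (S : DiscreteSpace κ Ω V) (v : V), ‖(S.emb v).1‖ ≤ c * ‖v‖ := by
  rcases hκΩ with hκ₀ | ⟨i, L, hL⟩
  · exact ⟨_, fun V _ _ S => S.norm_emb_fst_le_of_pos hκ₀⟩
  · refine ⟨2 * max L 0, fun V _ _ S v => ?_⟩
    exact (norm_fst_le_of_mem_H10 (le_max_right L 0) (fun x hx => (hL x hx).trans
      (le_max_left L 0)) hΩ.measurableSet (S.emb_mem v)).trans
        (mul_le_mul_of_nonneg_left (S.norm_emb_snd_le hκ v) (by positivity))

variable [FiniteDimensional ℂ V]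

@[simp]
theorem toDual_apply (v w : V) : S.toDual v w = inner ℂ (S.emb w).1 (S.emb v).1 := rfl

@[simp]
theorem A_apply (v w : V) : S.A v w = inner ℂ (S.emb w).2 (S.emb v).2 := rfl

/-- The embedding `V → V⋆` as a continuous linear map. -/
def toDualL : V →L[ℂ] AntiDual V :=
  LinearMap.toContinuousLinearMap
    { toFun := S.toDual
      map_add' := fun v w => by ext; simp [inner_add_right]
      map_smul' := fun c v => by ext; simp [inner_smul_right] }

theorem toDualL_apply (v : V) : S.toDualL v = S.toDual v := rfl

theorem norm_toDual_le {c : ℝ} (hc : ∀ v, ‖(S.emb v).1‖ ≤ c * ‖v‖) (v : V) :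
    ‖S.toDual v‖ ≤ c ^ 2 * ‖v‖ := by
  refine ContinuousLinearMap.opNorm_le_bound _ (by positivity) fun w => ?_
  calc ‖S.toDual v w‖ ≤ ‖(S.emb w).1‖ * ‖(S.emb v).1‖ :=
        norm_inner_le_norm (𝕜 := ℂ) (S.emb w).1 (S.emb v).1
    _ ≤ (c * ‖w‖) * (c * ‖v‖) := mul_le_mul (hc w) (hc v) (norm_nonneg _)
        ((norm_nonneg _).trans (hc w))
    _ = c ^ 2 * ‖v‖ * ‖w‖ := by ring

/-- An orthonormal basis of `V` which diagonalizes both the embedding `V → V⋆`, with eigenvalues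
`m j`, and the operator `A : V → V⋆`, with eigenvalues `p j`. -/
structure IsEigenbasis {ι : Type*} [Fintype ι] (b : OrthonormalBasis ι ℂ V) (m p : ι → ℝ) :
    Prop where
  pos : ∀ j, 0 < m j
  nonneg : ∀ j, 0 ≤ p j
  add_mul : ∀ j, p j + κ * m j = 1
  toDual_apply : ∀ j v, S.toDual v (b j) = m j * inner ℂ (b j) v
  A_apply : ∀ j v, S.A v (b j) = p j * inner ℂ (b j) v

theorem exists_isEigenbasis (hΩ : IsOpen Ω) :
    ∃ (b : OrthonormalBasis (Fin (Module.finrank ℂ V)) ℂ V)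
      (m p : Fin (Module.finrank ℂ V) → ℝ), S.IsEigenbasis b m p := by
  obtain ⟨b, m, hm⟩ := exists_orthonormalBasis_inner_map_eq ((LinearMap.fst ℂ _ _).comp S.emb)
  have hp : ∀ j v, inner ℂ (S.emb (b j)).2 (S.emb v).2 = (1 - κ * m j : ℝ) * inner ℂ (b j) v := by
    intro j v
    have hfst : inner ℂ (S.emb (b j)).1 (S.emb v).1 = m j * inner ℂ (b j) v := hm j v
    push_cast
    linear_combination -S.inner_eq (b j) v - κ * hfst
  have hval : ∀ j, ‖(S.emb (b j)).1‖ ^ 2 = m j := fun j =>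
    norm_sq_map_eq_of_inner_map_eq (b.norm_eq_one j) (hm j (b j))
  have hgrad : ∀ j, ‖(S.emb (b j)).2‖ ^ 2 = 1 - κ * m j := fun j =>
    norm_sq_map_eq_of_inner_map_eq (b.norm_eq_one j) (hp j (b j))
  refine ⟨b, m, fun j => 1 - κ * m j, fun j => ?_, fun j => ?_, fun j => ?_, hm, hp⟩
  · have hne : b j ≠ 0 := norm_pos_iff.1 (by rw [b.norm_eq_one]; exact one_pos)
    rw [← hval]
    exact pow_pos (norm_pos_iff.2 (S.emb_fst_ne_zero hΩ hne)) 2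
  · rw [← hgrad]
    positivity
  · exact sub_add_cancel 1 _

namespace IsEigenbasis

variable {S} {ι : Type*} [Fintype ι] {b : OrthonormalBasis ι ℂ V} {m p : ι → ℝ}

theorem isCoercive (h : S.IsEigenbasis b m p) {α : ℝ} (hα : 1 ≤ α) :
    IsCoercive m p α (max 1 κ) where
  nonneg j := (h.pos j).le
  le_add j := le_add_of_nonneg_of_le (h.nonneg j) (le_mul_of_one_le_left (h.pos j).le hα)
  one_le_mul_add j := by
    have hm := (h.pos j).le
    calc 1 = p j + κ * m j := (h.add_mul j).symm
      _ ≤ max 1 κ * p j + max 1 κ * (α * m j) := by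
          refine add_le_add (le_mul_of_one_le_left (h.nonneg j) (le_max_left 1 κ)) ?_
          exact mul_le_mul (le_max_right 1 κ) (le_mul_of_one_le_left hm hα) hm (by positivity)
      _ = max 1 κ * (p j + α * m j) := (mul_add _ _ _).symm
  one_le := le_max_left 1 κ

theorem isDiagonalEvolution (h : S.IsEigenbasis b m p) {α d C₀ : ℝ} {f f' : ℝ → AntiDual V}
    {F F' : ℂ → AntiDual V} {f₀ : H1 Ω} {u₀h : V} {u u' : ℝ → V}
    (hadm : Admissible S α d C₀ f f' F F' f₀) (hsol : S.IsSolution f u₀h u u') :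
    IsDiagonalEvolution b m p f f' u₀h u u' where
  pos := h.pos
  nonneg := h.nonneg
  memLp_source := hadm.memLp_deriv
  source := hadm.primitive
  memLp := hsol.memLp
  primitive := hsol.primitive
  equation := hsol.equation.mono fun t ht j => by
    rw [← ht, add_apply, h.toDual_apply, h.A_apply]

theorem eq_resolvent (h : S.IsEigenbasis b m p) {s : ℂ} (hs : 0 < s.re) {φ : AntiDual V}
    {q w : V} (hw : S.IsLaplaceSolution s (φ + S.toDual q) w) : w = resolvent b m p s φ q := by
  rw [← b.sum_repr' w, resolvent]
  refine Finset.sum_congr rfl fun j _ => congrArg (· • b j) ?_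
  have hcoord := congrArg (fun ψ : AntiDual V => ψ (b j)) hw
  simp only [add_apply, smul_apply, h.toDual_apply, h.A_apply, smul_eq_mul] at hcoord
  rw [eq_div_iff (symbol_ne_zero (h.pos j) (h.nonneg j) hs), ← hcoord, symbol]
  ring

end IsEigenbasis

end DiscreteSpace

end Spectral

section InitialData

variable {n : ℕ} {κ : ℝ} {Ω : Set (RSpace n)} {V : Type}
  [NormedAddCommGroup V] [InnerProductSpace ℂ V]

theorem H2.hasWeakDiv_grad (u : H2 Ω) : HasWeakDiv Ω u.grad u.laplacian := by
  intro φ hφ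
  have hgrad : ∀ i, Integrable (fun x => u.grad x i * partialDeriv i φ x) (volume.restrict Ω) :=
    fun i => ((Lp.memLp u.grad).continuousLinearMap_comp
      (EuclideanSpace.proj (𝕜 := ℂ) i)).integrable_mul (hφ.memLp_partialDeriv i)
  have hhess : ∀ i, Integrable (fun x => u.hess x (i, i) * φ x) (volume.restrict Ω) :=
    fun i => ((Lp.memLp u.hess).continuousLinearMap_comp
      (EuclideanSpace.proj (𝕜 := ℂ) (i, i))).integrable_mul hφ.memLp
  have hlaplacian : ∫ x in Ω, u.laplacian x * φ x = ∫ x in Ω, ∑ i, u.hess x (i, i) * φ x := by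
    refine integral_congr_ae ?_
    filter_upwards [ContinuousLinearMap.coeFn_compLp (∑ i : Fin n, (EuclideanSpace.proj (i, i) :
      EuclideanSpace ℂ (Fin n × Fin n) →L[ℂ] ℂ)) u.hess] with x hx
    rw [H2.laplacian, hx, ← Finset.sum_mul]
    simp
  rw [hlaplacian, integral_finsetSum _ fun i _ => hgrad i,
    integral_finsetSum _ fun i _ => hhess i, ← Finset.sum_neg_distrib]
  exact Finset.sum_congr rfl fun i _ => u.weak_hess i i φ hφ

namespace DiscreteSpace

theorem norm_emb_sq_le (S : DiscreteSpace κ Ω V) {u : H1 Ω} {v : V} (hv : S.IsH1Proj u v) :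
    ‖(S.emb v).1‖ ^ 2 + ‖(S.emb v).2‖ ^ 2 ≤ ‖u.val‖ ^ 2 + ‖u.grad‖ ^ 2 := by
  set a := ‖(S.emb v).1‖
  set b := ‖(S.emb v).2‖
  have hinner : ((a ^ 2 + b ^ 2 : ℝ) : ℂ) =
      inner ℂ (S.emb v).1 u.val + inner ℂ (S.emb v).2 u.grad := by
    have horth := hv v
    rw [inner_sub_right, inner_sub_right, inner_self_eq_norm_sq_to_K,
      inner_self_eq_norm_sq_to_K] at horth
    push_cast
    linear_combination horth
  have hcauchy : a ^ 2 + b ^ 2 ≤ a * ‖u.val‖ + b * ‖u.grad‖ := by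
    calc a ^ 2 + b ^ 2 = ‖((a ^ 2 + b ^ 2 : ℝ) : ℂ)‖ := by
          rw [Complex.norm_real, Real.norm_of_nonneg (by positivity)]
      _ ≤ _ := by
          rw [hinner]
          exact norm_add_le_of_le (norm_inner_le_norm _ _) (norm_inner_le_norm _ _)
  linarith [two_mul_le_add_sq a ‖u.val‖, two_mul_le_add_sq b ‖u.grad‖]

theorem norm_sq_le_mul_normSq (S : DiscreteSpace κ Ω V) {u : H2 Ω} {v : V}
    (hv : S.IsH1Proj u.toH1 v) : ‖v‖ ^ 2 ≤ max 1 κ * u.normSq := by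
  calc ‖v‖ ^ 2 = 1 * ‖(S.emb v).2‖ ^ 2 + κ * ‖(S.emb v).1‖ ^ 2 := by rw [S.norm_sq, one_mul]
    _ ≤ max 1 κ * ‖(S.emb v).2‖ ^ 2 + max 1 κ * ‖(S.emb v).1‖ ^ 2 := by
        gcongr
        exacts [le_max_left 1 κ, le_max_right 1 κ]
    _ = max 1 κ * (‖(S.emb v).1‖ ^ 2 + ‖(S.emb v).2‖ ^ 2) := by ring
    _ ≤ max 1 κ * u.normSq := by
        gcongr
        exact (S.norm_emb_sq_le hv).trans (le_add_of_nonneg_right (sq_nonneg _))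

variable [FiniteDimensional ℂ V] (S : DiscreteSpace κ Ω V)

/-- The functional `f(0) - A u₀h` is the initial value of `∂ₜu`; the projections of the data bound
its representative in `V` uniformly in the discrete space. -/
theorem l2Functional_sub_A_eq_toDual {f₀ : H1 Ω} {u₀ : H2 Ω} {u₀h Pf₀ PΔu₀ Pu₀ : V}
    (hu₀h : S.IsH1Proj u₀.toH1 u₀h) (hPf : S.IsL2Proj f₀.val Pf₀)
    (hPΔ : S.IsL2Proj u₀.laplacian PΔu₀) (hPu : S.IsL2Proj u₀.val Pu₀) (w : V) :
    S.l2Functional f₀.val w - S.A u₀h w = S.toDual (Pf₀ + PΔu₀ + (u₀h - Pu₀)) w := by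
  have hsource : S.l2Functional f₀.val w = S.toDual Pf₀ w :=
    (sub_eq_zero.1 ((inner_sub_right _ _ _).symm.trans (hPf w))).symm
  have hlaplacian : S.toDual PΔu₀ w = inner ℂ (S.emb w).1 u₀.laplacian :=
    sub_eq_zero.1 ((inner_sub_right _ _ _).symm.trans (hPΔ w))
  have hval : S.toDual Pu₀ w = inner ℂ (S.emb w).1 u₀.val :=
    sub_eq_zero.1 ((inner_sub_right _ _ _).symm.trans (hPu w))
  have hproj : S.toDual u₀h w - inner ℂ (S.emb w).1 u₀.val +
      (S.A u₀h w - inner ℂ (S.emb w).2 u₀.grad) = 0 := by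
    simpa only [inner_sub_right, toDual_apply, A_apply] using hu₀h w
  have hgreen := u₀.hasWeakDiv_grad.inner_snd_eq_neg_inner_fst (S.emb_mem w)
  have hsum : S.toDual (Pf₀ + PΔu₀ + (u₀h - Pu₀)) w = S.toDual Pf₀ w + S.toDual PΔu₀ w +
      (S.toDual u₀h w - S.toDual Pu₀ w) := by
    simp only [← S.toDualL_apply, map_add, map_sub, add_apply, sub_apply]
  rw [hsum, hsource, hlaplacian, hval]
  linear_combination -hproj - hgreen

end DiscreteSpace

end InitialData

section GoalFunctional

theorem hardySq_congr {X : Type} [NormedAddCommGroup X] [NormedSpace ℂ X] {α : ℝ} {g h : ℂ → X}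
    (hgh : ∀ s : ℂ, α < s.re → g s = h s) : hardySq α g = hardySq α h := by
  have hline : ∀ σ ∈ Ioi α, ∀ τ : ℝ, g (σ + Complex.I * τ) = h (σ + Complex.I * τ) :=
    fun σ hσ τ => hgh _ (by simpa using hσ)
  refine iSup_congr fun σ => iSup_congr fun hσ => ?_
  simp only [hline σ hσ]

theorem hardySq_clm_laplace_le {X Y : Type} [NormedAddCommGroup X] [NormedSpace ℂ X]
    [CompleteSpace X] [NormedAddCommGroup Y] [NormedSpace ℂ Y] [CompleteSpace Y]
    (T : X →L[ℂ] Y) {u : ℝ → X} {α : ℝ} (hu : LaplaceIntegrable u α) :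
    hardySq α (fun s => T (laplace u s)) ≤
      ∫⁻ τ : ℝ, ‖T (laplace u (α + Complex.I * τ))‖ₑ ^ 2 := by
  have hT : ∀ s : ℂ, α ≤ s.re → laplace (fun t => T (u t)) s = T (laplace u s) := fun s hs =>
    laplace_clm_comp T (hu.mono (by simpa using hs))
  rw [hardySq_congr fun s hs => (hT s hs.le).symm]
  refine (hardySq_laplace_le (hu.clm_comp T)).trans (le_of_eq (lintegral_congr fun τ => ?_))
  rw [hT _ (by simp)]

variable {n : ℕ} {κ : ℝ} {Ω : Set (RSpace n)} {V : Type}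
  [NormedAddCommGroup V] [InnerProductSpace ℂ V] [FiniteDimensional ℂ V]

theorem goal_le (S : DiscreteSpace κ Ω V) {c α : ℝ} (hc : ∀ v, ‖(S.emb v).1‖ ≤ c * ‖v‖)
    {u u' : ℝ → V} (hu : LaplaceIntegrable u α) (hu' : LaplaceIntegrable u' α)
    (W : Submodule ℂ V) :
    goal S α u u' W ≤
      (∫⁻ τ : ℝ, ‖laplace u (α + Complex.I * τ) -
        W.starProjection (laplace u (α + Complex.I * τ))‖ₑ ^ 2) +
      ENNReal.ofReal (c ^ 4) * ∫⁻ τ : ℝ, ‖laplace u' (α + Complex.I * τ) -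
        W.starProjection (laplace u' (α + Complex.I * τ))‖ₑ ^ 2 := by
  have := FiniteDimensional.complete ℂ V
  set Q : V →L[ℂ] V := ContinuousLinearMap.id ℂ V - W.starProjection
  have hdual : ∀ s : ℂ, α < s.re → laplace (fun t => S.toDual (u' t)) s -
      laplace (fun t => S.toDual (W.starProjection (u' t))) s =
        (S.toDualL ∘L Q) (laplace u' s) := by
    intro s hs
    have hint : LaplaceIntegrable u' s := hu'.mono (by simpa using hs.le)
    exact (congrArg₂ (· - ·) (laplace_clm_comp S.toDualL hint)
      (laplace_clm_comp (S.toDualL ∘L W.starProjection) hint)).trans (map_sub S.toDualL _ _).symm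
  refine add_le_add (hardySq_clm_laplace_le Q hu) ?_
  rw [hardySq_congr hdual, ← lintegral_const_mul' _ _ ENNReal.ofReal_ne_top]
  refine (hardySq_clm_laplace_le (S.toDualL ∘L Q) hu').trans (lintegral_mono fun τ => ?_)
  have hnorm := S.norm_toDual_le hc (Q (laplace u' (α + Complex.I * τ)))
  rw [enorm_sq_eq_ofReal, enorm_sq_eq_ofReal, ← ENNReal.ofReal_mul (by positivity)]
  refine ENNReal.ofReal_le_ofReal ((pow_le_pow_left₀ (norm_nonneg _) hnorm 2).trans_eq ?_)
  rw [mul_pow, ← pow_mul]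
  rfl

end GoalFunctional

section Rate

variable {d : ℝ} {K R : ℕ}

theorem exp_neg_sqrt_le (hd : d ∈ Ioo 0 (Real.pi / 2)) (hR : R ≤ 2 * K + 3) :
    Real.exp (-√(2 * Real.pi * d * K)) ≤
      Real.exp 4 * Real.exp (-2 * √(Real.pi * d * R / 4)) := by
  have hd₀ := hd.1
  rw [← Real.exp_add]
  refine Real.exp_le_exp.2 ?_
  have hhalf : 2 * √(Real.pi * d * R / 4) = √(Real.pi * d * R) := by
    rw [Real.sqrt_div (by positivity), show (4 : ℝ) = 2 ^ 2 by norm_num,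
      Real.sqrt_sq (by norm_num)]
    ring
  have hsplit : √(Real.pi * d * R) ≤ √(2 * Real.pi * d * K) + √(3 * Real.pi * d) := by
    have hcast : (R : ℝ) ≤ 2 * K + 3 := by exact_mod_cast hR
    have hcross := mul_nonneg (Real.sqrt_nonneg (2 * Real.pi * d * K))
      (Real.sqrt_nonneg (3 * Real.pi * d))
    rw [Real.sqrt_le_left (by positivity), add_sq, Real.sq_sqrt (by positivity),
      Real.sq_sqrt (by positivity)]
    linarith [mul_le_mul_of_nonneg_left hcast (by positivity : 0 ≤ Real.pi * d)]
  have hrest : √(3 * Real.pi * d) ≤ 4 := by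
    rw [Real.sqrt_le_left (by norm_num)]
    nlinarith [Real.pi_lt_d2, hd.2]
  linarith

theorem sqrt_mul_exp_le_rate (hd : d ∈ Ioo 0 (Real.pi / 2)) (hKR : K ≤ R) (hR : R ≤ 2 * K + 3) :
    √K * Real.exp (-√(2 * Real.pi * d * K)) ≤ Real.exp 4 * rate d R := by
  rw [rate, ← Real.sqrt_eq_rpow, mul_left_comm]
  exact mul_le_mul (Real.sqrt_le_sqrt (by exact_mod_cast hKR)) (exp_neg_sqrt_le hd hR)
    (Real.exp_pos _).le (Real.sqrt_nonneg _)

theorem one_le_rate (hd : d ∈ Ioo 0 (Real.pi / 2)) (hR₁ : 1 ≤ R) (hR₃ : R ≤ 3) :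
    1 ≤ Real.exp 4 * rate d R := by
  rw [rate, ← Real.sqrt_eq_rpow, mul_left_comm]
  have hsqrt : 1 ≤ √(R : ℝ) := Real.one_le_sqrt.2 (by exact_mod_cast hR₁)
  have hexp := exp_neg_sqrt_le (K := 0) hd (R := R) (by omega)
  rw [Nat.cast_zero, mul_zero, Real.sqrt_zero, neg_zero, Real.exp_zero] at hexp
  exact one_le_mul_of_one_le_of_one_le hsqrt hexp

/-- The factor `C(d, α)` of the error bound, which does not depend on `α`. -/
def angleConst (d : ℝ) : ℝ := (10 * stripConst d + 4) * ((1 - Real.sin d)⁻¹) ^ 2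

theorem angleConst_pos (hd : d ∈ Ioo 0 (Real.pi / 2)) : 0 < angleConst d := by
  have hstrip := stripConst_pos hd.1
  have hsin := one_sub_sin_pos hd
  unfold angleConst
  positivity

theorem tendsto_angleConst : Tendsto angleConst (𝓝[<] (Real.pi / 2)) atTop := by
  have hnear : ∀ᶠ d in 𝓝[<] (Real.pi / 2), d ∈ Ioo 0 (Real.pi / 2) :=
    Ioo_mem_nhdsLT (by positivity)
  have hsin : Tendsto (fun d => 1 - Real.sin d) (𝓝[<] (Real.pi / 2)) (𝓝[>] 0) := by
    refine tendsto_nhdsWithin_iff.2 ⟨?_, hnear.mono fun d hd => one_sub_sin_pos hd⟩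
    refine Tendsto.mono_left ?_ nhdsWithin_le_nhds
    exact Continuous.tendsto' (by fun_prop) _ _ (by rw [Real.sin_pi_div_two, sub_self])
  refine tendsto_atTop_mono' _ (hnear.mono fun d hd => ?_)
    ((tendsto_pow_atTop two_ne_zero).comp (tendsto_inv_nhdsGT_zero.comp hsin))
  exact le_mul_of_one_le_left (sq_nonneg _) (by linarith [stripConst_pos hd.1])

end Rate

section ErrorBound

namespace IsCoercive

variable {V : Type} [NormedAddCommGroup V] [InnerProductSpace ℂ V] {ι : Type*} [Fintype ι]
  {b : OrthonormalBasis ι ℂ V} {m p : ι → ℝ} {α β d C₀ : ℝ} {Φ : ℂ → AntiDual V} {q : V}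
  (W : Submodule ℂ V) [W.HasOrthogonalProjection]

theorem lintegral_le_angleConst_mul_exp [CompleteSpace V] (h : IsCoercive m p α β)
    (hd : d ∈ Ioo 0 (Real.pi / 2)) (hΦ : MemNTwo d Φ) (hC : ∀ τ : ℝ, ‖Φ τ‖ ≤ C₀ / √(1 + τ ^ 2))
    {K : ℕ} (hK : 1 ≤ K)
    (hW : ∀ k : ℤ, |k| ≤ K → resolvent b m p (α + Complex.I * sincPoint d K k)
      (Φ (sincPoint d K k)) q ∈ W) :
    ∫⁻ τ : ℝ, ‖resolvent b m p (α + Complex.I * τ) (Φ τ) q -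
        W.starProjection (resolvent b m p (α + Complex.I * τ) (Φ τ) q)‖ₑ ^ 2 ≤
      ENNReal.ofReal (β ^ 2 * (angleConst d * (√K * Real.exp (-√(2 * Real.pi * d * K))))) *
        (nTwoSq d Φ + ENNReal.ofReal ((C₀ + ‖q‖) ^ 2)) := by
  refine (lintegral_resolvent_sub_starProjection_le h hd hΦ hC hK W hW).trans ?_
  gcongr ENNReal.ofReal ?_ * _
  rw [resolventConst, angleConst, ← sub_nonneg]
  calc 0 ≤ 4 * (β * (1 - Real.sin d)⁻¹) ^ 2 *
        (√K * Real.exp (-√(2 * Real.pi * d * K))) := by positivity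
    _ = _ := by ring

theorem lintegral_le_angleConst (h : IsCoercive m p α β) (hd : d ∈ Ioo 0 (Real.pi / 2))
    (hC : ∀ τ : ℝ, ‖Φ τ‖ ≤ C₀ / √(1 + τ ^ 2)) :
    ∫⁻ τ : ℝ, ‖resolvent b m p (α + Complex.I * τ) (Φ τ) q -
        W.starProjection (resolvent b m p (α + Complex.I * τ) (Φ τ) q)‖ₑ ^ 2 ≤
      ENNReal.ofReal (β ^ 2 * (angleConst d * 1)) *
        (nTwoSq d Φ + ENNReal.ofReal ((C₀ + ‖q‖) ^ 2)) := by
  have hstrip := stripConst_pos hd.1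
  have hangle := angleConst_pos hd
  refine (lintegral_resolvent_sub_starProjection_le_const h hd hC W).trans ?_
  refine le_trans ?_ (mul_le_mul_right le_add_self _)
  rw [← ENNReal.ofReal_mul (by positivity)]
  gcongr ENNReal.ofReal (?_ * _)
  rw [resolventConst, angleConst, ← sub_nonneg]
  calc 0 ≤ 10 * stripConst d * (β * (1 - Real.sin d)⁻¹) ^ 2 := by positivity
    _ = _ := by ring

end IsCoercive

variable {n : ℕ} {Ω : Set (RSpace n)} {V : Type} [NormedAddCommGroup V]

/-- The part of the data norm `𝓑` that does not involve the source term, where `r` stands for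
`u₀h - Π_h u₀`. -/
def initialSq (Pf₀ PΔu₀ r : V) (u₀ : H2 Ω) : ℝ :=
  1 + ‖Pf₀‖ ^ 2 + ‖PΔu₀‖ ^ 2 + ‖r‖ ^ 2 + u₀.normSq

theorem H2.normSq_nonneg (u : H2 Ω) : 0 ≤ u.normSq := by
  unfold H2.normSq
  positivity

section InitialSq

variable (Pf₀ PΔu₀ r : V) (u₀ : H2 Ω)

theorem one_le_initialSq : 1 ≤ initialSq Pf₀ PΔu₀ r u₀ := by
  unfold initialSq
  linarith [u₀.normSq_nonneg, sq_nonneg ‖Pf₀‖, sq_nonneg ‖PΔu₀‖, sq_nonneg ‖r‖]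

theorem normSq_le_initialSq : u₀.normSq ≤ initialSq Pf₀ PΔu₀ r u₀ :=
  le_add_of_nonneg_left (by positivity)

theorem norm_add_sq_le_three_mul_initialSq :
    ‖Pf₀ + PΔu₀ + r‖ ^ 2 ≤ 3 * initialSq Pf₀ PΔu₀ r u₀ := by
  calc ‖Pf₀ + PΔu₀ + r‖ ^ 2 ≤ (‖Pf₀‖ + ‖PΔu₀‖ + ‖r‖) ^ 2 := by gcongr; exact norm_add₃_le
    _ ≤ 3 * (‖Pf₀‖ ^ 2 + ‖PΔu₀‖ ^ 2 + ‖r‖ ^ 2) := by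
        linarith [sq_nonneg (‖Pf₀‖ - ‖PΔu₀‖), sq_nonneg (‖PΔu₀‖ - ‖r‖), sq_nonneg (‖Pf₀‖ - ‖r‖)]
    _ ≤ 3 * initialSq Pf₀ PΔu₀ r u₀ := by
        unfold initialSq
        linarith [u₀.normSq_nonneg]

end InitialSq

theorem add_sq_le_mul {a x B : ℝ} (hB : 1 ≤ B) (hx : x ^ 2 ≤ 3 * B) :
    (a + x) ^ 2 ≤ (2 * a ^ 2 + 6) * B := by
  calc (a + x) ^ 2 ≤ 2 * (a ^ 2 + x ^ 2) := add_sq_le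
    _ ≤ 2 * (a ^ 2 * B + 3 * B) := by gcongr; exact le_mul_of_one_le_right (sq_nonneg a) hB
    _ = (2 * a ^ 2 + 6) * B := by ring

theorem sq_add_norm_initial_deriv_le (κ C₀ : ℝ) (Pf₀ PΔu₀ r : V) (u₀ : H2 Ω) :
    (C₀ + ‖Pf₀ + PΔu₀ + r‖) ^ 2 ≤ (2 * C₀ ^ 2 + 6) * (max 1 κ * initialSq Pf₀ PΔu₀ r u₀) := by
  have hone := one_le_initialSq Pf₀ PΔu₀ r u₀
  refine add_sq_le_mul (one_le_mul_of_one_le_of_one_le (le_max_left 1 κ) hone) ?_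
  refine (norm_add_sq_le_three_mul_initialSq Pf₀ PΔu₀ r u₀).trans ?_
  gcongr
  exact le_mul_of_one_le_left (one_pos.le.trans hone) (le_max_left 1 κ)

theorem ofReal_mul_add_ofReal_le {a N : ℝ≥0∞} {T M x B : ℝ} (hT : 0 ≤ T) (hM : 1 ≤ M)
    (hx : x ≤ M * B) (ha : a ≤ N) :
    ENNReal.ofReal T * (a + ENNReal.ofReal x) ≤
      ENNReal.ofReal (T * M) * (N + ENNReal.ofReal B) := by
  rw [ENNReal.ofReal_mul hT, mul_assoc, mul_add _ N, ← ENNReal.ofReal_mul (one_pos.le.trans hM)]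
  gcongr
  exact ha.trans (le_mul_of_one_le_left' (ENNReal.one_le_ofReal.2 hM))

theorem add_ofReal_mul_le {a b N : ℝ≥0∞} {c T : ℝ} (hc : 0 ≤ c) (ha : a ≤ ENNReal.ofReal T * N)
    (hb : b ≤ ENNReal.ofReal T * N) :
    a + ENNReal.ofReal c * b ≤ ENNReal.ofReal ((1 + c) * T) * N := by
  calc a + ENNReal.ofReal c * b
      ≤ ENNReal.ofReal T * N + ENNReal.ofReal c * (ENNReal.ofReal T * N) := by gcongr
    _ = ENNReal.ofReal ((1 + c) * T) * N := by
        rw [ENNReal.ofReal_mul (by positivity), ENNReal.ofReal_add zero_le_one hc,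
          ENNReal.ofReal_one]
        ring

/-- The factor `c` of the error bound, up to the constant relating the number of nodes to the
dimension `R`; here `c` bounds the embedding of `V` into `L²(Ω)`. -/
def errorConst (κ c C₀ : ℝ) : ℝ := (1 + c ^ 4) * (max 1 κ ^ 3 * (2 * C₀ ^ 2 + 6))

theorem errorConst_pos (κ c C₀ : ℝ) : 0 < errorConst κ c C₀ := by
  unfold errorConst
  positivity

theorem ofReal_errorConst_mul_le {κ c C₀ d x : ℝ} {R : ℕ} (hd : d ∈ Ioo 0 (Real.pi / 2))
    (hx : x ≤ Real.exp 4 * rate d R) :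
    ENNReal.ofReal (errorConst κ c C₀ * (angleConst d * x)) ≤
      ENNReal.ofReal (Real.exp 4 * errorConst κ c C₀ * (angleConst d * rate d R)) := by
  have herror := errorConst_pos κ c C₀
  have hangle := angleConst_pos hd
  refine ENNReal.ofReal_le_ofReal ?_
  calc errorConst κ c C₀ * (angleConst d * x)
      ≤ errorConst κ c C₀ * (angleConst d * (Real.exp 4 * rate d R)) := by gcongr
    _ = Real.exp 4 * errorConst κ c C₀ * (angleConst d * rate d R) := by ring

theorem finrank_span_nodes_le {V : Type*} [AddCommGroup V] [Module ℂ V] (q : V) (w : ℤ → V)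
    (K : ℕ) :
    Module.finrank ℂ (Submodule.span ℂ ({q} ∪ w '' {k : ℤ | |k| ≤ (K : ℤ)})) ≤ 2 * K + 2 := by
  classical
  set nodes : Finset V := insert q ((Finset.Icc (-(K : ℤ)) K).image w) with hnodes
  have hcoe : ({q} ∪ w '' {k : ℤ | |k| ≤ (K : ℤ)} : Set V) = nodes := by
    ext v
    simp [hnodes, abs_le]
  rw [hcoe]
  calc Module.finrank ℂ (Submodule.span ℂ (nodes : Set V)) ≤ nodes.card :=
        finrank_span_finset_le_card nodes
    _ ≤ (Finset.Icc (-(K : ℤ)) K).card + 1 :=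
        (Finset.card_insert_le _ _).trans (Nat.add_le_add_right Finset.card_image_le 1)
    _ = 2 * K + 2 := by
        rw [Int.card_Icc]
        omega

variable {κ : ℝ} [InnerProductSpace ℂ V] [FiniteDimensional ℂ V]

theorem bestGoal_le_goal (S : DiscreteSpace κ Ω V) {α : ℝ} {u u' : ℝ → V} {R : ℕ}
    {W : Submodule ℂ V} (hW : Module.finrank ℂ W ≤ R) : bestGoal S α u u' R ≤ goal S α u u' W :=
  iInf₂_le W hW

/-- The hypotheses on the semidiscrete problem: `u₀h = Q_h u₀`, the `L²` projections of `f(0)`,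
`Δu₀` and `u₀`, the assumptions on the source term `f`, and the solution `u` with its derivative
`u'`. -/
structure IsSemidiscreteProblem (S : DiscreteSpace κ Ω V) (α d C₀ : ℝ) (f f' : ℝ → AntiDual V)
    (F F' : ℂ → AntiDual V) (f₀ : H1 Ω) (u₀ : H2 Ω) (u₀h Pf₀ PΔu₀ Pu₀ : V) (u u' : ℝ → V) :
    Prop where
  isH1Proj : S.IsH1Proj u₀.toH1 u₀h
  isL2Proj_source : S.IsL2Proj f₀.val Pf₀
  isL2Proj_laplacian : S.IsL2Proj u₀.laplacian PΔu₀
  isL2Proj_initial : S.IsL2Proj u₀.val Pu₀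
  admissible : Admissible S α d C₀ f f' F F' f₀
  isSolution : S.IsSolution f u₀h u u'

namespace IsSemidiscreteProblem

variable {S : DiscreteSpace κ Ω V} {c α d C₀ : ℝ} {f f' : ℝ → AntiDual V}
  {F F' : ℂ → AntiDual V} {f₀ : H1 Ω} {u₀ : H2 Ω} {u₀h Pf₀ PΔu₀ Pu₀ : V} {u u' : ℝ → V}
  (h : IsSemidiscreteProblem S α d C₀ f f' F F' f₀ u₀ u₀h Pf₀ PΔu₀ Pu₀ u u')

include h

theorem norm_le (τ : ℝ) : ‖F τ‖ ≤ C₀ / √(1 + τ ^ 2) :=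
  (le_add_of_nonneg_right (norm_nonneg _)).trans (h.admissible.decay τ)

theorem norm_deriv_le (τ : ℝ) : ‖F' τ‖ ≤ C₀ / √(1 + τ ^ 2) :=
  (le_add_of_nonneg_left (norm_nonneg _)).trans (h.admissible.decay τ)

section Eigenbasis

variable {ι : Type*} [Fintype ι] {b : OrthonormalBasis ι ℂ V} {m p : ι → ℝ}

theorem laplace_eq_resolvent (hb : S.IsEigenbasis b m p) (hd : d ∈ Ioo 0 (Real.pi / 2))
    (hα : 0 < α) (τ : ℝ) :
    laplace u (α + Complex.I * τ) = resolvent b m p (α + Complex.I * τ) (F τ) u₀h := by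
  have hevo := hb.isDiagonalEvolution h.admissible h.isSolution
  rw [h.admissible.extends_f.eq_on_line hd
    (hevo.laplaceIntegrable_source (by simpa using hα)) τ,
    hevo.laplace_eq_resolvent (by simpa using hα)]

theorem laplace_deriv_eq_resolvent (hb : S.IsEigenbasis b m p) (hd : d ∈ Ioo 0 (Real.pi / 2))
    (hα : 0 < α) (τ : ℝ) :
    laplace u' (α + Complex.I * τ) =
      resolvent b m p (α + Complex.I * τ) (F' τ) (Pf₀ + PΔu₀ + (u₀h - Pu₀)) := by
  have hevo := hb.isDiagonalEvolution h.admissible h.isSolution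
  rw [h.admissible.extends_deriv.eq_on_line hd
    (LaplaceIntegrable.of_memLp h.admissible.memLp_deriv (by simpa using hα)) τ]
  refine hevo.laplace_deriv_eq_resolvent (by simpa using hα) fun j => ?_
  rw [← hb.toDual_apply, ← hb.A_apply, h.admissible.initial]
  exact S.l2Functional_sub_A_eq_toDual h.isH1Proj h.isL2Proj_source h.isL2Proj_laplacian
    h.isL2Proj_initial (b j)

end Eigenbasis

theorem eq_laplace (hΩ : IsOpen Ω) (hd : d ∈ Ioo 0 (Real.pi / 2)) (hα : 0 < α) {τ : ℝ} {w : V}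
    (hw : S.IsLaplaceSolution (α + Complex.I * τ) (F τ + S.toDual u₀h) w) :
    w = laplace u (α + Complex.I * τ) := by
  obtain ⟨b, m, p, hb⟩ := S.exists_isEigenbasis hΩ
  rw [h.laplace_eq_resolvent hb hd hα, hb.eq_resolvent (by simpa using hα) hw]

theorem sq_add_norm_initial_le :
    (C₀ + ‖u₀h‖) ^ 2 ≤
      (2 * C₀ ^ 2 + 6) * (max 1 κ * initialSq Pf₀ PΔu₀ (u₀h - Pu₀) u₀) := by
  have hone := one_le_initialSq Pf₀ PΔu₀ (u₀h - Pu₀) u₀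
  refine add_sq_le_mul (one_le_mul_of_one_le_of_one_le (le_max_left 1 κ) hone) ?_
  calc ‖u₀h‖ ^ 2 ≤ max 1 κ * u₀.normSq := S.norm_sq_le_mul_normSq h.isH1Proj
    _ ≤ max 1 κ * initialSq Pf₀ PΔu₀ (u₀h - Pu₀) u₀ := by gcongr; exact normSq_le_initialSq ..
    _ ≤ _ := le_mul_of_one_le_left (by positivity) (by norm_num)

theorem goal_le_of_lintegral_le {x : ℝ} (hx : 0 ≤ x) (hc : ∀ v, ‖(S.emb v).1‖ ≤ c * ‖v‖)
    (hu : LaplaceIntegrable u α) (hu' : LaplaceIntegrable u' α) {W : Submodule ℂ V}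
    (hW : ∫⁻ τ : ℝ, ‖laplace u (α + Complex.I * τ) -
        W.starProjection (laplace u (α + Complex.I * τ))‖ₑ ^ 2 ≤
      ENNReal.ofReal (max 1 κ ^ 2 * x) *
        (nTwoSq d F + ENNReal.ofReal ((C₀ + ‖u₀h‖) ^ 2)))
    (hW' : ∫⁻ τ : ℝ, ‖laplace u' (α + Complex.I * τ) -
        W.starProjection (laplace u' (α + Complex.I * τ))‖ₑ ^ 2 ≤
      ENNReal.ofReal (max 1 κ ^ 2 * x) *
        (nTwoSq d F' + ENNReal.ofReal ((C₀ + ‖Pf₀ + PΔu₀ + (u₀h - Pu₀)‖) ^ 2))) :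
    goal S α u u' W ≤ ENNReal.ofReal (errorConst κ c C₀ * x) *
      (nTwoSq d F + nTwoSq d F' +
        ENNReal.ofReal (initialSq Pf₀ PΔu₀ (u₀h - Pu₀) u₀)) := by
  have hM : 1 ≤ (2 * C₀ ^ 2 + 6) * max 1 κ :=
    one_le_mul_of_one_le_of_one_le (by nlinarith) (le_max_left 1 κ)
  have hconst : errorConst κ c C₀ * x =
      (1 + c ^ 4) * (max 1 κ ^ 2 * x * ((2 * C₀ ^ 2 + 6) * max 1 κ)) := by
    rw [errorConst]
    ring
  rw [hconst]
  refine (goal_le S hc hu hu' W).trans (add_ofReal_mul_le (by positivity) (hW.trans ?_)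
    (hW'.trans ?_))
  · refine ofReal_mul_add_ofReal_le (by positivity) hM ?_ le_self_add
    rw [mul_assoc]
    exact h.sq_add_norm_initial_le
  · refine ofReal_mul_add_ofReal_le (by positivity) hM ?_ le_add_self
    rw [mul_assoc]
    exact sq_add_norm_initial_deriv_le ..

theorem goal_le_angleConst (hΩ : IsOpen Ω) (hd : d ∈ Ioo 0 (Real.pi / 2)) (hα : 1 ≤ α)
    (hc : ∀ v, ‖(S.emb v).1‖ ≤ c * ‖v‖) (W : Submodule ℂ V) :
    goal S α u u' W ≤ ENNReal.ofReal (errorConst κ c C₀ * (angleConst d * 1)) *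
      (nTwoSq d F + nTwoSq d F' +
        ENNReal.ofReal (initialSq Pf₀ PΔu₀ (u₀h - Pu₀) u₀)) := by
  obtain ⟨b, m, p, hb⟩ := S.exists_isEigenbasis hΩ
  have hα_pos : 0 < α := one_pos.trans_le hα
  have hevo := hb.isDiagonalEvolution h.admissible h.isSolution
  have hangle := angleConst_pos hd
  refine h.goal_le_of_lintegral_le (by positivity) hc (hevo.laplaceIntegrable (by simpa))
    (hevo.laplaceIntegrable_deriv (by simpa)) ?_ ?_
  · simp only [h.laplace_eq_resolvent hb hd hα_pos]
    exact (hb.isCoercive hα).lintegral_le_angleConst W hd h.norm_le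
  · simp only [h.laplace_deriv_eq_resolvent hb hd hα_pos]
    exact (hb.isCoercive hα).lintegral_le_angleConst W hd h.norm_deriv_le

theorem goal_le_angleConst_mul_exp (hΩ : IsOpen Ω) (hd : d ∈ Ioo 0 (Real.pi / 2)) (hα : 1 ≤ α)
    (hc : ∀ v, ‖(S.emb v).1‖ ≤ c * ‖v‖) {K : ℕ} (hK : 1 ≤ K) {W : Submodule ℂ V} (hW : u₀h ∈ W)
    (hnodes : ∀ k : ℤ, |k| ≤ K → laplace u (α + Complex.I * sincPoint d K k) ∈ W) :
    goal S α u u' W ≤ ENNReal.ofReal (errorConst κ c C₀ *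
        (angleConst d * (√K * Real.exp (-√(2 * Real.pi * d * K))))) *
      (nTwoSq d F + nTwoSq d F' +
        ENNReal.ofReal (initialSq Pf₀ PΔu₀ (u₀h - Pu₀) u₀)) := by
  have := FiniteDimensional.complete ℂ V
  obtain ⟨b, m, p, hb⟩ := S.exists_isEigenbasis hΩ
  have hα_pos : 0 < α := one_pos.trans_le hα
  have hevo := hb.isDiagonalEvolution h.admissible h.isSolution
  have hangle := angleConst_pos hd
  refine h.goal_le_of_lintegral_le (by positivity) hc (hevo.laplaceIntegrable (by simpa))
    (hevo.laplaceIntegrable_deriv (by simpa)) ?_ ?_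
  · simp only [h.laplace_eq_resolvent hb hd hα_pos] at hnodes ⊢
    exact (hb.isCoercive hα).lintegral_le_angleConst_mul_exp W hd h.admissible.extends_f.mem
      h.norm_le hK hnodes
  · have hnodes' : ∀ k : ℤ, |k| ≤ K → laplace u' (α + Complex.I * sincPoint d K k) ∈ W := by
      intro k hk
      rw [← W.add_mem_iff_right hW, ← hevo.smul_laplace (by simpa)]
      exact W.smul_mem _ (hnodes k hk)
    simp only [h.laplace_deriv_eq_resolvent hb hd hα_pos] at hnodes' ⊢
    exact (hb.isCoercive hα).lintegral_le_angleConst_mul_exp W hd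
      h.admissible.extends_deriv.mem h.norm_deriv_le hK hnodes'

theorem goal_span_le (hΩ : IsOpen Ω) (hd : d ∈ Ioo 0 (Real.pi / 2)) (hα : 1 ≤ α)
    (hc : ∀ v, ‖(S.emb v).1‖ ≤ c * ‖v‖) {K R : ℕ} (hK : 1 ≤ K) (hKR : K ≤ R) (hRK : R ≤ 2 * K + 3)
    {w : ℤ → V} (hw : ∀ k : ℤ, |k| ≤ K → w k = laplace u (α + Complex.I * sincPoint d K k)) :
    goal S α u u' (Submodule.span ℂ ({u₀h} ∪ w '' {k : ℤ | |k| ≤ (K : ℤ)})) ≤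
      ENNReal.ofReal (Real.exp 4 * errorConst κ c C₀ * (angleConst d * rate d R)) *
        (nTwoSq d F + nTwoSq d F' +
          ENNReal.ofReal (initialSq Pf₀ PΔu₀ (u₀h - Pu₀) u₀)) := by
  refine (h.goal_le_angleConst_mul_exp hΩ hd hα hc hK (Submodule.subset_span (Or.inl rfl))
    fun k hk => Submodule.subset_span (Or.inr ⟨k, hk, hw k hk⟩)).trans ?_
  exact mul_le_mul_left (ofReal_errorConst_mul_le hd (sqrt_mul_exp_le_rate hd hKR hRK)) _

theorem bestGoal_le (hΩ : IsOpen Ω) (hd : d ∈ Ioo 0 (Real.pi / 2)) (hα : 1 ≤ α)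
    (hc : ∀ v, ‖(S.emb v).1‖ ≤ c * ‖v‖) {R : ℕ} (hR : 1 ≤ R) :
    bestGoal S α u u' R ≤
      ENNReal.ofReal (Real.exp 4 * errorConst κ c C₀ * (angleConst d * rate d R)) *
        (nTwoSq d F + nTwoSq d F' +
          ENNReal.ofReal (initialSq Pf₀ PΔu₀ (u₀h - Pu₀) u₀)) := by
  rcases le_or_gt R 3 with hR₃ | hR₃
  · refine (bestGoal_le_goal S (W := ⊥) (by simp)).trans
      ((h.goal_le_angleConst hΩ hd hα hc ⊥).trans ?_)
    exact mul_le_mul_left (ofReal_errorConst_mul_le hd (one_le_rate hd hR hR₃)) _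
  · obtain ⟨K, hK, hdim, hRK⟩ : ∃ K : ℕ, 1 ≤ K ∧ 2 * K + 2 ≤ R ∧ R ≤ 2 * K + 3 :=
      ⟨(R - 2) / 2, by omega, by omega, by omega⟩
    refine le_trans ?_ (h.goal_span_le hΩ hd hα hc hK (by omega) hRK fun k _ => rfl)
    exact bestGoal_le_goal S ((finrank_span_nodes_le u₀h _ K).trans hdim)

end IsSemidiscreteProblem

end ErrorBound

end LaplaceRB

end

open LaplaceRB in
theorem lemma4p5_general :
    ∃ C : ℝ → ℝ, (∀ d ∈ Ioo 0 (Real.pi / 2), 0 < C d) ∧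
      Tendsto C (𝓝[<] (Real.pi / 2)) atTop ∧
      ∀ (n : ℕ) (Ω : Set (RSpace n)), IsOpen Ω → ∀ κ : ℝ, 0 ≤ κ →
      (0 < κ ∨ ∃ (i : Fin n) (L : ℝ), ∀ x ∈ Ω, |x i| ≤ L) → ∀ C₀ : ℝ,
      ∃ c : ℝ, 0 < c ∧
        ∀ d ∈ Ioo 0 (Real.pi / 2), ∀ α : ℝ, 1 ≤ α →
        ∀ (V : Type) [NormedAddCommGroup V] [InnerProductSpace ℂ V] [FiniteDimensional ℂ V]
          (S : DiscreteSpace κ Ω V) (f f' : ℝ → AntiDual V) (F F' : ℂ → AntiDual V)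
          (f₀ : H1 Ω) (u₀ : H2 Ω) (u₀h Pf₀ PΔu₀ Pu₀ : V) (u u' : ℝ → V),
          IsSemidiscreteProblem S α d C₀ f f' F F' f₀ u₀ u₀h Pf₀ PΔu₀ Pu₀ u u' →
          (∀ R : ℕ, 1 ≤ R → bestGoal S α u u' R ≤ ENNReal.ofReal (c * (C d * rate d R)) *
            (nTwoSq d F + nTwoSq d F' +
              ENNReal.ofReal (initialSq Pf₀ PΔu₀ (u₀h - Pu₀) u₀))) ∧
          (∀ K : ℕ, 1 ≤ K → ∀ w : ℤ → V,
            (∀ k : ℤ, |k| ≤ (K : ℤ) → S.IsLaplaceSolution (α + Complex.I * sincPoint d K k)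
              (F (sincPoint d K k) + S.toDual u₀h) (w k)) →
            goal S α u u' (Submodule.span ℂ ({u₀h} ∪ w '' {k : ℤ | |k| ≤ (K : ℤ)})) ≤
              ENNReal.ofReal (c * (C d * rate d (2 * K + 2))) *
                (nTwoSq d F + nTwoSq d F' +
                  ENNReal.ofReal (initialSq Pf₀ PΔu₀ (u₀h - Pu₀) u₀))) := by
  refine ⟨angleConst, fun d hd => angleConst_pos hd, tendsto_angleConst, ?_⟩
  intro n Ω hΩ κ hκ hκΩ C₀
  obtain ⟨c, hc⟩ := DiscreteSpace.exists_norm_emb_fst_le hΩ hκ hκΩ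
  refine ⟨Real.exp 4 * errorConst κ c C₀, mul_pos (Real.exp_pos 4) (errorConst_pos κ c C₀), ?_⟩
  intro d hd α hα V _ _ _ S f f' F F' f₀ u₀ u₀h Pf₀ PΔu₀ Pu₀ u u' h
  refine ⟨fun R hR => h.bestGoal_le hΩ hd hα (hc V S) hR, fun K hK w hw => ?_⟩
  exact h.goal_span_le hΩ hd hα (hc V S) hK (by omega) (by omega) fun k hk =>
    h.eq_laplace hΩ hd (one_pos.trans_le hα) (hw k hk)

theorem lemma4p5 :
    ∃ C : ℝ → ℝ → ℝ,
      (∀ d ∈ Ioo 0 (Real.pi / 2), ∀ α : ℝ, 1 ≤ α → 0 < C d α) ∧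
      (∀ α : ℝ, 1 ≤ α → Tendsto (fun d => C d α) (𝓝[<] (Real.pi / 2)) atTop) ∧
      ∀ (n : ℕ), (n = 2 ∨ n = 3) →
      ∀ (Ω : Set (LaplaceRB.RSpace n)), IsOpen Ω → Bornology.IsBounded Ω →
      ∀ (κ : ℝ), (κ = 0 ∨ κ = 1) → ∀ (C₀ : ℝ),
      ∃ c : ℝ, 0 < c ∧
        ∀ d ∈ Ioo 0 (Real.pi / 2), ∀ α : ℝ, 1 ≤ α →
        ∀ (V : Type) [NormedAddCommGroup V] [InnerProductSpace ℂ V] [FiniteDimensional ℂ V]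
          (S : LaplaceRB.DiscreteSpace κ Ω V)
          (f f' : ℝ → LaplaceRB.AntiDual V) (F F' : ℂ → LaplaceRB.AntiDual V)
          (f₀ : LaplaceRB.H1 Ω) (u₀ : LaplaceRB.H2 Ω)
          (u₀h Pf₀ PΔu₀ Pu₀ : V) (u u' : ℝ → V),
          LaplaceRB.DiscreteSpace.IsH1Proj S u₀.toH1 u₀h →
          LaplaceRB.DiscreteSpace.IsL2Proj S f₀.val Pf₀ →
          LaplaceRB.DiscreteSpace.IsL2Proj S u₀.laplacian PΔu₀ →
          LaplaceRB.DiscreteSpace.IsL2Proj S u₀.val Pu₀ →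
          LaplaceRB.Admissible S α d C₀ f f' F F' f₀ →
          LaplaceRB.DiscreteSpace.IsSolution S f u₀h u u' →
          (∀ R : ℕ, 1 ≤ R →
            LaplaceRB.bestGoal S α u u' R ≤
              ENNReal.ofReal (c * (C d α * LaplaceRB.rate d R)) *
                (LaplaceRB.nTwoSq d F + LaplaceRB.nTwoSq d F' +
                  ENNReal.ofReal (1 + ‖Pf₀‖ ^ 2 + ‖PΔu₀‖ ^ 2 + ‖u₀h - Pu₀‖ ^ 2 + u₀.normSq))) ∧
          (∀ K : ℕ, 1 ≤ K → ∀ w : ℤ → V,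
            (∀ k : ℤ, |k| ≤ (K : ℤ) →
              LaplaceRB.DiscreteSpace.IsLaplaceSolution S
                (α + Complex.I * LaplaceRB.sincPoint d K k)
                (F (LaplaceRB.sincPoint d K k) + LaplaceRB.DiscreteSpace.toDual S u₀h) (w k)) →
            LaplaceRB.goal S α u u'
                (Submodule.span ℂ ({u₀h} ∪ w '' {k : ℤ | |k| ≤ (K : ℤ)})) ≤
              ENNReal.ofReal (c * (C d α * LaplaceRB.rate d (2 * K + 2))) *
                (LaplaceRB.nTwoSq d F + LaplaceRB.nTwoSq d F' +
                  ENNReal.ofReal (1 + ‖Pf₀‖ ^ 2 + ‖PΔu₀‖ ^ 2 + ‖u₀h - Pu₀‖ ^ 2 + u₀.normSq))) := by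
  obtain ⟨C, hC_pos, hC_tendsto, hbound⟩ := lemma4p5_general
  refine ⟨fun d _ => C d, fun d hd _ _ => hC_pos d hd, fun _ _ => hC_tendsto, ?_⟩
  intro n hn Ω hΩ hΩ_bdd κ hκ C₀
  obtain ⟨L, hL⟩ := hΩ_bdd.exists_norm_le
  have i : Fin n := ⟨0, by omega⟩
  obtain ⟨c, hc_pos, hc⟩ := hbound n Ω hΩ κ (by rcases hκ with rfl | rfl <;> norm_num)
    (Or.inr ⟨i, L, fun x hx => (PiLp.norm_apply_le x i).trans (hL x hx)⟩) C₀
  exact ⟨c, hc_pos, fun d hd α hα V _ _ _ S f f' F F' f₀ u₀ u₀h Pf₀ PΔu₀ Pu₀ u u' hu₀h hPf hPΔ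
    hPu hadm hsol => hc d hd α hα V S f f' F F' f₀ u₀ u₀h Pf₀ PΔu₀ Pu₀ u u'
      ⟨hu₀h, hPf, hPΔ, hPu, hadm, hsol⟩⟩
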